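/- Let $\mathbb{T}=\mathbb{R}/2\pi\mathbb{Z}$, fix $0<\epsilon_0<\tfrac12$ and let $L,M>0$. For $f\in L^2(\mathbb{R}^2_x\times\mathbb{T}_y)$ put $\|f\|_{H^1}=\|\langle\nabla_x\rangle f\|_{L^2}+\|\langle\nabla_y\rangle f\|_{L^2}$, and for $g$ on $\mathbb{T}$ put $\|g\|_{H^s(\mathbb{T})}^2=\sum_{k\in\mathbb{Z}}(1+k^2)^s|g_k|^2$ with $g_k=(2\pi)^{-1/2}\int_{\mathbb{T}}g(y)e^{-iky}\,dy$. Let $u\in C(\mathbb{R};H^1(\mathbb{R}^2\times\mathbb{T}))$ be a global solution of the defocusing cubic nonlinear Schrödinger equation $$i\partial_t u+\Delta_{\mathbb{R}^2\times\mathbb{T}}u=|u|^2u ,$$ that is, $u(t)=e^{it\Delta_{\mathbb{R}^2\times\mathbb{T}}}u(0)-i\int_0^t e^{i(t-s)\Delta_{\mathbb{R}^2\times\mathbb{T}}}\big(|u|^2u\big)(s)\,ds$ in $L^2(\mathbb{R}^2\times\mathbb{T})$ for all $t\in\mathbb{R}$. Suppose that $$\|u\|_{L^4_tL^4_xH^{1-\epsilon_0}_y}=\Big(\int_{\mathbb{R}}\int_{\mathbb{R}^2}\|u(t,x,\cdot)\|_{H^{1-\epsilon_0}(\mathbb{T})}^4\,dx\,dt\Big)^{1/4}\le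 L\qquad\text{and}\qquad \|u(0)\|_{H^1}\le M .$$ Then $u$ scatters in $H^1(\mathbb{R}^2\times\mathbb{T})$: there exist $u_+,u_-\in H^1(\mathbb{R}^2\times\mathbb{T})$ such that $$\|u(t)-e^{it\Delta_{\mathbb{R}^2\times\mathbb{T}}}u_\pm\|_{H^1(\mathbb{R}^2\times\mathbb{T})}\to0\qquad\text{as }t\to\pm\infty .$$ -/

import Mathlib

noncomputable section

namespace Waveguide

open MeasureTheory Filter Topology
open scoped ENNReal FourierTransform

/-- `2π > 0`, needed for the circle of length `2π`. -/
instance factTwoPiPos : Fact ((0 : ℝ) < 2 * Real.pi) := ⟨Real.two_pi_pos⟩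

/-- The torus `𝕋 = ℝ / 2πℤ`; its `volume` is Lebesgue measure, of total mass `2π`. -/
abbrev Torus : Type := AddCircle (2 * Real.pi)

/-- The Euclidean plane `ℝ²`. -/
abbrev Plane : Type := EuclideanSpace ℝ (Fin 2)

/-- `L²(ℝ²)`, complex valued. -/
abbrev L2Plane : Type := Lp ℂ 2 (volume : Measure Plane)

/-- `L²(ℝ² × 𝕋)`, complex valued. -/
abbrev L2 : Type := Lp ℂ 2 (volume : Measure (Plane × Torus))

/-! ### Fourier series in `y` -/

/-- The Fourier coefficient `(2π)^{-1/2} ∫_𝕋 g(y) e^{-iky} dy`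
(for the circle of length `2π`, `fourier k y` is `e^{iky}`). -/
def torusCoeff (k : ℤ) (g : Torus → ℂ) : ℂ :=
  ((Real.sqrt (2 * Real.pi) : ℝ) : ℂ)⁻¹ * ∫ y : Torus, g y * fourier (-k) y

/-- The Sobolev norm `‖g‖_{H^s(𝕋)} = (∑_k ⟨k⟩^{2s} |g_k|²)^{1/2}`, with `⟨k⟩ = (1 + k²)^{1/2}`. -/
def torusSobolevNorm (s : ℝ) (g : Torus → ℂ) : ℝ≥0∞ :=
  (∑' k : ℤ, ENNReal.ofReal ((1 + (k : ℝ) ^ 2) ^ s) * ‖torusCoeff k g‖ₑ ^ 2) ^ (1 / 2 : ℝ)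

theorem norm_fourier_apply (k : ℤ) (y : Torus) : ‖(fourier k y : ℂ)‖ = 1 := by
  rw [fourier_apply]
  exact Circle.norm_coe _

theorem enorm_torusCoeff_sq_le (k : ℤ) {g : Torus → ℂ} (hg : AEStronglyMeasurable g volume) :
    ‖torusCoeff k g‖ₑ ^ 2 ≤ ∫⁻ y, ‖g y‖ₑ ^ 2 := by
  have hpi : (0 : ℝ) < 2 * Real.pi := Real.two_pi_pos
  have hvol : (volume : Measure Torus) Set.univ = ENNReal.ofReal (2 * Real.pi) :=
    AddCircle.measure_univ (2 * Real.pi)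
  have h1 : ‖∫ y : Torus, g y * fourier (-k) y‖ₑ ≤ ∫⁻ y, ‖g y‖ₑ := by
    refine (enorm_integral_le_lintegral_enorm _).trans (le_of_eq ?_)
    refine lintegral_congr fun y => ?_
    rw [← ofReal_norm, ← ofReal_norm, norm_mul, norm_fourier_apply, mul_one]
  have h2 : (∫⁻ y, ‖g y‖ₑ) ^ 2 ≤ (∫⁻ y, ‖g y‖ₑ ^ 2) * ENNReal.ofReal (2 * Real.pi) := by
    have h := ENNReal.lintegral_mul_le_Lp_mul_Lq (volume : Measure Torus)
      Real.HolderConjugate.two_two hg.enorm (aemeasurable_const (b := (1 : ℝ≥0∞)))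
    simp only [Pi.mul_apply, mul_one, lintegral_const, hvol,
      ENNReal.rpow_two] at h
    refine (pow_le_pow_left' h 2).trans (le_of_eq ?_)
    rw [mul_pow, ← ENNReal.rpow_two, ← ENNReal.rpow_two, ← ENNReal.rpow_mul, ← ENNReal.rpow_mul]
    norm_num
  have h3 : ‖((Real.sqrt (2 * Real.pi) : ℝ) : ℂ)⁻¹‖ₑ ^ 2 = (ENNReal.ofReal (2 * Real.pi))⁻¹ := by
    rw [← ofReal_norm, ← ENNReal.ofReal_pow (norm_nonneg _), ← ENNReal.ofReal_inv_of_pos hpi,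
      norm_inv, Complex.norm_real, Real.norm_eq_abs, inv_pow, sq_abs, Real.sq_sqrt hpi.le]
  rw [torusCoeff, enorm_mul, mul_pow, h3]
  calc (ENNReal.ofReal (2 * Real.pi))⁻¹ * ‖∫ y : Torus, g y * fourier (-k) y‖ₑ ^ 2
      ≤ (ENNReal.ofReal (2 * Real.pi))⁻¹ *
          ((∫⁻ y, ‖g y‖ₑ ^ 2) * ENNReal.ofReal (2 * Real.pi)) := by
        gcongr
        exact (pow_le_pow_left' h1 2).trans h2
    _ = ∫⁻ y, ‖g y‖ₑ ^ 2 := by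
        rw [mul_comm, mul_assoc, ENNReal.mul_inv_cancel (by simpa using hpi)
          ENNReal.ofReal_ne_top, mul_one]

theorem memLp_partialCoeff (k : ℤ) (f : L2) :
    MemLp (fun x : Plane => torusCoeff k (fun y => f (x, y))) 2 volume := by
  have hf : AEStronglyMeasurable (f : Plane × Torus → ℂ)
      ((volume : Measure Plane).prod (volume : Measure Torus)) := Lp.aestronglyMeasurable f
  have hm : AEStronglyMeasurable (fun p : Plane × Torus => f p * fourier (-k) p.2)
      ((volume : Measure Plane).prod (volume : Measure Torus)) :=
    hf.mul (((fourier (-k)).continuous.comp continuous_snd).aestronglyMeasurable)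
  refine ⟨hm.integral_prod_right'.const_mul _, ?_⟩
  rw [eLpNorm_lt_top_iff_lintegral_rpow_enorm_lt_top two_ne_zero ENNReal.ofNat_ne_top]
  have hfin : ∫⁻ p, ‖f p‖ₑ ^ 2 ∂((volume : Measure Plane).prod (volume : Measure Torus)) < ∞ := by
    have h := (eLpNorm_lt_top_iff_lintegral_rpow_enorm_lt_top two_ne_zero
      ENNReal.ofNat_ne_top).1 (Lp.memLp f).2
    simp only [ENNReal.toReal_ofNat, ENNReal.rpow_two] at h
    exact h
  rw [lintegral_prod _ (hf.enorm.pow_const 2)] at hfin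
  refine lt_of_le_of_lt (lintegral_mono_ae ?_) hfin
  filter_upwards [hf.prodMk_left] with x hx
  simpa using enorm_torusCoeff_sq_le k hx

/-- The `k`-th Fourier coefficient in `y`, as a function in `L²(ℝ²)`:
`f_k(x) = (2π)^{-1/2} ∫_𝕋 f(x, y) e^{-iky} dy`. -/
def partialCoeff (k : ℤ) (f : L2) : L2Plane :=
  (memLp_partialCoeff k f).toLp _

theorem memLp_mode (k : ℤ) (φ : L2Plane) :
    MemLp (fun p : Plane × Torus =>
      φ p.1 * (((Real.sqrt (2 * Real.pi) : ℝ) : ℂ)⁻¹ * fourier k p.2)) 2 volume := by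
  have h1 : MemLp (fun p : Plane × Torus => φ p.1) 2
      ((volume : Measure Plane).prod (volume : Measure Torus)) :=
    (Lp.memLp φ).comp_fst volume
  have hc : Continuous fun p : Plane × Torus =>
      ((Real.sqrt (2 * Real.pi) : ℝ) : ℂ)⁻¹ * fourier k p.2 :=
    continuous_const.mul ((fourier k).continuous.comp continuous_snd)
  refine h1.of_le_mul (c := ‖((Real.sqrt (2 * Real.pi) : ℝ) : ℂ)⁻¹‖)
    (h1.1.mul hc.aestronglyMeasurable) (Eventually.of_forall fun p => le_of_eq ?_)
  rw [norm_mul, norm_mul, norm_fourier_apply, mul_one, mul_comm]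

/-- The function `(x, y) ↦ φ(x) (2π)^{-1/2} e^{iky}` in `L²(ℝ² × 𝕋)`. -/
def mode (k : ℤ) (φ : L2Plane) : L2 :=
  (memLp_mode k φ).toLp _

/-! ### The Sobolev space `H¹(ℝ² × 𝕋)`

Mathlib's Fourier transform `𝓕` on `L²(ℝ²)` is the unitary one with kernel `e^{-2πi x·ξ}`, so that
`-Δ_x` has the symbol `(2π|ξ|)²`. -/

/-- `‖f‖_{H¹} = ‖⟨∇_x⟩ f‖_{L²} + ‖⟨∇_y⟩ f‖_{L²}`, with value `∞` if `f` is not in `H¹`. -/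
def h1Norm (f : L2) : ℝ≥0∞ :=
  (∑' k : ℤ, ∫⁻ ξ : Plane, ENNReal.ofReal (1 + (2 * Real.pi * ‖ξ‖) ^ 2) *
      ‖(𝓕 (partialCoeff k f) : L2Plane) ξ‖ₑ ^ 2) ^ (1 / 2 : ℝ) +
  (∑' k : ℤ, ∫⁻ ξ : Plane, ENNReal.ofReal (1 + (k : ℝ) ^ 2) *
      ‖(𝓕 (partialCoeff k f) : L2Plane) ξ‖ₑ ^ 2) ^ (1 / 2 : ℝ)

/-- Membership in `H¹(ℝ² × 𝕋)`. -/
def MemH1 (f : L2) : Prop := h1Norm f < ∞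

/-! ### The free Schrödinger group -/

/-- The symbol `e^{-it(|2πξ|² + k²)}` of `e^{itΔ}` on `ℝ² × 𝕋`. -/
def schrodingerSymbol (t : ℝ) (k : ℤ) (ξ : Plane) : ℂ :=
  Complex.exp (-(Complex.I * ((t * ((2 * Real.pi * ‖ξ‖) ^ 2 + (k : ℝ) ^ 2) : ℝ) : ℂ)))

theorem norm_schrodingerSymbol (t : ℝ) (k : ℤ) (ξ : Plane) : ‖schrodingerSymbol t k ξ‖ = 1 := by
  rw [schrodingerSymbol, ← mul_neg, ← Complex.ofReal_neg, mul_comm,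
    Complex.norm_exp_ofReal_mul_I]

theorem memLp_symbol_mul (t : ℝ) (k : ℤ) (φ : L2Plane) :
    MemLp (fun ξ => schrodingerSymbol t k ξ * φ ξ) 2 volume := by
  have hc : Continuous fun ξ : Plane => schrodingerSymbol t k ξ := by
    unfold schrodingerSymbol
    fun_prop
  refine (Lp.memLp φ).of_le (hc.aestronglyMeasurable.mul (Lp.aestronglyMeasurable φ))
    (Eventually.of_forall fun ξ => ?_)
  rw [norm_mul, norm_schrodingerSymbol, one_mul]

/-- Fourier multiplier on `L²(ℝ²)` with symbol `ξ ↦ e^{-it(|2πξ|² + k²)}`. -/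
def modePropagator (t : ℝ) (k : ℤ) (φ : L2Plane) : L2Plane :=
  𝓕⁻ ((memLp_symbol_mul t k (𝓕 φ : L2Plane)).toLp _ : L2Plane)

/-- The free Schrödinger group `e^{itΔ}` on `L²(ℝ² × 𝕋)`:
`e^{itΔ} f = ∑_k (e^{it(Δ_x - k²)} f_k)(x) (2π)^{-1/2} e^{iky}`
(an orthogonal sum, unconditionally convergent in `L²`). -/
def freeEvolution (t : ℝ) (f : L2) : L2 :=
  ∑' k : ℤ, mode k (modePropagator t k (partialCoeff k f))

/-! ### Solutions of the cubic equation and the space-time norm -/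

/-- `u` is a global solution in `C(ℝ; H¹(ℝ² × 𝕋))` of `i ∂_t u + Δ u = |u|² u`: it satisfies
Duhamel's formula `u(t) = e^{itΔ} u(0) - i ∫_0^t e^{i(t-s)Δ} (|u|² u)(s) ds`, `t ∈ ℝ`, where `N s`
is `(|u|² u)(s)` as an element of `L²` (recall `H¹ ⊂ L⁶`) and the integral is that of an `L²`-valued
function. -/
structure IsGlobalSolution (u : ℝ → L2) : Prop where
  memH1 : ∀ t, MemH1 (u t)
  continuous_h1 : ∀ t₀, Tendsto (fun t => h1Norm (u t - u t₀)) (𝓝 t₀) (𝓝 0)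
  duhamel : ∃ N : ℝ → L2,
    (∀ s, ∀ᵐ p, N s p = ((‖u s p‖ ^ 2 : ℝ) : ℂ) * u s p) ∧
    ∀ t, IntervalIntegrable (fun s => freeEvolution (t - s) (N s)) volume 0 t ∧
      u t = freeEvolution t (u 0) - Complex.I • ∫ s in (0 : ℝ)..t, freeEvolution (t - s) (N s)

/-- `‖u‖_{L⁴_t L⁴_x H^s_y(ℝ × ℝ² × 𝕋)}`. -/
def spaceTimeNorm (s : ℝ) (u : ℝ → L2) : ℝ≥0∞ :=
  (∫⁻ t : ℝ, ∫⁻ x : Plane, torusSobolevNorm s (fun y => u t (x, y)) ^ 4) ^ (1 / 4 : ℝ)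

end Waveguide

end

/-!
A solution with finite `L⁴_t L⁴_x H^{1-ε₀}_y` norm scatters because the equation, and every
difference equation obtained from it by translation, is a *linear* Schrödinger equation with a
potential that this norm controls.

Write `e^{itΔ}` for the free group, `v(t) = e^{-itΔ} u(t)` for the profile of the solution, and
`a`, `b` for the dual norms of `L⁴_x L²_y` and `L^{4/3}_x L²_y`. Three facts carry the argument.

* *Strichartz.* `‖e^{itΔ} f‖_{L⁴_t L⁴_x L²_y} ≲ ‖f‖_{L²}` (`isStrichartzPair_freeEvolution`). By
  Minkowski's inequality this reduces to the plane (`strichartz_modePropagator`), where the square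
  of the free wave is, in Fourier variables and for fixed output frequency `ξ`, an oscillatory
  integral over `η ∈ ℝ²` with phase `t (|η|² + |ξ - η|²)`. The image of Lebesgue measure under this
  phase has bounded density, because the area of an annulus in the plane is proportional to the
  increment of the squared radius (`map_pairPhase_le`), and Plancherel in `t`
  (`lintegral_oscillatory_le`) gives the estimate.

* *Nonlinear estimate.* As `1 - ε₀ > 1/2`, the space `H^{1-ε₀}(𝕋)` embeds into `L^∞(𝕋)`, so that
  with `G(t) = ‖u(t)‖⁴_{L⁴_x H^{1-ε₀}_y}` and `T` a translation of `ℝ² × 𝕋`, the nonlinearity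
  `N = |u|² u` satisfies `b(TN - N) ≲ G^{1/2} a(Tu - u)`
  (`normFourThirdsTwo_cubic_translate_sub_le`), and `b(N) ≲ G^{1/2} a(u)` likewise.

* *Difference quotients.* `‖f‖_{H¹}` is comparable to the best `K` for which `‖f‖ ≤ K` and
  `‖T f - f‖ ≤ K |h|` for every translation `T` along `ℝ²` or `𝕋` by `h`
  (`h1Norm_le_of_translate`, `enorm_translate_plane_sub_le`, `enorm_translate_torus_sub_le`).

Let `w` be `v` or `Tv - v`; free waves commute with translations. Strichartz and duality bound
`‖w(t) - w(s)‖_{L²}` by the integral of `b` in `L^{4/3}` of `[s, t]`, hence by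
`(∫_s^t G)^{1/2}` times the `L⁴` norm of `a(e^{irΔ} w(r))` on `[s, t]`
(`IsControlledPath.enorm_sub_le`). The latter norm is bounded, on an interval where `∫ G` is small,
by the size of `w` at the left end, and finitely many such intervals cover the line. So
`‖w(t) - w(s)‖ ≲ (∫_s^∞ G)^{1/2} ‖w(0)‖` with a constant that does not depend on the translation
(`IsControlledPath.exists_enorm_sub_le`). Taking `w = v` shows that `v(t)` converges in `L²`; taking
`w = Tv - v` and dividing by `|h|` upgrades this to convergence in `H¹`. Using difference quotients
instead of derivatives has the advantage that all estimates take place in `L²`, for functions that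
are known to exist.

The step from Strichartz estimates for free waves to estimates for `e^{itΔ} w(t)` with a moving `w`
needs the Christ–Kiselev lemma. Here it takes the form of a chaining argument
(`IsStrichartzPair.lfour_holder_path_le`): the path `w`, parametrized by the mass of the forcing, is
Hölder continuous of exponent `3/4` in `L²`, and a Strichartz bound in `L⁴` for each of the `16ⁿ`
increments of generation `n` sums up because `16^{1/4} · 16^{-3/4} < 1`.
-/

namespace Waveguide

open MeasureTheory Filter Topology Set
open scoped ENNReal NNReal FourierTransform RealInnerProductSpace

/-! ### Strichartz pairs -/

/-- A one-parameter family `U` of unitary operators together with a gauge `a` and a dual gauge `b`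
for which `‖a (U t f)‖_{L⁴_t} ≤ C ‖f‖`. The gauges are functionals with values in `[0, ∞]` on the
Hilbert space itself, so that no space of functions on space-time is needed; only the properties of
norms that the argument uses are recorded. `U` is not required to be a group. -/
structure IsStrichartzPair {H : Type*} [NormedAddCommGroup H] [InnerProductSpace ℂ H]
    (U : ℝ → H ≃ₗᵢ[ℂ] H) (a b : H → ℝ≥0∞) (C : ℝ≥0) : Prop where
  continuous_apply : ∀ f, Continuous fun t => U t f
  lsc : LowerSemicontinuous a
  add_le : ∀ f g, a (f + g) ≤ a f + a g
  enorm_inner_le : ∀ f g, ‖inner ℂ f g‖ₑ ≤ a f * b g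
  strichartz : ∀ f, (∫⁻ t, a (U t f) ^ (4 : ℝ)) ^ (1 / 4 : ℝ) ≤ C * ‖f‖ₑ

namespace IsStrichartzPair

variable {H : Type*} [NormedAddCommGroup H] [InnerProductSpace ℂ H]
  {U : ℝ → H ≃ₗᵢ[ℂ] H} {a b : H → ℝ≥0∞} {C : ℝ≥0}

theorem continuous_comp (h : IsStrichartzPair U a b C) {v : ℝ → H} (hv : Continuous v) :
    Continuous fun t => U t (v t) := by
  rw [continuous_iff_continuousAt]
  intro t₀
  have h1 : Tendsto (fun t => U t (v t - v t₀)) (𝓝 t₀) (𝓝 0) := by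
    rw [tendsto_zero_iff_norm_tendsto_zero]
    simp only [LinearIsometryEquiv.norm_map]
    rw [← tendsto_zero_iff_norm_tendsto_zero, ← sub_self (v t₀)]
    exact (hv.tendsto t₀).sub_const _
  have h2 := h1.add ((h.continuous_apply (v t₀)).tendsto t₀)
  simpa [ContinuousAt, map_sub] using h2

theorem measurable_comp (h : IsStrichartzPair U a b C) {v : ℝ → H} (hv : Continuous v) :
    Measurable fun t => a (U t (v t)) :=
  (h.lsc.comp (h.continuous_comp hv)).measurable

/-- The dual Strichartz estimate for a forcing `F`, with a majorant `β` of `b (U r (F r))`. -/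
theorem enorm_integral_le [CompleteSpace H] (h : IsStrichartzPair U a b C) {F : ℝ → H}
    {β : ℝ → ℝ≥0∞}
    (hβ : Measurable β) {s t : ℝ} (hst : s ≤ t) (hF : IntervalIntegrable F volume s t)
    (hb : ∀ r, b (U r (F r)) ≤ β r) :
    ‖∫ r in s..t, F r‖ₑ ≤ C * (∫⁻ r in Ioc s t, β r ^ (4 / 3 : ℝ)) ^ (3 / 4 : ℝ) := by
  set I := (∫⁻ r in Ioc s t, β r ^ (4 / 3 : ℝ)) ^ (3 / 4 : ℝ) with hI
  set w := ∫ r in s..t, F r with hw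
  rcases eq_or_ne w 0 with hw0 | hw0
  · simp [hw0]
  have hwpos : ‖w‖ₑ ≠ 0 := by simpa using hw0
  have key : ‖w‖ₑ * ‖w‖ₑ ≤ ‖w‖ₑ * (C * I) := by
    have e1 : ‖inner ℂ w w‖ₑ = ‖w‖ₑ * ‖w‖ₑ := by
      rw [inner_self_eq_norm_sq_to_K, ← ofReal_norm (E := ℂ), ← ofReal_norm,
        ← ENNReal.ofReal_mul (norm_nonneg _)]
      simp [sq]
    have e2 : inner ℂ w w = ∫ r in Ioc s t, inner ℂ w (F r) := by
      rw [integral_inner ((intervalIntegrable_iff_integrableOn_Ioc_of_le hst).1 hF), hw,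
        intervalIntegral.integral_of_le hst]
    rw [← e1, e2]
    calc ‖∫ r in Ioc s t, inner ℂ w (F r)‖ₑ ≤ ∫⁻ r in Ioc s t, ‖inner ℂ w (F r)‖ₑ :=
          enorm_integral_le_lintegral_enorm _
      _ ≤ ∫⁻ r in Ioc s t, a (U r w) * β r := by
          refine lintegral_mono fun r => ?_
          rw [← (U r).inner_map_map]
          exact (h.enorm_inner_le _ _).trans (mul_le_mul_right (hb r) _)
      _ ≤ (∫⁻ r in Ioc s t, a (U r w) ^ (4 : ℝ)) ^ (1 / 4 : ℝ) *
            (∫⁻ r in Ioc s t, β r ^ (4 / 3 : ℝ)) ^ (1 / (4 / 3) : ℝ) := by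
          refine ENNReal.lintegral_mul_le_Lp_mul_Lq _ ?_
            (h.measurable_comp continuous_const).aemeasurable hβ.aemeasurable
          rw [Real.holderConjugate_iff]; norm_num
      _ ≤ (C * ‖w‖ₑ) * I := by
          rw [show (1 / (4 / 3) : ℝ) = 3 / 4 by norm_num]
          gcongr
          refine le_trans ?_ (h.strichartz w)
          gcongr
          exact Measure.restrict_le_self
      _ = ‖w‖ₑ * (C * I) := by ring
  exact (ENNReal.mul_le_mul_iff_right hwpos enorm_ne_top).1 key

end IsStrichartzPair

/-- The `L⁴` seminorm of a nonnegative function. -/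
noncomputable def lfour (μ : Measure ℝ) (f : ℝ → ℝ≥0∞) : ℝ≥0∞ :=
  (∫⁻ t, f t ^ (4 : ℝ) ∂μ) ^ (1 / 4 : ℝ)

theorem lfour_mono {μ : Measure ℝ} {f g : ℝ → ℝ≥0∞} (h : ∀ t, f t ≤ g t) :
    lfour μ f ≤ lfour μ g := by
  unfold lfour; gcongr with t; exact h t

theorem lfour_add_le {μ : Measure ℝ} {f g : ℝ → ℝ≥0∞} (hf : Measurable f) (hg : Measurable g) :
    lfour μ (fun t => f t + g t) ≤ lfour μ f + lfour μ g :=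
  ENNReal.lintegral_Lp_add_le hf.aemeasurable hg.aemeasurable (by norm_num)

theorem lfour_sum_le {μ : Measure ℝ} {f : ℕ → ℝ → ℝ≥0∞} (hf : ∀ n, Measurable (f n)) (m : ℕ) :
    lfour μ (fun t => ∑ n ∈ Finset.range m, f n t) ≤ ∑ n ∈ Finset.range m, lfour μ (f n) := by
  induction m with
  | zero => simp [lfour]
  | succ m ih =>
    simp only [Finset.sum_range_succ]
    refine (lfour_add_le (Finset.measurable_sum _ fun n _ => hf n) (hf m)).trans ?_
    gcongr

theorem lfour_iSup_le {μ : Measure ℝ} {f : ℕ → ℝ → ℝ≥0∞} (hf : ∀ n, Measurable (f n))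
    (hmono : Monotone f) {K : ℝ≥0∞} (hK : ∀ n, lfour μ (f n) ≤ K) :
    lfour μ (fun t => ⨆ n, f n t) ≤ K := by
  have h4 : ∀ t, (⨆ n, f n t) ^ (4 : ℝ) = ⨆ n, f n t ^ (4 : ℝ) := fun t =>
    (ENNReal.orderIsoRpow 4 (by norm_num)).map_iSup fun n => f n t
  unfold lfour
  simp only [h4]
  rw [lintegral_iSup (fun n => (hf n).pow_const _)
    (fun m n hmn t => ENNReal.rpow_le_rpow (hmono hmn t) (by norm_num))]
  refine le_of_eq_of_le ((ENNReal.orderIsoRpow (1 / 4) (by norm_num)).map_iSup _) ?_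
  exact iSup_le hK

namespace IsStrichartzPair

variable {H : Type*} [NormedAddCommGroup H] [InnerProductSpace ℂ H]
  {U : ℝ → H ≃ₗᵢ[ℂ] H} {a b : H → ℝ≥0∞} {C : ℝ≥0}

/-- The Strichartz estimate for the `ℓ⁴` sum of `N` free waves. -/
theorem lfour_sum_rpow_le (h : IsStrichartzPair U a b C) (e : ℕ → H) (N : ℕ) {K : ℝ≥0∞}
    (he : ∀ j < N, ‖e j‖ₑ ≤ K) :
    lfour volume (fun t => (∑ j ∈ Finset.range N, a (U t (e j)) ^ (4 : ℝ)) ^ (1 / 4 : ℝ)) ≤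
      (N : ℝ≥0∞) ^ (1 / 4 : ℝ) * (C * K) := by
  unfold lfour
  simp only [← ENNReal.rpow_mul]
  norm_num only [ENNReal.rpow_one]
  rw [lintegral_finsetSum _
    fun j _ => (h.measurable_comp (v := fun _ => e j) continuous_const).pow_const _]
  have h1 : ∀ j ∈ Finset.range N, ∫⁻ t, a (U t (e j)) ^ (4 : ℝ) ≤ (C * K) ^ (4 : ℝ) := by
    intro j hj
    have := (h.strichartz (e j)).trans (mul_le_mul_right (he j (Finset.mem_range.1 hj)) _)
    rw [one_div, ENNReal.rpow_inv_le_iff (by norm_num)] at this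
    exact this
  calc _ ≤ (∑ _j ∈ Finset.range N, (C * K) ^ (4 : ℝ)) ^ (1 / 4 : ℝ) := by
        gcongr with j hj; exact h1 j hj
    _ = _ := by
        rw [Finset.sum_const, Finset.card_range, nsmul_eq_mul,
          ENNReal.mul_rpow_of_nonneg _ _ (by norm_num), ← ENNReal.rpow_mul]
        norm_num

/-- A chaining argument: if `V` is Hölder continuous of exponent `3/4` on `[0, 1]`, then the
Strichartz estimate holds for `U t (V (θ t))`, whatever the choice `θ` of the parameter. The point
`θ t` is approximated by its `16`-adic truncations. The `≈ 16ⁿ` increments of generation `n`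
have size `16^{-3n/4}`, and the `ℓ⁴` sum over all of them dominates the one that occurs at time `t`,
so that generation `n` contributes at most `16^{n/4} · 16^{-3n/4} = 4^{-n}` up to a constant. -/
theorem lfour_holder_path_le (h : IsStrichartzPair U a b C) {V : ℝ → H} {K : ℝ≥0∞} (hK : K ≠ ∞)
    (hV : ∀ x ∈ Icc (0 : ℝ) 1, ∀ y ∈ Icc (0 : ℝ) 1,
      ‖V x - V y‖ₑ ≤ K * ENNReal.ofReal |x - y| ^ (3 / 4 : ℝ))
    {θ : ℝ → ℝ} (hθ : ∀ t, θ t ∈ Icc (0 : ℝ) 1) :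
    lfour volume (fun t => a (U t (V (θ t)))) ≤ C * ‖V 0‖ₑ + 9 * (C * K) := by
  -- `W n (J n t)` is the value of `V` at the `16`-adic truncation of generation `n` of `θ t`, and
  -- `e n j` is the increment that leads to the grid point `j / 16 ^ (n + 1)` from its truncation.
  set J : ℕ → ℝ → ℕ := fun n t => ⌊(16 : ℝ) ^ n * θ t⌋₊ with hJ
  set W : ℕ → ℕ → H := fun n j => V ((j : ℝ) / 16 ^ n) with hW
  set e : ℕ → ℕ → H := fun n j => W (n + 1) j - W n (j / 16) with he
  set g : ℕ → ℝ → ℝ≥0∞ := fun n t =>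
    (∑ j ∈ Finset.range (16 ^ (n + 1) + 1), a (U t (e n j)) ^ (4 : ℝ)) ^ (1 / 4 : ℝ) with hg
  have h16 : ∀ n : ℕ, (0 : ℝ) < 16 ^ n := fun n => by positivity
  have hJle : ∀ n t, J n t ≤ 16 ^ n := by
    intro n t
    refine Nat.floor_le_of_le ?_
    push_cast
    exact mul_le_of_le_one_right (h16 n).le (hθ t).2
  have hJsucc : ∀ n t, J (n + 1) t / 16 = J n t := by
    intro n t
    simp only [hJ]
    have := Nat.floor_div_natCast ((16 : ℝ) ^ (n + 1) * θ t) 16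
    rw [← this]
    congr 1
    push_cast
    ring
  have hgrid : ∀ n j : ℕ, j ≤ 16 ^ n → (j : ℝ) / 16 ^ n ∈ Icc (0 : ℝ) 1 := by
    intro n j hj
    refine ⟨by positivity, div_le_one_of_le₀ (by exact_mod_cast hj) (h16 n).le⟩
  have hpow : ∀ n : ℕ, ENNReal.ofReal (1 / 16 ^ n) ^ (3 / 4 : ℝ) = ENNReal.ofReal (1 / 8 ^ n) := by
    intro n
    rw [ENNReal.ofReal_rpow_of_nonneg (by positivity) (by norm_num)]
    congr 1
    rw [one_div, one_div, ← inv_pow, ← inv_pow, ← Real.rpow_natCast, ← Real.rpow_natCast,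
      ← Real.rpow_mul (by norm_num), mul_comm, Real.rpow_mul (by norm_num)]
    congr 1
    rw [show (16⁻¹ : ℝ) = (2⁻¹) ^ (4 : ℝ) by norm_num, ← Real.rpow_mul (by norm_num)]
    norm_num
  have hebound : ∀ n j, j < 16 ^ (n + 1) + 1 → ‖e n j‖ₑ ≤ K * ENNReal.ofReal (1 / 8 ^ n) := by
    intro n j hj
    have hj' : j ≤ 16 ^ (n + 1) := Nat.lt_succ_iff.1 hj
    have hj2 : j / 16 ≤ 16 ^ n := by
      have := Nat.div_le_div_right (c := 16) hj'
      rwa [pow_succ, Nat.mul_div_cancel _ (by norm_num)] at this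
    refine (hV _ (hgrid _ _ hj') _ (hgrid _ _ hj2)).trans ?_
    rw [← hpow]
    gcongr
    have hd : (j : ℝ) = 16 * ((j / 16 : ℕ) : ℝ) + ((j % 16 : ℕ) : ℝ) := by
      exact_mod_cast (Nat.div_add_mod j 16).symm
    have hm : ((j % 16 : ℕ) : ℝ) ≤ 16 := by exact_mod_cast (Nat.mod_lt j (by norm_num)).le
    have : (j : ℝ) / 16 ^ (n + 1) - ((j / 16 : ℕ) : ℝ) / 16 ^ n
        = ((j % 16 : ℕ) : ℝ) / 16 / 16 ^ n := by
      rw [hd, pow_succ]; field_simp; ring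
    rw [this, abs_of_nonneg (by positivity)]
    gcongr
    linarith
  have hgmeas : ∀ n, Measurable (g n) := fun n =>
    (Finset.measurable_sum _ fun j _ =>
      (h.measurable_comp (v := fun _ => e n j) continuous_const).pow_const _).pow_const _
  have hgbound : ∀ n, lfour volume (g n) ≤ 4 * (C * K) * ENNReal.ofReal ((1 / 2) ^ n) := by
    intro n
    refine (h.lfour_sum_rpow_le (e n) _ (hebound n)).trans ?_
    have hc : ((16 ^ (n + 1) + 1 : ℕ) : ℝ≥0∞) ^ (1 / 4 : ℝ) ≤ ENNReal.ofReal (4 * 2 ^ n) := by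
      rw [one_div, ENNReal.rpow_inv_le_iff (by norm_num),
        ENNReal.ofReal_rpow_of_nonneg (by positivity) (by norm_num)]
      rw [← ENNReal.ofReal_natCast]
      refine ENNReal.ofReal_le_ofReal ?_
      have h1 : ((4 * 2 ^ n : ℝ)) ^ (4 : ℝ) = 256 * 16 ^ n := by
        rw [show (4 : ℝ) = ((4 : ℕ) : ℝ) by norm_num, Real.rpow_natCast, mul_pow, ← pow_mul,
          mul_comm n 4, pow_mul]
        norm_num
      rw [h1]
      push_cast
      have : (1 : ℝ) ≤ 16 ^ n := one_le_pow₀ (by norm_num)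
      rw [pow_succ]
      linarith
    calc _ ≤ ENNReal.ofReal (4 * 2 ^ n) * (C * (K * ENNReal.ofReal (1 / 8 ^ n))) := by gcongr
      _ = (C * K) * (ENNReal.ofReal (4 * 2 ^ n) * ENNReal.ofReal (1 / 8 ^ n)) := by ring
      _ ≤ (C * K) * (4 * ENNReal.ofReal ((1 / 2) ^ n)) := by
          refine mul_le_mul_right ?_ _
          rw [← ENNReal.ofReal_mul (by positivity), show (4 : ℝ≥0∞) = ENNReal.ofReal 4 by simp,
            ← ENNReal.ofReal_mul (by positivity)]
          refine ENNReal.ofReal_le_ofReal ?_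
          rw [mul_assoc]
          gcongr
          rw [show (8 : ℝ) = 2 * (2 * 2) by norm_num, mul_pow]
          rw [one_div, mul_inv, ← mul_assoc, mul_inv_cancel₀ (by positivity), one_mul, one_div,
            inv_pow]
          gcongr
          norm_num
      _ = _ := by ring
  set h0 : ℝ → ℝ≥0∞ := fun t => a (U t (V 0)) with hh0
  set h1 : ℝ → ℝ≥0∞ := fun t => a (U t (V 1 - V 0)) with hh1
  have h0m : Measurable h0 := h.measurable_comp continuous_const
  have h1m : Measurable h1 := h.measurable_comp continuous_const
  set S : ℕ → ℝ → ℝ≥0∞ := fun m t => (h0 t + h1 t) + ∑ n ∈ Finset.range m, g n t with hS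
  have hstep : ∀ m t, a (U t (W m (J m t))) ≤ S m t := by
    intro m t
    induction m with
    | zero =>
      simp only [hS, Finset.range_zero, Finset.sum_empty, add_zero]
      have hle := hJle 0 t
      simp only [pow_zero] at hle
      rcases Nat.le_one_iff_eq_zero_or_eq_one.1 hle with h' | h'
      · simp only [h', hW]; simp [hh0]
      · have : W 0 (J 0 t) = V 0 + (V 1 - V 0) := by simp [h', hW]
        rw [this, map_add]
        exact h.add_le _ _
    | succ m ih =>
      have : W (m + 1) (J (m + 1) t) = W m (J m t) + e m (J (m + 1) t) := by
        simp only [he, hJsucc]; abel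
      rw [this, map_add]
      refine (h.add_le _ _).trans ?_
      simp only [hS, Finset.sum_range_succ, ← add_assoc]
      refine add_le_add ih ?_
      simp only [hg]
      rw [one_div, ENNReal.le_rpow_inv_iff (by norm_num)]
      exact Finset.single_le_sum (f := fun j => a (U t (e m j)) ^ (4 : ℝ)) (fun _ _ => zero_le)
        (Finset.mem_range.2 (Nat.lt_succ_of_le (hJle _ _)))
  have hconv : ∀ t, Tendsto (fun m => W m (J m t)) atTop (𝓝 (V (θ t))) := by
    intro t
    rw [tendsto_iff_edist_tendsto_0]
    have hb : ∀ m, edist (W m (J m t)) (V (θ t)) ≤ K * ENNReal.ofReal (1 / 8 ^ m) := by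
      intro m
      rw [edist_eq_enorm_sub]
      refine (hV _ (hgrid _ _ (hJle m t)) _ (hθ t)).trans ?_
      rw [← hpow]
      gcongr
      have hx : 0 ≤ (16 : ℝ) ^ m * θ t := mul_nonneg (h16 m).le (hθ t).1
      have l1 := Nat.floor_le hx
      have l2 := (Nat.lt_floor_add_one ((16 : ℝ) ^ m * θ t)).le
      have : ((J m t : ℕ) : ℝ) / 16 ^ m - θ t = ((J m t : ℝ) - 16 ^ m * θ t) / 16 ^ m := by
        field_simp
      rw [this, abs_div, abs_of_pos (h16 m)]
      gcongr
      rw [abs_le]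
      constructor <;> simp only [hJ] <;> linarith
    refine tendsto_of_tendsto_of_tendsto_of_le_of_le tendsto_const_nhds ?_ (fun _ => zero_le) hb
    have : Tendsto (fun m : ℕ => ENNReal.ofReal (1 / 8 ^ m)) atTop (𝓝 0) := by
      rw [← ENNReal.ofReal_zero]
      refine ENNReal.tendsto_ofReal ?_
      simpa [one_div, inv_pow] using
        tendsto_pow_atTop_nhds_zero_of_lt_one (r := (8⁻¹ : ℝ)) (by norm_num) (by norm_num)
    simpa using ENNReal.Tendsto.const_mul this (Or.inr hK)
  have hSmono : Monotone S := by
    intro m n hmn t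
    simp only [hS]
    gcongr
  have hlim : ∀ t, a (U t (V (θ t))) ≤ ⨆ m, S m t := by
    intro t
    have hcl : IsClosed {f | a f ≤ ⨆ m, S m t} := h.lsc.isClosed_preimage _
    refine hcl.mem_of_tendsto (((U t).continuous.tendsto _).comp (hconv t))
      (Eventually.of_forall fun m => ?_)
    exact (hstep m t).trans (le_iSup (fun m => S m t) m)
  refine (lfour_mono hlim).trans (lfour_iSup_le (fun m => ?_) hSmono fun m => ?_)
  · exact (h0m.add h1m).add (Finset.measurable_sum _ fun n _ => hgmeas n)
  refine (lfour_add_le (h0m.add h1m) (Finset.measurable_sum _ fun n _ => hgmeas n)).trans ?_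
  have b0 : lfour volume h0 ≤ C * ‖V 0‖ₑ := h.strichartz _
  have b1 : lfour volume h1 ≤ C * K := by
    refine (h.strichartz _).trans ?_
    gcongr
    simpa using hV 1 (by simp) 0 (by simp)
  have b2 : lfour volume (fun t => ∑ n ∈ Finset.range m, g n t) ≤ 8 * (C * K) := by
    refine (lfour_sum_le hgmeas m).trans ((Finset.sum_le_sum fun n _ => hgbound n).trans ?_)
    rw [← Finset.mul_sum, ← ENNReal.ofReal_sum_of_nonneg (fun _ _ => by positivity)]
    calc _ ≤ 4 * (C * K) * ENNReal.ofReal 2 := by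
          gcongr
          refine (Summable.sum_le_tsum _ (fun _ _ => by positivity) ?_).trans_eq tsum_geometric_two
          exact summable_geometric_two
      _ = _ := by rw [show ENNReal.ofReal 2 = 2 by simp]; ring
  calc _ ≤ (C * ‖V 0‖ₑ + C * K) + 8 * (C * K) :=
        add_le_add ((lfour_add_le h0m h1m).trans (add_le_add b0 b1)) b2
    _ = _ := by ring

end IsStrichartzPair

/-! ### Perturbed free evolutions -/

/-- A finite measure `γ dt` has a continuous, real valued distribution function. -/
theorem exists_primitive {γ : ℝ → ℝ≥0∞} (hγ : Measurable γ) (hfin : ∫⁻ r, γ r ≠ ∞) :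
    ∃ Λ : ℝ → ℝ, Continuous Λ ∧ Λ 0 = 0 ∧ Monotone Λ ∧
      ∀ r r', r ≤ r' → ∫⁻ t in Ioc r r', γ t = ENNReal.ofReal (Λ r' - Λ r) := by
  have hint : Integrable (fun t => (γ t).toReal) :=
    integrable_toReal_of_lintegral_ne_top hγ.aemeasurable hfin
  have hii : ∀ a b : ℝ, IntervalIntegrable (fun t => (γ t).toReal) volume a b :=
    fun a b => hint.intervalIntegrable
  have hsub : ∀ r r' : ℝ, (∫ t in (0 : ℝ)..r', (γ t).toReal) - (∫ t in (0 : ℝ)..r, (γ t).toReal)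
      = ∫ t in r..r', (γ t).toReal :=
    fun r r' => intervalIntegral.integral_interval_sub_left (hii _ _) (hii _ _)
  refine ⟨fun t => ∫ r in (0 : ℝ)..t, (γ r).toReal,
    intervalIntegral.continuous_primitive hii 0, by simp, fun r r' hr => ?_, fun r r' hr => ?_⟩
  · have := hsub r r'
    have h0 : 0 ≤ ∫ t in r..r', (γ t).toReal :=
      intervalIntegral.integral_nonneg hr fun _ _ => ENNReal.toReal_nonneg
    simp only
    linarith
  · have hae : ∀ᵐ t ∂volume.restrict (Ioc r r'), γ t < ∞ :=
      ae_restrict_of_ae (ae_lt_top hγ hfin)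
    have hle : ∫⁻ t in Ioc r r', γ t ≠ ∞ :=
      ne_top_of_le_ne_top hfin (setLIntegral_le_lintegral _ _)
    rw [hsub, intervalIntegral.integral_of_le hr, integral_toReal hγ.aemeasurable hae,
      ENNReal.ofReal_toReal hle]

namespace IsStrichartzPair

variable {H : Type*} [NormedAddCommGroup H] [InnerProductSpace ℂ H]
  {U : ℝ → H ≃ₗᵢ[ℂ] H} {a b : H → ℝ≥0∞} {C : ℝ≥0}

/-- The Strichartz estimate for `U t (v t)`, when the increments of `v` are controlled by the power
`3/4` of an integral of `γ`. Parametrizing `v` by the mass of `γ` turns it into a Hölder continuous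
path; `v` is constant on intervals where `γ` has no mass, so nothing is lost. -/
theorem lfour_path_le (h : IsStrichartzPair U a b C) {v : ℝ → H} {s T : ℝ} (hsT : s ≤ T)
    {γ : ℝ → ℝ≥0∞} (hγ : Measurable γ) (hfin : ∫⁻ r, γ r ≠ ∞) {K : ℝ≥0∞} (hK : K ≠ ∞)
    (hv : ∀ r r', r ≤ r' → ‖v r' - v r‖ₑ ≤ K * (∫⁻ t in Ioc r r', γ t) ^ (3 / 4 : ℝ)) :
    lfour (volume.restrict (Ioc s T)) (fun t => a (U t (v t))) ≤
      C * ‖v s‖ₑ + 9 * (C * (K * (∫⁻ t in Ioc s T, γ t) ^ (3 / 4 : ℝ))) := by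
  obtain ⟨Λ, hΛc, -, hΛm, hΛ⟩ := exists_primitive hγ hfin
  set L := Λ T - Λ s with hL
  have hL0 : 0 ≤ L := sub_nonneg.2 (hΛm hsT)
  -- `v` factors through the distribution function `Λ`
  have hveq : ∀ r r', Λ r = Λ r' → v r = v r' := by
    have key : ∀ r r', r ≤ r' → Λ r = Λ r' → v r = v r' := by
      intro r r' hr he
      have := hv r r' hr
      rw [hΛ r r' hr, he, sub_self, ENNReal.ofReal_zero, ENNReal.zero_rpow_of_pos (by norm_num),
        mul_zero, nonpos_iff_eq_zero, enorm_eq_zero, sub_eq_zero] at this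
      exact this.symm
    intro r r' he
    rcases le_total r r' with hr | hr
    · exact key r r' hr he
    · exact (key r' r hr he.symm).symm
  have hτ : ∀ x : ℝ, ∃ t, x ∈ Icc (0 : ℝ) 1 → Λ t = Λ s + L * x := by
    intro x
    by_cases hx : x ∈ Icc (0 : ℝ) 1
    · have : Λ s + L * x ∈ Icc (Λ s) (Λ T) := by
        refine ⟨by nlinarith [hx.1], ?_⟩
        nlinarith [hx.2]
      obtain ⟨t, -, ht⟩ := intermediate_value_Icc hsT hΛc.continuousOn this
      exact ⟨t, fun _ => ht⟩
    · exact ⟨0, fun h => absurd h hx⟩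
  choose τ hτ using hτ
  have hV : ∀ x ∈ Icc (0 : ℝ) 1, ∀ y ∈ Icc (0 : ℝ) 1, ‖v (τ x) - v (τ y)‖ₑ ≤
      K * ENNReal.ofReal L ^ (3 / 4 : ℝ) * ENNReal.ofReal |x - y| ^ (3 / 4 : ℝ) := by
    have key : ∀ x ∈ Icc (0 : ℝ) 1, ∀ y ∈ Icc (0 : ℝ) 1, x ≤ y → ‖v (τ y) - v (τ x)‖ₑ ≤
        K * ENNReal.ofReal L ^ (3 / 4 : ℝ) * ENNReal.ofReal |x - y| ^ (3 / 4 : ℝ) := by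
      intro x hx y hy hxy
      rcases le_or_gt (τ x) (τ y) with hle | hlt
      · refine (hv _ _ hle).trans (le_of_eq ?_)
        rw [hΛ _ _ hle, hτ x hx, hτ y hy, mul_assoc,
          ← ENNReal.mul_rpow_of_nonneg _ _ (by norm_num), ← ENNReal.ofReal_mul hL0,
          abs_sub_comm, abs_of_nonneg (sub_nonneg.2 hxy)]
        congr 3
        ring
      · have h1 := hΛm hlt.le
        have h2 : Λ (τ x) ≤ Λ (τ y) := by
          rw [hτ x hx, hτ y hy]; gcongr
        rw [hveq _ _ (le_antisymm h1 h2)]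
        simp
    intro x hx y hy
    rcases le_total x y with hxy | hxy
    · rw [← enorm_neg, neg_sub]; exact key x hx y hy hxy
    · rw [abs_sub_comm]; exact key y hy x hx hxy
  set θ : ℝ → ℝ := fun t => if t ∈ Ioc s T then (Λ t - Λ s) / L else 0 with hθ
  have hθmem : ∀ t, θ t ∈ Icc (0 : ℝ) 1 := by
    intro t
    simp only [hθ]
    split_ifs with ht
    · have h1 := hΛm ht.1.le
      have h2 := hΛm ht.2
      exact ⟨div_nonneg (by linarith) hL0, div_le_one_of_le₀ (by rw [hL]; linarith) hL0⟩
    · simp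
  have hvθ : ∀ t ∈ Ioc s T, v t = v (τ (θ t)) := by
    intro t ht
    refine hveq _ _ ?_
    rw [hτ _ (hθmem t)]
    simp only [hθ, if_pos ht]
    have h1 := hΛm ht.1.le
    have h2 := hΛm ht.2
    rcases hL0.eq_or_lt with h0 | h0
    · rw [← h0]; simp only [zero_mul, add_zero]; linarith
    · field_simp; ring
  have hv0 : v (τ 0) = v s := hveq _ _ (by rw [hτ 0 (by simp)]; ring)
  have main := h.lfour_holder_path_le (V := fun x => v (τ x))
    (K := K * ENNReal.ofReal L ^ (3 / 4 : ℝ))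
    (ENNReal.mul_ne_top hK (ENNReal.rpow_ne_top_of_nonneg (by norm_num) ENNReal.ofReal_ne_top))
    hV hθmem
  rw [hv0, ← hΛ s T hsT] at main
  refine le_trans ?_ main
  unfold lfour
  gcongr 1
  rw [setLIntegral_congr_fun (g := fun t => a (U t (v (τ (θ t)))) ^ (4 : ℝ)) measurableSet_Ioc
    (fun t ht => by simp only [← hvθ t ht])]
  exact setLIntegral_le_lintegral _ _

end IsStrichartzPair

/-- The profile `v` of a solution of a linear equation with forcing `F`, where the forcing is that
of a potential of size `G^{1/2}`: in the interaction picture `v' = F`, in integrated form, and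
`b (U r (F r)) ≤ C₁ G(r)^{1/2} a (U r (v r))`. The space-time norm of `U r (v r)` is assumed to be
finite, as is needed to absorb it. -/
structure IsControlledPath {H : Type*} [NormedAddCommGroup H] [InnerProductSpace ℂ H]
    (U : ℝ → H ≃ₗᵢ[ℂ] H) (a b : H → ℝ≥0∞) (G : ℝ → ℝ≥0∞) (C₁ : ℝ≥0) (v F : ℝ → H) : Prop where
  continuous : Continuous v
  intervalIntegrable : ∀ s t, IntervalIntegrable F volume s t
  sub_eq : ∀ s t, v t - v s = ∫ r in s..t, F r
  le : ∀ r, b (U r (F r)) ≤ C₁ * G r ^ (1 / 2 : ℝ) * a (U r (v r))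
  lintegral_ne_top : ∫⁻ r, a (U r (v r)) ^ (4 : ℝ) ≠ ∞

theorem lfour_Ioc_le_add {s m T : ℝ} (hsm : s ≤ m) (hmT : m ≤ T) (f : ℝ → ℝ≥0∞) :
    lfour (volume.restrict (Ioc s T)) f ≤
      lfour (volume.restrict (Ioc s m)) f + lfour (volume.restrict (Ioc m T)) f := by
  unfold lfour
  rw [← Ioc_union_Ioc_eq_Ioc hsm hmT,
    lintegral_union measurableSet_Ioc (Ioc_disjoint_Ioc_of_le le_rfl)]
  exact ENNReal.rpow_add_le_add_rpow _ _ (by norm_num) (by norm_num)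

namespace IsControlledPath

variable {H : Type*} [NormedAddCommGroup H] [InnerProductSpace ℂ H]
  {U : ℝ → H ≃ₗᵢ[ℂ] H} {a b : H → ℝ≥0∞} {C : ℝ≥0} {G : ℝ → ℝ≥0∞} {C₁ : ℝ≥0} {v F : ℝ → H}

theorem lintegral_rpow_le (h : IsStrichartzPair U a b C) (hG : Measurable G)
    (hv : IsControlledPath U a b G C₁ v F) (S : Set ℝ) :
    (∫⁻ r in S, (C₁ * G r ^ (1 / 2 : ℝ) * a (U r (v r))) ^ (4 / 3 : ℝ)) ^ (3 / 4 : ℝ) ≤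
      C₁ * (∫⁻ r in S, G r) ^ (1 / 2 : ℝ) *
        lfour (volume.restrict S) (fun r => a (U r (v r))) := by
  have := ENNReal.lintegral_Lp_mul_le_Lq_mul_Lr (p := 4 / 3) (q := 2) (r := 4) (by norm_num)
    (by norm_num) (by norm_num) (volume.restrict S) (f := fun r => C₁ * G r ^ (1 / 2 : ℝ))
    (g := fun r => a (U r (v r))) ((hG.pow_const _).const_mul _).aemeasurable
    (h.measurable_comp hv.continuous).aemeasurable
  norm_num only [Pi.mul_apply] at this
  refine this.trans (le_of_eq ?_)
  congr 1
  simp only [ENNReal.mul_rpow_of_nonneg _ _ (show (0 : ℝ) ≤ 2 by norm_num), ← ENNReal.rpow_mul]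
  norm_num only [ENNReal.rpow_one]
  rw [lintegral_const_mul _ hG, ENNReal.mul_rpow_of_nonneg _ _ (by norm_num), ← ENNReal.rpow_mul]
  norm_num

theorem measurable_majorant (h : IsStrichartzPair U a b C) (hG : Measurable G)
    (hv : IsControlledPath U a b G C₁ v F) :
    Measurable fun r => C₁ * G r ^ (1 / 2 : ℝ) * a (U r (v r)) :=
  ((hG.pow_const _).const_mul _).mul (h.measurable_comp hv.continuous)

theorem lfour_ne_top (hv : IsControlledPath U a b G C₁ v F) (S : Set ℝ) :
    lfour (volume.restrict S) (fun r => a (U r (v r))) ≠ ∞ :=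
  ENNReal.rpow_ne_top_of_nonneg (by norm_num)
    (ne_top_of_le_ne_top hv.lintegral_ne_top (setLIntegral_le_lintegral _ _))

variable [CompleteSpace H]

theorem enorm_sub_le_rpow (h : IsStrichartzPair U a b C) (hG : Measurable G)
    (hv : IsControlledPath U a b G C₁ v F) {s t : ℝ} (hst : s ≤ t) :
    ‖v t - v s‖ₑ ≤ C * (∫⁻ r in Ioc s t,
      (C₁ * G r ^ (1 / 2 : ℝ) * a (U r (v r))) ^ (4 / 3 : ℝ)) ^ (3 / 4 : ℝ) := by
  rw [hv.sub_eq]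
  exact h.enorm_integral_le (hv.measurable_majorant h hG) hst (hv.intervalIntegrable s t) hv.le

theorem enorm_sub_le (h : IsStrichartzPair U a b C) (hG : Measurable G)
    (hv : IsControlledPath U a b G C₁ v F) {s t : ℝ} (hst : s ≤ t) :
    ‖v t - v s‖ₑ ≤ C * (C₁ * (∫⁻ r in Ioc s t, G r) ^ (1 / 2 : ℝ) *
        lfour (volume.restrict (Ioc s t)) (fun r => a (U r (v r)))) :=
  (hv.enorm_sub_le_rpow h hG hst).trans (mul_le_mul_right (hv.lintegral_rpow_le h hG _) _)

/-- The inequality to be absorbed when the integral of `G` over `[s, T]` is small. -/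
theorem lfour_le (h : IsStrichartzPair U a b C) (hG : Measurable G) (hGfin : ∫⁻ r, G r ≠ ∞)
    (hv : IsControlledPath U a b G C₁ v F) {s T : ℝ} (hsT : s ≤ T) :
    lfour (volume.restrict (Ioc s T)) (fun r => a (U r (v r))) ≤
      C * ‖v s‖ₑ + (9 * C ^ 2 * C₁ : ℝ≥0) * (∫⁻ r in Ioc s T, G r) ^ (1 / 2 : ℝ) *
        lfour (volume.restrict (Ioc s T)) (fun r => a (U r (v r))) := by
  have hfin : ∫⁻ r, (C₁ * G r ^ (1 / 2 : ℝ) * a (U r (v r))) ^ (4 / 3 : ℝ) ≠ ∞ := by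
    have h1 := hv.lintegral_rpow_le h hG univ
    have h2 := hv.lfour_ne_top univ
    rw [Measure.restrict_univ] at h1 h2
    intro htop
    rw [htop, ENNReal.top_rpow_of_pos (by norm_num), top_le_iff] at h1
    exact ENNReal.mul_ne_top (ENNReal.mul_ne_top ENNReal.coe_ne_top
      (ENNReal.rpow_ne_top_of_nonneg (by norm_num) hGfin)) h2 h1
  refine (h.lfour_path_le hsT ((hv.measurable_majorant h hG).pow_const _) hfin
    (ENNReal.coe_ne_top (r := C)) (fun r r' hr => hv.enorm_sub_le_rpow h hG hr)).trans ?_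
  refine add_le_add le_rfl ?_
  calc _ ≤ 9 * ((C : ℝ≥0∞) * (C * (C₁ * (∫⁻ r in Ioc s T, G r) ^ (1 / 2 : ℝ) *
        lfour (volume.restrict (Ioc s T)) (fun r => a (U r (v r)))))) := by
        gcongr
        exact hv.lintegral_rpow_le h hG _
    _ = _ := by push_cast; ring

/-- The space-time norm of a controlled path is bounded by its initial value, with a constant that
depends on `G` and not on the path: the half line splits into finitely many intervals on which the
integral of `G` is small enough for absorption. -/
theorem exists_lfour_le (h : IsStrichartzPair U a b C) (hG : Measurable G)
    (hGfin : ∫⁻ r, G r ≠ ∞) (C₁ : ℝ≥0) :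
    ∃ K : ℝ≥0, ∀ v F : ℝ → H, IsControlledPath U a b G C₁ v F → ∀ T, 0 ≤ T →
      lfour (volume.restrict (Ioc 0 T)) (fun r => a (U r (v r))) ≤ K * ‖v 0‖ₑ := by
  obtain ⟨Λ, hΛc, hΛ0, hΛm, hΛ⟩ := exists_primitive hG hGfin
  obtain ⟨g, hg⟩ : ∃ g : ℝ≥0, (g : ℝ≥0∞) = (∫⁻ r, G r) ^ (1 / 2 : ℝ) :=
    ⟨_, ENNReal.coe_toNNReal (ENNReal.rpow_ne_top_of_nonneg (by norm_num) hGfin)⟩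
  -- `δ` is chosen such that the factor `D δ^{1/2}` in the inequality to be absorbed is at most `1/2`
  set D : ℝ≥0 := 9 * C ^ 2 * C₁ with hD
  set δ : ℝ≥0 := ((2 * (D + 1))⁻¹) ^ 2 with hδ
  have hδpos : 0 < δ := by positivity
  have hDδ : (D : ℝ≥0∞) * (δ : ℝ≥0∞) ^ (1 / 2 : ℝ) ≤ 1 / 2 := by
    rw [← ENNReal.coe_rpow_of_nonneg _ (by norm_num), hδ, ← NNReal.rpow_natCast, ← NNReal.rpow_mul]
    norm_num only [NNReal.rpow_one]
    rw [← ENNReal.coe_mul, show (1 / 2 : ℝ≥0∞) = ((1 / 2 : ℝ≥0) : ℝ≥0∞) by norm_num,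
      ENNReal.coe_le_coe, mul_inv]
    rw [← mul_assoc, mul_comm D, mul_assoc, one_div]
    refine mul_le_of_le_one_right (by positivity) ?_
    rw [← div_eq_mul_inv]
    exact div_le_one_of_le₀ (by simp) (by positivity)
  -- absorption on intervals where `∫ G ≤ δ`
  have habs : ∀ v F : ℝ → H, IsControlledPath U a b G C₁ v F → ∀ s T, s ≤ T → Λ T - Λ s ≤ δ →
      lfour (volume.restrict (Ioc s T)) (fun r => a (U r (v r))) ≤ 2 * C * ‖v s‖ₑ := by
    intro v F hv s T hsT hle
    set X := lfour (volume.restrict (Ioc s T)) (fun r => a (U r (v r))) with hX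
    have hXtop : X ≠ ∞ := hv.lfour_ne_top _
    have h1 : X ≤ C * ‖v s‖ₑ + 1 / 2 * X := by
      refine (hv.lfour_le h hG hGfin hsT).trans ?_
      gcongr
      refine le_trans ?_ hDδ
      gcongr
      rw [hΛ s T hsT]
      exact ENNReal.ofReal_le_of_le_toReal (by simpa using hle)
    have h2 : X / 2 + X / 2 ≤ C * ‖v s‖ₑ + X / 2 := by
      rw [ENNReal.add_halves]
      simpa [ENNReal.div_eq_inv_mul] using h1
    have h3 : X / 2 ≤ C * ‖v s‖ₑ :=
      (ENNReal.add_le_add_iff_right (ENNReal.div_ne_top hXtop (by norm_num))).1 h2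
    calc X = 2 * (X / 2) := by
          rw [ENNReal.mul_div_cancel (by norm_num) (by norm_num)]
      _ ≤ 2 * (C * ‖v s‖ₑ) := by gcongr
      _ = _ := by ring
  -- each further interval of mass `δ` costs a fixed factor
  have hind : ∀ n : ℕ, ∃ K : ℝ≥0, ∀ v F : ℝ → H, IsControlledPath U a b G C₁ v F → ∀ T, 0 ≤ T →
      Λ T ≤ n * δ →
      lfour (volume.restrict (Ioc 0 T)) (fun r => a (U r (v r))) ≤ K * ‖v 0‖ₑ := by
    intro n
    induction n with
    | zero =>
      refine ⟨2 * C, fun v F hv T hT hle => ?_⟩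
      have := habs v F hv 0 T hT (by rw [hΛ0]; simp at hle; exact (by simpa using hle.trans δ.2))
      simpa using this
    | succ n ih =>
      obtain ⟨K, hK⟩ := ih
      refine ⟨K + 2 * C * (1 + C * (C₁ * g * K)), fun v F hv T hT hle => ?_⟩
      have hex : ∃ m ∈ Icc 0 T, Λ m ≤ n * δ ∧ Λ T - Λ m ≤ δ := by
        rcases le_total (Λ T) (n * δ) with hc | hc
        · exact ⟨T, ⟨hT, le_rfl⟩, hc, by simp⟩
        · obtain ⟨m, hm, hme⟩ := intermediate_value_Icc hT hΛc.continuousOn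
            (show (n * δ : ℝ) ∈ Icc (Λ 0) (Λ T) from ⟨by rw [hΛ0]; positivity, hc⟩)
          refine ⟨m, hm, hme.le, ?_⟩
          push_cast at hle
          rw [hme]; linarith
      obtain ⟨m, hm, hm1, hm2⟩ := hex
      have e1 := hK v F hv m hm.1 hm1
      have e2 := habs v F hv m T hm.2 hm2
      have e3 : ‖v m‖ₑ ≤ (1 + C * (C₁ * g * K)) * ‖v 0‖ₑ := by
        calc ‖v m‖ₑ = ‖v 0 + (v m - v 0)‖ₑ := by congr 1; abel
          _ ≤ ‖v 0‖ₑ + ‖v m - v 0‖ₑ := enorm_add_le _ _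
          _ ≤ ‖v 0‖ₑ + C * (C₁ * g * (K * ‖v 0‖ₑ)) := by
              gcongr
              refine (hv.enorm_sub_le h hG hm.1).trans ?_
              rw [hg]
              gcongr
              exact Measure.restrict_le_self
          _ = _ := by ring
      calc _ ≤ _ := lfour_Ioc_le_add hm.1 hm.2 _
        _ ≤ K * ‖v 0‖ₑ + 2 * C * ((1 + C * (C₁ * g * K)) * ‖v 0‖ₑ) := by
            gcongr
            exact e2.trans (by gcongr)
        _ = _ := by push_cast; ring
  obtain ⟨n, hn⟩ := exists_nat_ge ((∫⁻ r, G r).toReal / δ)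
  obtain ⟨K, hK⟩ := hind n
  refine ⟨K, fun v F hv T hT => hK v F hv T hT ?_⟩
  have h1 : ENNReal.ofReal (Λ T) ≤ ∫⁻ r, G r := by
    have := hΛ 0 T hT
    rw [hΛ0, sub_zero] at this
    rw [← this]
    exact setLIntegral_le_lintegral _ _
  have h2 : Λ T ≤ (∫⁻ r, G r).toReal := (ENNReal.ofReal_le_iff_le_toReal hGfin).1 h1
  rw [div_le_iff₀ (by exact_mod_cast hδpos)] at hn
  exact h2.trans hn

/-- The oscillation of a controlled path after time `s` is bounded by its initial value times a
factor that tends to `0` as `s → ∞`, uniformly over all controlled paths. -/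
theorem exists_enorm_sub_le (h : IsStrichartzPair U a b C) (hG : Measurable G)
    (hGfin : ∫⁻ r, G r ≠ ∞) (C₁ : ℝ≥0) :
    ∃ K : ℝ≥0, ∀ v F : ℝ → H, IsControlledPath U a b G C₁ v F → ∀ s t, 0 ≤ s → s ≤ t →
      ‖v t - v s‖ₑ ≤ K * (∫⁻ r in Ioi s, G r) ^ (1 / 2 : ℝ) * ‖v 0‖ₑ := by
  obtain ⟨K, hK⟩ := exists_lfour_le h hG hGfin C₁
  refine ⟨C * C₁ * K, fun v F hv s t hs hst => (hv.enorm_sub_le h hG hst).trans ?_⟩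
  calc _ ≤ C * (C₁ * (∫⁻ r in Ioi s, G r) ^ (1 / 2 : ℝ) * (K * ‖v 0‖ₑ)) := by
        gcongr
        · exact Ioc_subset_Ioi_self
        · refine le_trans ?_ (hK v F hv t (hs.trans hst))
          unfold lfour
          gcongr
    _ = _ := by push_cast; ring

end IsControlledPath

/-! ### Oscillatory integrals whose phase has bounded density -/

/-- The absolute value of the Fourier transform of a Gaussian. -/
theorem enorm_integral_gaussian_mul_cexp {ε : ℝ} (hε : 0 < ε) (q : ℝ) :
    ‖∫ t : ℝ, Complex.exp (-(Complex.I * ((t * q : ℝ) : ℂ))) * ((Real.exp (-ε * t ^ 2) : ℝ) : ℂ)‖ₑ =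
      ENNReal.ofReal (Real.sqrt (Real.pi / ε) * Real.exp (-(1 / (4 * ε)) * q ^ 2)) := by
  have h := fourierIntegral_gaussian (b := (ε : ℂ)) (by simpa using hε) (-(q : ℂ))
  have e1 : ∫ t : ℝ, Complex.exp (-(Complex.I * ((t * q : ℝ) : ℂ))) *
      ((Real.exp (-ε * t ^ 2) : ℝ) : ℂ) = ∫ x : ℝ, Complex.exp (Complex.I * (-(q : ℂ)) * x) *
        Complex.exp (-(ε : ℂ) * x ^ 2) := by
    refine integral_congr_ae (Eventually.of_forall fun t => ?_)
    simp only
    congr 1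
    · congr 1; push_cast; ring
    · push_cast; rfl
  rw [e1, h, ← ofReal_norm, norm_mul]
  congr 2
  · rw [show (Real.pi : ℂ) / ε = ((Real.pi / ε : ℝ) : ℂ) by push_cast; rfl,
      show (1 / 2 : ℂ) = ((1 / 2 : ℝ) : ℂ) by push_cast; rfl,
      ← Complex.ofReal_cpow (by positivity), Complex.norm_real, Real.norm_eq_abs,
      abs_of_nonneg (by positivity), Real.sqrt_eq_rpow]
  · rw [show (-(-(q : ℂ)) ^ 2 / (4 * (ε : ℂ))) = ((-(1 / (4 * ε)) * q ^ 2 : ℝ) : ℂ) by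
        push_cast; field_simp, ← Complex.ofReal_exp, Complex.norm_real, Real.norm_eq_abs,
      abs_of_nonneg (by positivity)]

/-- The integral of the kernel does not depend on `ε`. -/
theorem lintegral_gaussian_kernel {ε : ℝ} (hε : 0 < ε) :
    ∫⁻ q : ℝ, ENNReal.ofReal (Real.sqrt (Real.pi / ε) * Real.exp (-(1 / (4 * ε)) * q ^ 2)) =
      ENNReal.ofReal (2 * Real.pi) := by
  rw [← ofReal_integral_eq_lintegral_ofReal
    ((integrable_exp_neg_mul_sq (by positivity)).const_mul _)
    (Eventually.of_forall fun q => by positivity), integral_const_mul, integral_gaussian]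
  congr 1
  rw [← Real.sqrt_mul (by positivity)]
  rw [show Real.pi / ε * (Real.pi / (1 / (4 * ε))) = (2 * Real.pi) ^ 2 by field_simp; ring]
  exact Real.sqrt_sq (by positivity)

section Oscillatory

variable {X : Type*} [MeasurableSpace X] {μ : Measure X} [SFinite μ] {p : X → ℝ} {D : ℝ≥0}
  {h : X → ℂ}

/-- The estimate `lintegral_oscillatory_le` with a Gaussian weight in `t`. Squaring out and
integrating in `t` first leaves the kernel `K_ε (p x - p y)`, to which Schur's test applies. -/
theorem lintegral_gaussian_mul_oscillatory_le (hp : Measurable p)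
    (hmap : μ.map p ≤ D • volume) (hh : Integrable h μ) {ε : ℝ} (hε : 0 < ε) :
    ∫⁻ t : ℝ, ENNReal.ofReal (Real.exp (-ε * t ^ 2)) *
      ‖∫ x, Complex.exp (-(Complex.I * ((t * p x : ℝ) : ℂ))) * h x ∂μ‖ₑ ^ 2 ≤
      ENNReal.ofReal (2 * Real.pi) * D * ∫⁻ x, ‖h x‖ₑ ^ 2 ∂μ := by
  set K : ℝ → ℝ := fun q => Real.sqrt (Real.pi / ε) * Real.exp (-(1 / (4 * ε)) * q ^ 2) with hK
  have hKm : Measurable fun q => ENNReal.ofReal (K q) := by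
    have : Continuous K := by fun_prop
    exact this.measurable.ennreal_ofReal
  have hKeven : ∀ q, K (-q) = K q := fun q => by simp [hK]
  set q : X × X → ℝ := fun z => p z.1 - p z.2 with hq
  have hqm : Measurable q := (hp.comp measurable_fst).sub (hp.comp measurable_snd)
  set Hh : X × X → ℂ := fun z => h z.1 * (starRingEnd ℂ) (h z.2) with hHh
  have hHint : Integrable Hh (μ.prod μ) := by
    refine hh.mul_prod (g := fun x => (starRingEnd ℂ) (h x)) ?_
    exact (LinearIsometryEquiv.integrable_comp_iff Complex.conjLIE).2 hh
  set J : ℝ → ℂ := fun t => ∫ x, Complex.exp (-(Complex.I * ((t * p x : ℝ) : ℂ))) * h x ∂μ with hJ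
  have hJsq : ∀ t, J t * (starRingEnd ℂ) (J t) =
      ∫ z, Complex.exp (-(Complex.I * ((t * q z : ℝ) : ℂ))) * Hh z ∂(μ.prod μ) := by
    intro t
    have e1 : (starRingEnd ℂ) (J t) = ∫ x, (starRingEnd ℂ)
        (Complex.exp (-(Complex.I * ((t * p x : ℝ) : ℂ))) * h x) ∂μ := integral_conj.symm
    rw [e1, hJ, ← integral_prod_mul]
    refine integral_congr_ae (Eventually.of_forall fun z => ?_)
    simp only [map_mul, ← Complex.exp_conj, map_neg, Complex.conj_I, Complex.conj_ofReal, hHh, hq]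
    rw [mul_mul_mul_comm, ← Complex.exp_add]
    congr 2
    push_cast; ring
  have hgauss : Integrable (fun t : ℝ => ((Real.exp (-ε * t ^ 2) : ℝ) : ℂ)) :=
    (integrable_exp_neg_mul_sq hε).ofReal
  set Φ : ℝ × (X × X) → ℂ := fun w =>
    Complex.exp (-(Complex.I * ((w.1 * q w.2 : ℝ) : ℂ))) * (((Real.exp (-ε * w.1 ^ 2) : ℝ) : ℂ) * Hh w.2)
    with hΦ
  have hΦint : Integrable Φ (volume.prod (μ.prod μ)) := by
    refine (hgauss.mul_prod hHint).bdd_mul (c := 1) ?_ ?_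
    · refine Measurable.aestronglyMeasurable ?_
      have : Measurable fun w : ℝ × (X × X) => w.1 * q w.2 :=
        measurable_fst.mul (hqm.comp measurable_snd)
      fun_prop
    · refine Eventually.of_forall fun w => ?_
      rw [← mul_neg, ← Complex.ofReal_neg, mul_comm, Complex.norm_exp_ofReal_mul_I]
  have step1 : ∫⁻ t : ℝ, ENNReal.ofReal (Real.exp (-ε * t ^ 2)) * ‖J t‖ₑ ^ 2 =
      ‖∫ t : ℝ, ∫ z, Φ (t, z) ∂(μ.prod μ)‖ₑ := by
    have e1 : ∀ t, ∫ z, Φ (t, z) ∂(μ.prod μ) = ((Real.exp (-ε * t ^ 2) * ‖J t‖ ^ 2 : ℝ) : ℂ) := by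
      intro t
      have : (((‖J t‖ ^ 2 : ℝ)) : ℂ) = J t * (starRingEnd ℂ) (J t) := by
        rw [Complex.mul_conj, Complex.normSq_eq_norm_sq]
      rw [Complex.ofReal_mul, this, hJsq, ← integral_const_mul]
      refine integral_congr_ae (Eventually.of_forall fun z => ?_)
      simp only [hΦ]; ring
    have hint : Integrable fun t => Real.exp (-ε * t ^ 2) * ‖J t‖ ^ 2 := by
      have h1 := hΦint.integral_prod_left
      simp only [e1] at h1
      have h2 := h1.re
      simpa [Complex.ofReal_re, ← Complex.ofReal_mul, ← Complex.ofReal_pow] using h2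
    simp only [e1]
    rw [integral_complex_ofReal, ← ofReal_norm (E := ℂ), Complex.norm_real, Real.norm_eq_abs, abs_of_nonneg
      (integral_nonneg fun t => by positivity), ofReal_integral_eq_lintegral_ofReal hint
      (Eventually.of_forall fun t => by positivity)]
    refine lintegral_congr fun t => ?_
    rw [ENNReal.ofReal_mul (by positivity), ENNReal.ofReal_pow (norm_nonneg _), ofReal_norm]
  rw [step1, integral_integral_swap hΦint]
  have hKq : ∀ z, ‖∫ t : ℝ, Φ (t, z)‖ₑ = ENNReal.ofReal (K (q z)) * ‖Hh z‖ₑ := by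
    intro z
    have : ∀ t : ℝ, Φ (t, z) = (Complex.exp (-(Complex.I * ((t * q z : ℝ) : ℂ))) *
        ((Real.exp (-ε * t ^ 2) : ℝ) : ℂ)) * Hh z := fun t => by simp only [hΦ]; ring
    simp only [this]
    rw [integral_mul_const, enorm_mul, enorm_integral_gaussian_mul_cexp hε]
  have hhm : AEMeasurable (fun x => ‖h x‖ₑ ^ 2) μ := hh.1.enorm.pow_const 2
  -- Schur's test: the kernel has uniformly bounded integrals
  have hinner : ∀ x, ∫⁻ y, ENNReal.ofReal (K (p x - p y)) ∂μ ≤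
      ENNReal.ofReal (2 * Real.pi) * D := by
    intro x
    rw [← lintegral_map (f := fun r => ENNReal.ofReal (K (p x - r)))
      (hKm.comp (measurable_const.sub measurable_id)) hp]
    calc _ ≤ ∫⁻ r, ENNReal.ofReal (K (p x - r)) ∂((D : ℝ≥0∞) • volume) := by
          gcongr; exact hmap
      _ = D * ∫⁻ r, ENNReal.ofReal (K (p x - r)) := by rw [lintegral_smul_measure]; rfl
      _ = D * ∫⁻ r, ENNReal.ofReal (K r) := by
          rw [lintegral_sub_left_eq_self (fun r => ENNReal.ofReal (K r))]
      _ = _ := by rw [lintegral_gaussian_kernel hε, mul_comm]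
  have hAE1 : AEMeasurable (fun z : X × X => ENNReal.ofReal (K (q z)) * ‖h z.1‖ₑ ^ 2) (μ.prod μ) :=
    (hKm.comp hqm).aemeasurable.mul hhm.comp_fst
  have hx : ∫⁻ z, ENNReal.ofReal (K (q z)) * ‖h z.1‖ₑ ^ 2 ∂(μ.prod μ) ≤
      ENNReal.ofReal (2 * Real.pi) * D * ∫⁻ x, ‖h x‖ₑ ^ 2 ∂μ := by
    rw [lintegral_prod _ hAE1, ← lintegral_const_mul'' _ hhm]
    refine lintegral_mono fun x => ?_
    simp only [hq]
    rw [lintegral_mul_const (f := fun y => ENNReal.ofReal (K (p x - p y))) _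
      (hKm.comp (measurable_const.sub hp))]
    exact mul_le_mul_left (hinner x) _
  have hy : ∫⁻ z, ENNReal.ofReal (K (q z)) * ‖h z.2‖ₑ ^ 2 ∂(μ.prod μ) ≤
      ENNReal.ofReal (2 * Real.pi) * D * ∫⁻ x, ‖h x‖ₑ ^ 2 ∂μ := by
    rw [← lintegral_prod_swap]
    refine le_of_eq_of_le (lintegral_congr fun z => ?_) hx
    simp only [hq, Prod.fst_swap, Prod.snd_swap]
    rw [← hKeven, neg_sub]
  calc ‖∫ z, (∫ t : ℝ, Φ (t, z)) ∂(μ.prod μ)‖ₑ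
      ≤ ∫⁻ z, ENNReal.ofReal (K (q z)) * ‖Hh z‖ₑ ∂(μ.prod μ) := by
        refine (enorm_integral_le_lintegral_enorm _).trans (le_of_eq ?_)
        simp only [hKq]
    _ ≤ ∫⁻ z, 2⁻¹ * (ENNReal.ofReal (K (q z)) * ‖h z.1‖ₑ ^ 2 +
          ENNReal.ofReal (K (q z)) * ‖h z.2‖ₑ ^ 2) ∂(μ.prod μ) := by
        refine lintegral_mono fun z => ?_
        rw [← mul_add, mul_left_comm]
        refine mul_le_mul_right ?_ _
        simp only [hHh, enorm_mul]
        rw [show ‖(starRingEnd ℂ) (h z.2)‖ₑ = ‖h z.2‖ₑ by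
          rw [← ofReal_norm, RCLike.norm_conj, ofReal_norm]]
        have h2 : ∀ x y : ℝ≥0∞, 2 * (x * y) ≤ x ^ 2 + y ^ 2 := by
          intro x y
          rcases eq_or_ne x ∞ with rfl | hx
          · simp
          rcases eq_or_ne y ∞ with rfl | hy
          · simp
          lift x to ℝ≥0 using hx
          lift y to ℝ≥0 using hy
          norm_cast
          have := two_mul_le_add_sq x y
          rwa [mul_assoc] at this
        calc _ = 2⁻¹ * (2 * (‖h z.1‖ₑ * ‖h z.2‖ₑ)) := by
              rw [← mul_assoc, ENNReal.inv_mul_cancel (by norm_num) (by norm_num), one_mul]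
          _ ≤ _ := by gcongr; exact h2 _ _
    _ = 2⁻¹ * (∫⁻ z, ENNReal.ofReal (K (q z)) * ‖h z.1‖ₑ ^ 2 ∂(μ.prod μ) +
          ∫⁻ z, ENNReal.ofReal (K (q z)) * ‖h z.2‖ₑ ^ 2 ∂(μ.prod μ)) := by
        rw [lintegral_const_mul' _ _ (by norm_num), lintegral_add_left' hAE1]
    _ ≤ 2⁻¹ * (ENNReal.ofReal (2 * Real.pi) * D * ∫⁻ x, ‖h x‖ₑ ^ 2 ∂μ +
          ENNReal.ofReal (2 * Real.pi) * D * ∫⁻ x, ‖h x‖ₑ ^ 2 ∂μ) := by gcongr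
    _ = _ := by
        rw [← two_mul, ← mul_assoc, ENNReal.inv_mul_cancel (by norm_num) (by norm_num), one_mul]

/-- Plancherel's inequality in `t` for an oscillatory integral whose phase `p` maps `μ` to a measure
of density at most `D`. -/
theorem lintegral_oscillatory_le (hp : Measurable p)
    (hmap : μ.map p ≤ D • volume) (hh : Integrable h μ) :
    ∫⁻ t : ℝ, ‖∫ x, Complex.exp (-(Complex.I * ((t * p x : ℝ) : ℂ))) * h x ∂μ‖ₑ ^ 2 ≤
      ENNReal.ofReal (2 * Real.pi) * D * ∫⁻ x, ‖h x‖ₑ ^ 2 ∂μ := by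
  set J : ℝ → ℂ := fun t => ∫ x, Complex.exp (-(Complex.I * ((t * p x : ℝ) : ℂ))) * h x ∂μ with hJ
  have hJm : AEStronglyMeasurable J volume := by
    refine AEStronglyMeasurable.integral_prod_right' (f := fun w : ℝ × X =>
      Complex.exp (-(Complex.I * ((w.1 * p w.2 : ℝ) : ℂ))) * h w.2) ?_
    refine AEStronglyMeasurable.mul (Measurable.aestronglyMeasurable ?_) hh.1.comp_snd
    have : Measurable fun w : ℝ × X => w.1 * p w.2 :=
        measurable_fst.mul (hp.comp measurable_snd)
    fun_prop
  have hlim : ∀ t : ℝ, Tendsto (fun n : ℕ =>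
      ENNReal.ofReal (Real.exp (-(1 / ((n : ℝ) + 1)) * t ^ 2)) * ‖J t‖ₑ ^ 2) atTop
      (𝓝 (‖J t‖ₑ ^ 2)) := by
    intro t
    have h1 : Tendsto (fun n : ℕ => Real.exp (-(1 / ((n : ℝ) + 1)) * t ^ 2)) atTop (𝓝 1) := by
      have := (tendsto_one_div_add_atTop_nhds_zero_nat (𝕜 := ℝ)).neg.mul_const (t ^ 2)
      simpa [Function.comp_def] using (Real.continuous_exp.tendsto _).comp this
    have h2 := ENNReal.Tendsto.mul_const (b := ‖J t‖ₑ ^ 2) (ENNReal.tendsto_ofReal h1)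
      (Or.inl (by simp))
    simpa using h2
  calc _ = ∫⁻ t : ℝ, liminf (fun n : ℕ =>
      ENNReal.ofReal (Real.exp (-(1 / ((n : ℝ) + 1)) * t ^ 2)) * ‖J t‖ₑ ^ 2) atTop :=
        lintegral_congr fun t => (hlim t).liminf_eq.symm
    _ ≤ liminf (fun n : ℕ => ∫⁻ t : ℝ,
      ENNReal.ofReal (Real.exp (-(1 / ((n : ℝ) + 1)) * t ^ 2)) * ‖J t‖ₑ ^ 2) atTop := by
        refine lintegral_liminf_le' fun n => ?_
        refine AEMeasurable.mul ?_ (hJm.enorm.pow_const 2)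
        have : Continuous fun t : ℝ => Real.exp (-(1 / ((n : ℝ) + 1)) * t ^ 2) := by fun_prop
        exact this.measurable.ennreal_ofReal.aemeasurable
    _ ≤ _ := by
        refine liminf_le_of_le (by isBoundedDefault) fun c hc => ?_
        obtain ⟨n, hn⟩ := hc.exists
        exact hn.trans (lintegral_gaussian_mul_oscillatory_le hp hmap hh (by positivity))

end Oscillatory

/-! ### The phase of a pair of waves on the plane -/

/-- The substitution `r ↦ r²`. -/
theorem lintegral_mul_indicator_sq (S : Set ℝ) (hS : MeasurableSet S) :
    ∫⁻ r in Ioi (0 : ℝ), ENNReal.ofReal r * S.indicator 1 (r ^ 2) ≤ 2⁻¹ * volume S := by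
  have h := lintegral_image_eq_lintegral_abs_deriv_mul (s := Ioi (0 : ℝ)) (f := fun r : ℝ => r ^ 2)
    (f' := fun r => 2 * r) measurableSet_Ioi
    (fun x _ => by simpa using (hasDerivAt_pow 2 x).hasDerivWithinAt)
    (fun x hx y hy hxy => (pow_left_inj₀ (le_of_lt hx) (le_of_lt hy) two_ne_zero).1 hxy)
    (S.indicator 1)
  have h1 : ∫⁻ r in Ioi (0 : ℝ), ENNReal.ofReal |2 * r| * S.indicator 1 (r ^ 2) =
      2 * ∫⁻ r in Ioi (0 : ℝ), ENNReal.ofReal r * S.indicator 1 (r ^ 2) := by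
    rw [← lintegral_const_mul' _ _ (by norm_num)]
    refine setLIntegral_congr_fun measurableSet_Ioi fun r hr => ?_
    rw [abs_of_pos (by have : (0 : ℝ) < r := hr; positivity), ENNReal.ofReal_mul (by norm_num),
      mul_assoc]
    simp
  rw [h1] at h
  have h2 : 2 * ∫⁻ r in Ioi (0 : ℝ), ENNReal.ofReal r * S.indicator 1 (r ^ 2) ≤ volume S := by
    rw [← h]
    refine (setLIntegral_le_lintegral _ _).trans (le_of_eq ?_)
    rw [lintegral_indicator hS]; simp
  calc _ = 2⁻¹ * (2 * ∫⁻ r in Ioi (0 : ℝ), ENNReal.ofReal r * S.indicator 1 (r ^ 2)) := by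
        rw [← mul_assoc, ENNReal.inv_mul_cancel (by norm_num) (by norm_num), one_mul]
    _ ≤ _ := by gcongr

/-- The image of the area under `z ↦ ‖z‖²` has density at most `π`. -/
theorem volume_norm_sq_preimage_le (S : Set ℝ) (hS : MeasurableSet S) :
    volume {z : Plane | ‖z‖ ^ 2 ∈ S} ≤ ENNReal.ofReal Real.pi * volume S := by
  have hm : MeasurableSet {z : Plane | ‖z‖ ^ 2 ∈ S} :=
    (measurable_norm.pow_const 2) hS
  have hm' : MeasurableSet {z : ℂ | ‖z‖ ^ 2 ∈ S} := (measurable_norm.pow_const 2) hS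
  have e1 : volume {z : Plane | ‖z‖ ^ 2 ∈ S} = volume {z : ℂ | ‖z‖ ^ 2 ∈ S} := by
    rw [← (Complex.orthonormalBasisOneI.repr.measurePreserving).measure_preimage
      hm.nullMeasurableSet]
    congr 1
    ext z
    simp
  rw [e1, ← lintegral_indicator_one hm', ← Complex.lintegral_comp_polarCoord_symm,
    polarCoord_target]
  have e2 : ∀ p : ℝ × ℝ, ({z : ℂ | ‖z‖ ^ 2 ∈ S}.indicator (1 : ℂ → ℝ≥0∞)
      (Complex.polarCoord.symm p)) = S.indicator 1 (p.1 ^ 2) := by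
    intro p
    have : Complex.polarCoord.symm p ∈ {z : ℂ | ‖z‖ ^ 2 ∈ S} ↔ p.1 ^ 2 ∈ S := by
      rw [mem_ofPred_eq, Complex.norm_polarCoord_symm, sq_abs]
    by_cases hp : p.1 ^ 2 ∈ S
    · rw [indicator_of_mem hp, indicator_of_mem (this.2 hp)]; rfl
    · rw [indicator_of_notMem hp, indicator_of_notMem (mt this.1 hp)]
  simp only [e2, smul_eq_mul]
  have hmeas : Measurable fun r : ℝ => ENNReal.ofReal r * S.indicator (1 : ℝ → ℝ≥0∞) (r ^ 2) :=
    ENNReal.measurable_ofReal.mul ((measurable_one.indicator hS).comp (measurable_id.pow_const 2))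
  rw [Measure.volume_eq_prod, ← Measure.prod_restrict,
    lintegral_prod (fun p : ℝ × ℝ => ENNReal.ofReal p.1 * S.indicator (1 : ℝ → ℝ≥0∞) (p.1 ^ 2))
      (hmeas.comp measurable_fst).aemeasurable]
  simp only [lintegral_const, Measure.restrict_apply MeasurableSet.univ, univ_inter,
    Real.volume_Ioo]
  rw [lintegral_mul_const _ hmeas]
  calc _ ≤ 2⁻¹ * volume S * ENNReal.ofReal (Real.pi - -Real.pi) := by
        gcongr; exact lintegral_mul_indicator_sq S hS
    _ = _ := by
        rw [show Real.pi - -Real.pi = 2 * Real.pi by ring, ENNReal.ofReal_mul (by norm_num)]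
        rw [show ENNReal.ofReal 2 = 2 by simp]
        rw [mul_comm, ← mul_assoc, mul_comm 2, mul_assoc (ENNReal.ofReal _),
          ENNReal.mul_inv_cancel (by norm_num) (by norm_num), mul_one]

/-- The phase `(|2πη|² + k²) + (|2π(ξ - η)|² + k²)` of the product of two waves of frequencies `η`
and `ξ - η` in the `k`-th mode. -/
noncomputable def pairPhase (k : ℤ) (ξ η : Plane) : ℝ :=
  ((2 * Real.pi * ‖η‖) ^ 2 + (k : ℝ) ^ 2) + ((2 * Real.pi * ‖ξ - η‖) ^ 2 + (k : ℝ) ^ 2)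

theorem continuous_pairPhase (k : ℤ) : Continuous fun z : Plane × Plane => pairPhase k z.1 z.2 := by
  unfold pairPhase; fun_prop

theorem pairPhase_eq (k : ℤ) (ξ η : Plane) : pairPhase k ξ η =
    (2 * Real.pi ^ 2 * ‖ξ‖ ^ 2 + 2 * (k : ℝ) ^ 2) +
      (8 * Real.pi ^ 2) * ‖η - (2⁻¹ : ℝ) • ξ‖ ^ 2 := by
  have h := parallelogram_law_with_norm ℝ (η - (2⁻¹ : ℝ) • ξ) ((2⁻¹ : ℝ) • ξ)
  have h1 : η - (2⁻¹ : ℝ) • ξ + (2⁻¹ : ℝ) • ξ = η := by abel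
  have h2 : η - (2⁻¹ : ℝ) • ξ - (2⁻¹ : ℝ) • ξ = -(ξ - η) := by
    rw [sub_sub, ← add_smul]; norm_num
  have h3 : ‖(2⁻¹ : ℝ) • ξ‖ = 2⁻¹ * ‖ξ‖ := by rw [norm_smul]; norm_num
  rw [h1, h2, norm_neg, h3] at h
  unfold pairPhase
  linear_combination 4 * Real.pi ^ 2 * h

/-- Up to affine changes of variables the phase is `‖·‖²`, so it maps the area to a measure of
bounded density. This is where the dimension `2` enters. -/
theorem map_pairPhase_le (k : ℤ) (ξ : Plane) :
    (volume : Measure Plane).map (pairPhase k ξ) ≤ (1 : ℝ≥0) • volume := by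
  have hm : Measurable (pairPhase k ξ) :=
    ((continuous_pairPhase k).comp (Continuous.prodMk_right ξ)).measurable
  refine Measure.le_iff.2 fun S hS => ?_
  rw [Measure.map_apply hm hS, one_smul]
  set A := 2 * Real.pi ^ 2 * ‖ξ‖ ^ 2 + 2 * (k : ℝ) ^ 2 with hA
  set B := 8 * Real.pi ^ 2 with hB
  have hBpos : 0 < B := by positivity
  set S' : Set ℝ := (fun r => B * r) ⁻¹' ((fun r => A + r) ⁻¹' S) with hS'
  have hS'm : MeasurableSet S' :=
    (measurable_const_mul B) ((measurable_const_add A) hS)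
  have e1 : pairPhase k ξ ⁻¹' S = (fun η => η + -((2⁻¹ : ℝ) • ξ)) ⁻¹' {z : Plane | ‖z‖ ^ 2 ∈ S'} := by
    ext η
    simp [hS', pairPhase_eq, hA, hB, sub_eq_add_neg]
  rw [e1, measure_preimage_add_right]
  refine (volume_norm_sq_preimage_le S' hS'm).trans ?_
  rw [hS', Real.volume_preimage_mul_left hBpos.ne', measure_preimage_add, ← mul_assoc,
    ← ENNReal.ofReal_mul Real.pi_pos.le]
  refine mul_le_of_le_one_left zero_le ?_
  rw [← ENNReal.ofReal_one]
  refine ENNReal.ofReal_le_ofReal ?_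
  rw [abs_of_pos (inv_pos.2 hBpos), ← div_eq_mul_inv, div_le_one hBpos, hB]
  nlinarith [Real.pi_gt_three]

/-- Plancherel for the square of a function. -/
theorem lintegral_enorm_fourierInv_pow_four (g : SchwartzMap Plane ℂ) :
    ∫⁻ x, ‖(𝓕⁻ g) x‖ₑ ^ 4 = ∫⁻ ξ, ‖∫ η, g η * g (ξ - η)‖ₑ ^ 2 := by
  set c := SchwartzMap.convolution (ContinuousLinearMap.mul ℂ ℂ) g g with hc
  have h1 : ∀ ξ, c ξ = ∫ η, g η * g (ξ - η) := fun ξ => by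
    rw [hc, SchwartzMap.convolution_apply]; rfl
  have h2 : ∀ x, 𝓕 c x = 𝓕 g x * 𝓕 g x := fun x => by
    rw [hc, SchwartzMap.fourier_convolution]; rfl
  have h3 := SchwartzMap.norm_fourier_toL2_eq c
  have h4 : ∀ f : SchwartzMap Plane ℂ, ∫⁻ x, ‖f x‖ₑ ^ 2 = ‖f.toLp 2‖ₑ ^ 2 := by
    intro f
    rw [Lp.enorm_def, eLpNorm_congr_ae (f.coeFn_toLp 2 volume),
      eLpNorm_eq_lintegral_rpow_enorm_toReal (by norm_num) (by norm_num)]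
    simp only [ENNReal.toReal_ofNat, ENNReal.rpow_two]
    rw [← ENNReal.rpow_two, ← ENNReal.rpow_mul]
    norm_num
  calc ∫⁻ x, ‖(𝓕⁻ g) x‖ₑ ^ 4 = ∫⁻ x, ‖(𝓕 g) (-x)‖ₑ ^ 4 := by
        refine lintegral_congr fun x => ?_
        rw [SchwartzMap.fourierInv_apply_eq]
        rfl
    _ = ∫⁻ x, ‖(𝓕 g) x‖ₑ ^ 4 := lintegral_neg_eq_self (fun x => ‖(𝓕 g) x‖ₑ ^ 4)
    _ = ∫⁻ x, ‖(𝓕 c) x‖ₑ ^ 2 := by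
        refine lintegral_congr fun x => ?_
        rw [h2, enorm_mul, ← sq, ← pow_mul]
    _ = ∫⁻ x, ‖c x‖ₑ ^ 2 := by
        rw [h4, h4, ← ofReal_norm, ← ofReal_norm, h3]
    _ = _ := by simp only [h1]

/-! ### The `L⁴` Strichartz estimate on the plane -/

section TestFunctions

open scoped ContDiff

/-- A criterion adapted to Fatou's lemma, which applies after passing to a subsequence that
converges almost everywhere. -/
theorem lowerSemicontinuous_of_subseq {M : Type*} [TopologicalSpace M] [SequentialSpace M]
    {Φ : M → ℝ≥0∞}
    (h : ∀ (f : ℕ → M) (g : M), Tendsto f atTop (𝓝 g) →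
      ∃ ns : ℕ → ℕ, Φ g ≤ liminf (fun n => Φ (f (ns n))) atTop) :
    LowerSemicontinuous Φ := by
  rw [lowerSemicontinuous_iff_isClosed_preimage]
  intro c
  refine IsSeqClosed.isClosed fun f g hf hg => ?_
  obtain ⟨ns, hns⟩ := h f g hg
  refine hns.trans (liminf_le_of_le (by isBoundedDefault) fun d hd => ?_)
  obtain ⟨n, hn⟩ := hd.exists
  exact hn.trans (hf _)

theorem lowerSemicontinuous_lintegral_enorm_pow_four :
    LowerSemicontinuous fun φ : L2Plane => ∫⁻ x, ‖φ x‖ₑ ^ 4 := by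
  refine lowerSemicontinuous_of_subseq fun f g hfg => ?_
  obtain ⟨ns, -, hns⟩ := (tendstoInMeasure_of_tendsto_Lp hfg).exists_seq_tendsto_ae
  refine ⟨ns, ?_⟩
  calc ∫⁻ x, ‖g x‖ₑ ^ 4 ≤ ∫⁻ x, liminf (fun n => ‖f (ns n) x‖ₑ ^ 4) atTop := by
        refine lintegral_mono_ae ?_
        filter_upwards [hns] with x hx
        exact (((ENNReal.continuous_pow 4).tendsto _).comp hx.enorm).liminf_eq.ge
    _ ≤ _ := lintegral_liminf_le' fun n => ((Lp.aestronglyMeasurable _).enorm.pow_const 4)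

theorem lintegral_enorm_sq_eq {X : Type*} [MeasurableSpace X] {μ : Measure X} (f : Lp ℂ 2 μ) :
    ∫⁻ x, ‖f x‖ₑ ^ 2 ∂μ = ‖f‖ₑ ^ 2 := by
  rw [Lp.enorm_def, eLpNorm_eq_lintegral_rpow_enorm_toReal (by norm_num) (by norm_num)]
  simp only [ENNReal.toReal_ofNat, ENNReal.rpow_two]
  rw [← ENNReal.rpow_two, ← ENNReal.rpow_mul]
  norm_num

theorem continuous_schrodingerSymbol (k : ℤ) :
    Continuous fun z : ℝ × Plane => schrodingerSymbol z.1 k z.2 := by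
  unfold schrodingerSymbol; fun_prop

theorem fourier_modePropagator (t : ℝ) (k : ℤ) (φ : L2Plane) :
    (𝓕 (modePropagator t k φ) : L2Plane) =ᵐ[volume]
      fun ξ => schrodingerSymbol t k ξ * (𝓕 φ : L2Plane) ξ := by
  unfold modePropagator
  rw [FourierTransform.fourier_fourierInv_eq]
  exact MemLp.coeFn_toLp _

theorem norm_eq_of_ae_eq_mul {X : Type*} [MeasurableSpace X] {μ : Measure X} {m : X → ℂ}
    (hm : ∀ x, ‖m x‖ = 1) {f g : Lp ℂ 2 μ} (h : f =ᵐ[μ] fun x => m x * g x) : ‖f‖ = ‖g‖ := by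
  rw [Lp.norm_def, Lp.norm_def]
  congr 1
  refine eLpNorm_congr_norm_ae ?_
  filter_upwards [h] with x hx
  rw [hx, norm_mul, hm, one_mul]

theorem norm_modePropagator (t : ℝ) (k : ℤ) (φ : L2Plane) : ‖modePropagator t k φ‖ = ‖φ‖ := by
  rw [← Lp.norm_fourier_eq (modePropagator t k φ), ← Lp.norm_fourier_eq (E := Plane) (F := ℂ) φ]
  exact norm_eq_of_ae_eq_mul (norm_schrodingerSymbol t k) (fourier_modePropagator t k φ)

theorem fourier_injective {φ ψ : L2Plane} (h : (𝓕 φ : L2Plane) = 𝓕 ψ) : φ = ψ :=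
  (Lp.fourierTransformₗᵢ Plane ℂ).injective h

theorem modePropagator_add (t : ℝ) (k : ℤ) (φ ψ : L2Plane) :
    modePropagator t k (φ + ψ) = modePropagator t k φ + modePropagator t k ψ := by
  refine fourier_injective (Lp.ext ?_)
  rw [FourierTransform.fourier_add]
  filter_upwards [fourier_modePropagator t k (φ + ψ), fourier_modePropagator t k φ,
    fourier_modePropagator t k ψ, Lp.coeFn_add (𝓕 (modePropagator t k φ) : L2Plane)
      (𝓕 (modePropagator t k ψ)), Lp.coeFn_add (𝓕 φ : L2Plane) (𝓕 ψ)] with ξ h1 h2 h3 h4 h5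
  rw [h1, h4, Pi.add_apply, h2, h3, FourierTransform.fourier_add, h5, Pi.add_apply, mul_add]

theorem modePropagator_smul (t : ℝ) (k : ℤ) (c : ℂ) (φ : L2Plane) :
    modePropagator t k (c • φ) = c • modePropagator t k φ := by
  refine fourier_injective (Lp.ext ?_)
  rw [FourierTransform.fourier_smul]
  filter_upwards [fourier_modePropagator t k (c • φ), fourier_modePropagator t k φ,
    Lp.coeFn_smul c (𝓕 (modePropagator t k φ) : L2Plane),
    Lp.coeFn_smul c (𝓕 φ : L2Plane)] with ξ h1 h2 h4 h5
  rw [h1, h4, Pi.smul_apply, h2, FourierTransform.fourier_smul, h5, Pi.smul_apply, smul_eq_mul,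
    smul_eq_mul, mul_left_comm]

/-- `modePropagator` as a linear isometry. -/
noncomputable def modePropagatorₗᵢ (t : ℝ) (k : ℤ) : L2Plane →ₗᵢ[ℂ] L2Plane where
  toFun := modePropagator t k
  map_add' := modePropagator_add t k
  map_smul' := modePropagator_smul t k
  norm_map' := norm_modePropagator t k

theorem continuous_modePropagator (k : ℤ) (φ : L2Plane) :
    Continuous fun t => modePropagator t k φ := by
  rw [continuous_iff_continuousAt]
  intro t₀
  have hF : Continuous (fun φ : L2Plane => (𝓕⁻ φ : L2Plane)) :=
    (Lp.fourierTransformₗᵢ Plane ℂ).symm.continuous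
  set g : L2Plane := 𝓕 φ with hg
  suffices h : Tendsto (fun t => (memLp_symbol_mul t k g).toLp _) (𝓝 t₀)
      (𝓝 ((memLp_symbol_mul t₀ k g).toLp _)) from (hF.tendsto _).comp h
  rw [tendsto_iff_edist_tendsto_0]
  have e1 : ∀ t, edist ((memLp_symbol_mul t k g).toLp _) ((memLp_symbol_mul t₀ k g).toLp _) =
      (∫⁻ ξ, ‖(schrodingerSymbol t k ξ - schrodingerSymbol t₀ k ξ) * g ξ‖ₑ ^ 2) ^ (1 / 2 : ℝ) := by
    intro t
    rw [Lp.edist_toLp_toLp, eLpNorm_eq_lintegral_rpow_enorm_toReal (by norm_num) (by norm_num)]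
    simp [sub_mul]
  simp only [e1]
  have h0 : Tendsto (fun t => ∫⁻ ξ, ‖(schrodingerSymbol t k ξ - schrodingerSymbol t₀ k ξ) * g ξ‖ₑ ^ 2)
      (𝓝 t₀) (𝓝 (∫⁻ _ξ : Plane, 0)) := by
    refine tendsto_of_seq_tendsto fun τ hτ => ?_
    refine tendsto_lintegral_of_dominated_convergence' (fun ξ => (2 * ‖g ξ‖ₑ) ^ 2) ?_ ?_ ?_ ?_
    · refine fun n => AEMeasurable.pow_const ?_ 2
      have hc : ∀ t, Continuous fun ξ : Plane => schrodingerSymbol t k ξ := fun t =>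
        (continuous_schrodingerSymbol k).comp (Continuous.prodMk_right t)
      exact (((hc _).sub (hc t₀)).aestronglyMeasurable.mul (Lp.aestronglyMeasurable g)).enorm
    · refine fun n => Eventually.of_forall fun ξ => ?_
      simp only [enorm_mul]
      gcongr
      refine (enorm_sub_le).trans (le_of_eq ?_)
      rw [← ofReal_norm, ← ofReal_norm, norm_schrodingerSymbol, norm_schrodingerSymbol]
      norm_num
    · simp only [mul_pow]
      rw [lintegral_const_mul' _ _ (by norm_num), lintegral_enorm_sq_eq]
      exact ENNReal.mul_ne_top (by norm_num) (ENNReal.pow_ne_top enorm_ne_top)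
    · refine Eventually.of_forall fun ξ => ?_
      have hc : Continuous fun t => ‖(schrodingerSymbol t k ξ - schrodingerSymbol t₀ k ξ) * g ξ‖ₑ ^ 2 := by
        have := (continuous_schrodingerSymbol k).comp (Continuous.prodMk_left ξ)
        refine (ENNReal.continuous_pow 2).comp (continuous_enorm.comp ?_)
        exact (this.sub continuous_const).mul continuous_const
      simpa [Function.comp_def] using (hc.tendsto t₀).comp hτ
  rw [lintegral_zero] at h0
  have := (ENNReal.continuous_rpow_const (y := (1 / 2 : ℝ))).tendsto 0 |>.comp h0
  simpa [Function.comp_def] using this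

theorem lintegral_conv_sq (g : Plane → ℂ) (hg : AEStronglyMeasurable g volume) :
    ∫⁻ ξ, ∫⁻ η, ‖g η * g (ξ - η)‖ₑ ^ 2 = (∫⁻ η, ‖g η‖ₑ ^ 2) ^ 2 := by
  have hm : AEMeasurable (fun η => ‖g η‖ₑ ^ 2) volume := hg.enorm.pow_const 2
  rw [lintegral_lintegral_swap (((hg.comp_snd (μ := (volume : Measure Plane))).mul
    (hg.comp_quasiMeasurePreserving (quasiMeasurePreserving_sub_of_right_invariant
      (volume : Measure Plane) (volume : Measure Plane)))).enorm.pow_const 2)]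
  · simp only [enorm_mul, mul_pow]
    have : ∀ η : Plane, ∫⁻ ξ : Plane, ‖g η‖ₑ ^ 2 * ‖g (ξ - η)‖ₑ ^ 2 = ‖g η‖ₑ ^ 2 * ∫⁻ ξ, ‖g ξ‖ₑ ^ 2 := by
      intro η
      rw [lintegral_const_mul' _ _ (ENNReal.pow_ne_top enorm_ne_top),
        lintegral_sub_right_eq_self (fun ξ => ‖g ξ‖ₑ ^ 2)]
    simp only [this]
    rw [lintegral_mul_const'' _ hm, sq]

/-- The Strichartz estimate when the Fourier transform of the datum is a test function. -/
theorem strichartz_of_contDiff (k : ℤ) {g : Plane → ℂ} (hg : ContDiff ℝ ∞ g)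
    (hgc : HasCompactSupport g) :
    ∫⁻ t, ∫⁻ x, ‖modePropagator t k (𝓕⁻ ((hgc.toSchwartzMap hg).toLp 2 volume)) x‖ₑ ^ 4 ≤
      ENNReal.ofReal (2 * Real.pi) * ‖(hgc.toSchwartzMap hg).toLp 2 volume‖ₑ ^ 4 := by
  set G := hgc.toSchwartzMap hg with hG
  have hGg : ∀ η, G η = g η := fun η => rfl
  have hsm : ∀ t, ContDiff ℝ ∞ fun ξ : Plane => schrodingerSymbol t k ξ * g ξ := by
    intro t
    have h1 : ContDiff ℝ ∞ fun ξ : Plane => ‖ξ‖ ^ 2 := contDiff_norm_sq ℝ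
    have h2 : ContDiff ℝ ∞ fun ξ : Plane =>
        (((t * ((2 * Real.pi) ^ 2 * ‖ξ‖ ^ 2 + (k : ℝ) ^ 2) : ℝ)) : ℂ) :=
      Complex.ofRealCLM.contDiff.comp
        (contDiff_const.mul ((contDiff_const.mul h1).add contDiff_const))
    have h3 := ((contDiff_const (c := Complex.I)).mul h2).neg.cexp
    refine ContDiff.mul ?_ hg
    unfold schrodingerSymbol
    simpa only [mul_pow] using h3
  have hcs : ∀ t, HasCompactSupport fun ξ : Plane => schrodingerSymbol t k ξ * g ξ :=
    fun t => hgc.mul_left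
  set Gt : ℝ → SchwartzMap Plane ℂ := fun t => (hcs t).toSchwartzMap (hsm t) with hGt
  have hGtg : ∀ t η, Gt t η = schrodingerSymbol t k η * g η := fun t η => rfl
  have hmp : ∀ t, modePropagator t k (𝓕⁻ (G.toLp 2 volume)) = (𝓕⁻ (Gt t)).toLp 2 volume := by
    intro t
    rw [← SchwartzMap.toLp_fourierInv_eq]
    unfold modePropagator
    congr 1
    refine Lp.ext ?_
    refine (MemLp.coeFn_toLp _).trans ?_
    rw [FourierTransform.fourier_fourierInv_eq]
    filter_upwards [G.coeFn_toLp 2 volume, (Gt t).coeFn_toLp 2 volume] with ξ h1 h2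
    rw [h1, h2, hGtg, hGg]
  -- the square of a free wave is an oscillatory integral with phase `pairPhase`
  have hY : ∀ t, ∫⁻ x, ‖modePropagator t k (𝓕⁻ (G.toLp 2 volume)) x‖ₑ ^ 4 =
      ∫⁻ ξ, ‖∫ η, Complex.exp (-(Complex.I * ((t * pairPhase k ξ η : ℝ) : ℂ))) *
        (g η * g (ξ - η))‖ₑ ^ 2 := by
    intro t
    rw [hmp]
    have : ∫⁻ x, ‖((𝓕⁻ (Gt t)).toLp 2 volume : L2Plane) x‖ₑ ^ 4 = ∫⁻ x, ‖(𝓕⁻ (Gt t)) x‖ₑ ^ 4 := by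
      refine lintegral_congr_ae ?_
      filter_upwards [(𝓕⁻ (Gt t)).coeFn_toLp 2 volume] with x hx
      rw [hx]
    rw [this, lintegral_enorm_fourierInv_pow_four]
    refine lintegral_congr fun ξ => ?_
    congr 2
    refine integral_congr_ae (Eventually.of_forall fun η => ?_)
    simp only [hGtg]
    rw [mul_mul_mul_comm]
    congr 1
    unfold schrodingerSymbol pairPhase
    rw [← Complex.exp_add]
    congr 1
    push_cast; ring
  simp only [hY]
  have hcont : Continuous fun w : (ℝ × Plane) × Plane =>
      Complex.exp (-(Complex.I * ((w.1.1 * pairPhase k w.1.2 w.2 : ℝ) : ℂ))) *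
        (g w.2 * g (w.1.2 - w.2)) := by
    have h1 : Continuous fun w : (ℝ × Plane) × Plane => pairPhase k w.1.2 w.2 :=
      by unfold pairPhase; fun_prop
    have h2 := hg.continuous
    fun_prop
  rw [lintegral_lintegral_swap]
  swap
  · have := hcont.stronglyMeasurable.integral_prod_right' (ν := (volume : Measure Plane))
    exact (this.enorm.pow_const 2).aemeasurable
  have hgi : Integrable g := hg.continuous.integrable_of_hasCompactSupport hgc
  have hbd : ∀ ξ : Plane, Integrable fun η => g η * g (ξ - η) := by
    intro ξ
    have : Continuous fun η => g η * g (ξ - η) :=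
      hg.continuous.mul (hg.continuous.comp (continuous_const.sub continuous_id))
    exact this.integrable_of_hasCompactSupport hgc.mul_right
  calc _ ≤ ∫⁻ ξ : Plane, ENNReal.ofReal (2 * Real.pi) * (1 : ℝ≥0) * ∫⁻ η, ‖g η * g (ξ - η)‖ₑ ^ 2 := by
        refine lintegral_mono fun ξ => ?_
        exact lintegral_oscillatory_le
          ((continuous_pairPhase k).comp (Continuous.prodMk_right ξ)).measurable
          (map_pairPhase_le k ξ) (hbd ξ)
    _ = ENNReal.ofReal (2 * Real.pi) * (∫⁻ η, ‖g η‖ₑ ^ 2) ^ 2 := by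
        rw [lintegral_const_mul' _ _ (by finiteness), lintegral_conv_sq _ hgi.1]
        simp
    _ = _ := by
        rw [show (4 : ℕ) = 2 * 2 by norm_num, pow_mul, ← lintegral_enorm_sq_eq]
        congr 2
        refine lintegral_congr_ae ?_
        filter_upwards [G.coeFn_toLp 2 volume] with x hx
        rw [hx, hGg]

theorem lintegral_modePropagator_le_of_contDiff (k : ℤ) {g : Plane → ℂ} (hg : ContDiff ℝ ∞ g)
    (hgc : HasCompactSupport g) (φ : L2Plane)
    (hφ : (𝓕 φ : L2Plane) = (hgc.toSchwartzMap hg).toLp 2 volume) :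
    ∫⁻ t, ∫⁻ x, ‖modePropagator t k φ x‖ₑ ^ 4 ≤ ENNReal.ofReal (2 * Real.pi) * ‖φ‖ₑ ^ 4 := by
  have h1 : φ = 𝓕⁻ ((hgc.toSchwartzMap hg).toLp 2 volume : L2Plane) := by
    rw [← hφ, FourierTransform.fourierInv_fourier_eq]
  have h2 : ‖φ‖ₑ = ‖(hgc.toSchwartzMap hg).toLp 2 volume‖ₑ := by
    rw [← hφ, ← ofReal_norm, ← ofReal_norm, Lp.norm_fourier_eq]
  rw [h2]
  conv_lhs => rw [h1]
  exact strichartz_of_contDiff k hg hgc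

/-- Test functions are dense in `L²(ℝ²)`. -/
theorem exists_seq_contDiff_tendsto (ψ : L2Plane) :
    ∃ f : ℕ → L2Plane, Tendsto f atTop (𝓝 ψ) ∧ ∀ n, ∃ (g : Plane → ℂ) (hg : ContDiff ℝ ∞ g)
      (hgc : HasCompactSupport g), f n = (hgc.toSchwartzMap hg).toLp 2 volume := by
  set S : Set L2Plane := {f | ∃ (g : Plane → ℂ) (hg : ContDiff ℝ ∞ g)
      (hgc : HasCompactSupport g), f = (hgc.toSchwartzMap hg).toLp 2 volume} with hS
  have hmem : ψ ∈ closure S := by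
    refine (mem_closure_iff_nhds_basis Metric.nhds_basis_closedBall).2 fun ε hε => ?_
    obtain ⟨g, hg₁, hg₂, hg₃⟩ := MemLp.exist_eLpNorm_sub_le (by norm_num) (by norm_num)
      (Lp.memLp ψ) hε
    refine ⟨_, ⟨g, hg₂, hg₁, rfl⟩, ?_⟩
    have : (ψ : Plane → ℂ) - ((hg₁.toSchwartzMap hg₂).toLp 2 volume : Plane → ℂ) =ᵐ[volume]
        (ψ : Plane → ℂ) - g := by
      filter_upwards [(hg₁.toSchwartzMap hg₂).coeFn_toLp 2 volume]
      simp
    rw [Metric.mem_closedBall', Lp.dist_def, eLpNorm_congr_ae this]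
    exact ENNReal.toReal_le_of_le_ofReal hε.le hg₃
  obtain ⟨f, hf, hlim⟩ := mem_closure_iff_seq_limit.1 hmem
  exact ⟨f, hlim, hf⟩

theorem measurable_lintegral_modePropagator (k : ℤ) (φ : L2Plane) :
    Measurable fun t => ∫⁻ x, ‖modePropagator t k φ x‖ₑ ^ 4 :=
  (lowerSemicontinuous_lintegral_enorm_pow_four.comp (continuous_modePropagator k φ)).measurable

/-- The `L⁴` Strichartz estimate on the plane. -/
theorem strichartz_modePropagator (k : ℤ) (φ : L2Plane) :
    ∫⁻ t, ∫⁻ x, ‖modePropagator t k φ x‖ₑ ^ 4 ≤ ENNReal.ofReal (2 * Real.pi) * ‖φ‖ₑ ^ 4 := by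
  obtain ⟨f, hf, hfS⟩ := exists_seq_contDiff_tendsto (𝓕 φ)
  set ψ : ℕ → L2Plane := fun n => 𝓕⁻ (f n) with hψ
  have hlim : Tendsto ψ atTop (𝓝 φ) := by
    have h := ((Lp.fourierTransformₗᵢ Plane ℂ).symm.continuous.tendsto (𝓕 φ)).comp hf
    rw [show (𝓕 φ : L2Plane) = Lp.fourierTransformₗᵢ Plane ℂ φ from rfl,
      LinearIsometryEquiv.symm_apply_apply] at h
    exact h
  have hb : ∀ n, ∫⁻ t, ∫⁻ x, ‖modePropagator t k (ψ n) x‖ₑ ^ 4 ≤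
      ENNReal.ofReal (2 * Real.pi) * ‖ψ n‖ₑ ^ 4 := by
    intro n
    obtain ⟨g, hg, hgc, he⟩ := hfS n
    refine lintegral_modePropagator_le_of_contDiff k hg hgc (ψ n) ?_
    rw [hψ, FourierTransform.fourier_fourierInv_eq, he]
  have hpt : ∀ t, ∫⁻ x, ‖modePropagator t k φ x‖ₑ ^ 4 ≤
      liminf (fun n => ∫⁻ x, ‖modePropagator t k (ψ n) x‖ₑ ^ 4) atTop := by
    intro t
    have h1 : Tendsto (fun n => modePropagator t k (ψ n)) atTop (𝓝 (modePropagator t k φ)) :=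
      ((modePropagatorₗᵢ t k).continuous.tendsto φ).comp hlim
    exact (lowerSemicontinuous_lintegral_enorm_pow_four.le_liminf _).trans
      (liminf_le_liminf_of_le h1)
  have hlim2 : Tendsto (fun n => ENNReal.ofReal (2 * Real.pi) * ‖ψ n‖ₑ ^ 4) atTop
      (𝓝 (ENNReal.ofReal (2 * Real.pi) * ‖φ‖ₑ ^ 4)) :=
    ENNReal.Tendsto.const_mul (((ENNReal.continuous_pow 4).tendsto _).comp hlim.enorm)
      (Or.inr (by finiteness))
  calc _ ≤ ∫⁻ t, liminf (fun n => ∫⁻ x, ‖modePropagator t k (ψ n) x‖ₑ ^ 4) atTop :=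
        lintegral_mono hpt
    _ ≤ liminf (fun n => ∫⁻ t, ∫⁻ x, ‖modePropagator t k (ψ n) x‖ₑ ^ 4) atTop :=
        lintegral_liminf_le fun n => measurable_lintegral_modePropagator k _
    _ ≤ liminf (fun n => ENNReal.ofReal (2 * Real.pi) * ‖ψ n‖ₑ ^ 4) atTop :=
        liminf_le_liminf (Eventually.of_forall hb)
    _ = _ := hlim2.liminf_eq

end TestFunctions

/-! ### Fourier coefficients of slices -/

theorem torusCoeff_eq_fourierCoeff (k : ℤ) (g : Torus → ℂ) :
    torusCoeff k g = ((Real.sqrt (2 * Real.pi) : ℝ) : ℂ) * fourierCoeff g k := by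
  have hpi : (0 : ℝ) < 2 * Real.pi := Real.two_pi_pos
  rw [torusCoeff, fourierCoeff, AddCircle.integral_haarAddCircle]
  have h1 : (((Real.sqrt (2 * Real.pi) : ℝ)) : ℂ) ≠ 0 := by
    exact_mod_cast (Real.sqrt_pos.2 hpi).ne'
  have h2 : (((Real.sqrt (2 * Real.pi) : ℝ)) : ℂ) * ((Real.sqrt (2 * Real.pi) : ℝ) : ℂ) =
      ((2 * Real.pi : ℝ) : ℂ) := by
    rw [← Complex.ofReal_mul, Real.mul_self_sqrt hpi.le]
  have h3 : ∀ y : Torus, fourier (-k) y • g y = g y * fourier (-k) y := fun y => by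
    rw [smul_eq_mul, mul_comm]
  simp only [h3]
  rw [Complex.real_smul, ← mul_assoc]
  congr 1
  rw [Complex.ofReal_inv, ← h2]
  field_simp

/-- Parseval's identity on the circle. -/
theorem tsum_enorm_torusCoeff_sq {g : Torus → ℂ} (hg : MemLp g 2 volume) :
    ∑' k, ‖torusCoeff k g‖ₑ ^ 2 = ∫⁻ y, ‖g y‖ₑ ^ 2 := by
  have hpi : (0 : ℝ) < 2 * Real.pi := Real.two_pi_pos
  have hg' : MemLp g 2 AddCircle.haarAddCircle := memLp_haarAddCircle_iff.2 hg
  have h := hasSum_sq_fourierCoeff (hg'.toLp g)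
  have hco : ∀ k, fourierCoeff (hg'.toLp g) k = fourierCoeff g k := fun k =>
    congrFun (fourierCoeff_congr_ae hg'.coeFn_toLp) k
  simp only [hco] at h
  have h1 : ∑' k, ‖fourierCoeff g k‖ₑ ^ 2 = ∫⁻ y, ‖g y‖ₑ ^ 2 ∂AddCircle.haarAddCircle := by
    have e1 := ENNReal.ofReal_tsum_of_nonneg (fun k => by positivity) h.summable
    rw [h.tsum_eq] at e1
    rw [ofReal_integral_eq_lintegral_ofReal
      ((memLp_two_iff_integrable_sq_norm (Lp.aestronglyMeasurable _)).1 (Lp.memLp _))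
      (Eventually.of_forall fun y => by positivity)] at e1
    simp only [ENNReal.ofReal_pow (norm_nonneg _), ofReal_norm] at e1
    rw [← e1]
    refine lintegral_congr_ae ?_
    filter_upwards [hg'.coeFn_toLp] with y hy
    rw [hy]
  rw [AddCircle.volume_eq_smul_haarAddCircle, lintegral_smul_measure, ← h1, smul_eq_mul,
    ← ENNReal.tsum_mul_left]
  refine tsum_congr fun k => ?_
  rw [torusCoeff_eq_fourierCoeff, enorm_mul, mul_pow]
  congr 1
  rw [← ofReal_norm, Complex.norm_real, Real.norm_eq_abs, ← ENNReal.ofReal_pow (abs_nonneg _),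
    sq_abs, Real.sq_sqrt hpi.le]

/-- An element of `L²(ℝ² × 𝕋)` is measurable for the product measure, the form in which it is
needed for Fubini's theorem. -/
theorem aestronglyMeasurable_prod (f : L2) : AEStronglyMeasurable (f : Plane × Torus → ℂ)
    ((volume : Measure Plane).prod (volume : Measure Torus)) := Lp.aestronglyMeasurable f

theorem lintegral_slices (f : L2) : ∫⁻ x, ∫⁻ y, ‖f (x, y)‖ₑ ^ 2 = ‖f‖ₑ ^ 2 := by
  rw [← lintegral_enorm_sq_eq]
  exact (lintegral_prod _ ((aestronglyMeasurable_prod f).enorm.pow_const 2)).symm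

theorem ae_memLp_slice (f : L2) : ∀ᵐ x, MemLp (fun y => f (x, y)) 2 volume := by
  have hf := aestronglyMeasurable_prod f
  have h1 : ∀ᵐ x : Plane, ∫⁻ y, ‖f (x, y)‖ₑ ^ 2 < ∞ := by
    refine ae_lt_top' ((hf.enorm.pow_const 2).lintegral_prod_right') ?_
    rw [lintegral_slices]
    exact ENNReal.pow_ne_top enorm_ne_top
  filter_upwards [h1, hf.prodMk_left] with x hx hm
  refine ⟨hm, ?_⟩
  rw [eLpNorm_lt_top_iff_lintegral_rpow_enorm_lt_top two_ne_zero ENNReal.ofNat_ne_top]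
  simpa using hx

theorem coeFn_partialCoeff (k : ℤ) (f : L2) :
    (partialCoeff k f : Plane → ℂ) =ᵐ[volume] fun x => torusCoeff k fun y => f (x, y) :=
  MemLp.coeFn_toLp _

theorem ae_tsum_partialCoeff (f : L2) :
    ∀ᵐ x, ∑' k, ‖partialCoeff k f x‖ₑ ^ 2 = ∫⁻ y, ‖f (x, y)‖ₑ ^ 2 := by
  filter_upwards [ae_memLp_slice f, ae_all_iff.2 fun k => coeFn_partialCoeff k f] with x hx hk
  simp only [hk]
  exact tsum_enorm_torusCoeff_sq hx

theorem tsum_enorm_partialCoeff (f : L2) : ∑' k, ‖partialCoeff k f‖ₑ ^ 2 = ‖f‖ₑ ^ 2 := by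
  simp only [← lintegral_enorm_sq_eq (partialCoeff _ f)]
  rw [← lintegral_tsum fun k => (Lp.aestronglyMeasurable _).enorm.pow_const 2, ← lintegral_slices]
  exact lintegral_congr_ae (ae_tsum_partialCoeff f)

theorem enorm_partialCoeff_le (k : ℤ) (f : L2) : ‖partialCoeff k f‖ₑ ≤ ‖f‖ₑ := by
  have : ‖partialCoeff k f‖ₑ ^ 2 ≤ ‖f‖ₑ ^ 2 := by
    rw [← tsum_enorm_partialCoeff]; exact ENNReal.le_tsum k
  exact (ENNReal.pow_le_pow_left_iff two_ne_zero).1 this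

theorem integrable_mul_fourier (k : ℤ) {g : Torus → ℂ} (hg : MemLp g 2 volume) :
    Integrable (fun y => g y * fourier k y) := by
  refine (hg.integrable (by norm_num)).mul_bdd (c := 1)
    (fourier k).continuous.aestronglyMeasurable (Eventually.of_forall fun y => ?_)
  exact (norm_fourier_apply k y).le

theorem torusCoeff_add (k : ℤ) {g h : Torus → ℂ} (hg : MemLp g 2 volume) (hh : MemLp h 2 volume) :
    torusCoeff k (fun y => g y + h y) = torusCoeff k g + torusCoeff k h := by
  simp only [torusCoeff, add_mul]
  rw [integral_add (integrable_mul_fourier _ hg) (integrable_mul_fourier _ hh), mul_add]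

theorem torusCoeff_const_mul (k : ℤ) (c : ℂ) (g : Torus → ℂ) :
    torusCoeff k (fun y => c * g y) = c * torusCoeff k g := by
  simp only [torusCoeff, mul_assoc]
  rw [integral_const_mul, mul_left_comm]

theorem torusCoeff_congr_ae (k : ℤ) {g h : Torus → ℂ} (hgh : g =ᵐ[volume] h) :
    torusCoeff k g = torusCoeff k h := by
  unfold torusCoeff
  congr 1
  refine integral_congr_ae ?_
  filter_upwards [hgh] with y hy
  rw [hy]

theorem ae_ae_of_ae {P : Plane × Torus → Prop} (h : ∀ᵐ p, P p) : ∀ᵐ x, ∀ᵐ y, P (x, y) :=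
  Measure.ae_ae_of_ae_prod h

theorem partialCoeff_add (k : ℤ) (f g : L2) :
    partialCoeff k (f + g) = partialCoeff k f + partialCoeff k g := by
  refine Lp.ext ?_
  filter_upwards [coeFn_partialCoeff k (f + g), coeFn_partialCoeff k f, coeFn_partialCoeff k g,
    Lp.coeFn_add (partialCoeff k f) (partialCoeff k g), ae_ae_of_ae (Lp.coeFn_add f g),
    ae_memLp_slice f, ae_memLp_slice g] with x h1 h2 h3 h4 h5 h6 h7
  rw [h1, h4, Pi.add_apply, h2, h3, ← torusCoeff_add k h6 h7]
  exact torusCoeff_congr_ae k h5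

theorem partialCoeff_smul (k : ℤ) (c : ℂ) (f : L2) :
    partialCoeff k (c • f) = c • partialCoeff k f := by
  refine Lp.ext ?_
  filter_upwards [coeFn_partialCoeff k (c • f), coeFn_partialCoeff k f,
    Lp.coeFn_smul c (partialCoeff k f), ae_ae_of_ae (Lp.coeFn_smul c f)] with x h1 h2 h4 h5
  rw [h1, h4, Pi.smul_apply, h2, smul_eq_mul, ← torusCoeff_const_mul k]
  exact torusCoeff_congr_ae k h5

/-- `partialCoeff` as a continuous linear map. -/
noncomputable def partialCoeffL (k : ℤ) : L2 →L[ℂ] L2Plane :=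
  LinearMap.mkContinuous
    { toFun := partialCoeff k
      map_add' := partialCoeff_add k
      map_smul' := partialCoeff_smul k } 1 fun f => by
    have := enorm_partialCoeff_le k f
    rw [← ofReal_norm, ← ofReal_norm, ENNReal.ofReal_le_ofReal_iff (norm_nonneg _)] at this
    simpa using this

@[simp] theorem partialCoeffL_apply (k : ℤ) (f : L2) : partialCoeffL k f = partialCoeff k f := rfl

theorem ext_partialCoeff {f g : L2} (h : ∀ k, partialCoeff k f = partialCoeff k g) : f = g := by
  have h1 := tsum_enorm_partialCoeff (f - g)
  have h2 : ∀ k, partialCoeff k (f - g) = 0 := fun k => by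
    rw [← partialCoeffL_apply, map_sub, partialCoeffL_apply, partialCoeffL_apply, h, sub_self]
  simp only [h2] at h1
  have h3 : ‖f - g‖ₑ = 0 := by simpa using h1.symm
  exact sub_eq_zero.1 (enorm_eq_zero.1 h3)

theorem torusCoeff_fourier (j k : ℤ) :
    torusCoeff j (fun y => ((Real.sqrt (2 * Real.pi) : ℝ) : ℂ)⁻¹ * fourier k y) =
      if j = k then 1 else 0 := by
  have hpi : (0 : ℝ) < 2 * Real.pi := Real.two_pi_pos
  have h1 : (((Real.sqrt (2 * Real.pi) : ℝ)) : ℂ) ≠ 0 := by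
    exact_mod_cast (Real.sqrt_pos.2 hpi).ne'
  rw [torusCoeff_const_mul, torusCoeff_eq_fourierCoeff, inv_mul_cancel_left₀ h1,
    fourierCoeff_fourier, Pi.single_apply]

theorem coeFn_mode (k : ℤ) (φ : L2Plane) : (mode k φ : Plane × Torus → ℂ) =ᵐ[volume]
    fun p => φ p.1 * (((Real.sqrt (2 * Real.pi) : ℝ) : ℂ)⁻¹ * fourier k p.2) :=
  MemLp.coeFn_toLp _

theorem partialCoeff_mode (j k : ℤ) (φ : L2Plane) :
    partialCoeff j (mode k φ) = if j = k then φ else 0 := by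
  refine Lp.ext ?_
  filter_upwards [coeFn_partialCoeff j (mode k φ), ae_ae_of_ae (coeFn_mode k φ),
    Lp.coeFn_zero ℂ 2 (volume : Measure Plane)] with x h1 h2 h3
  rw [h1, torusCoeff_congr_ae j h2, torusCoeff_const_mul, torusCoeff_fourier]
  split_ifs
  · rw [mul_one]
  · rw [h3]; simp

theorem enorm_sum_mode (s : Finset ℤ) (φ : ℤ → L2Plane) :
    ‖∑ k ∈ s, mode k (φ k)‖ₑ ^ 2 = ∑ k ∈ s, ‖φ k‖ₑ ^ 2 := by
  have h : ∀ j, partialCoeff j (∑ k ∈ s, mode k (φ k)) = if j ∈ s then φ j else 0 := by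
    intro j
    rw [← partialCoeffL_apply, map_sum]
    simp only [partialCoeffL_apply, partialCoeff_mode]
    simp
  rw [← tsum_enorm_partialCoeff]
  simp only [h]
  rw [tsum_eq_sum (s := s) (fun j hj => by simp [hj])]
  exact Finset.sum_congr rfl fun j hj => by simp [hj]

theorem summable_mode {φ : ℤ → L2Plane} (h : ∑' k, ‖φ k‖ₑ ^ 2 ≠ ∞) :
    Summable fun k => mode k (φ k) := by
  have hs : Summable fun k => ‖φ k‖ ^ 2 := by
    have := ENNReal.summable_toReal h
    simpa [ENNReal.toReal_pow] using this
  rw [summable_iff_vanishing_norm]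
  intro ε hε
  obtain ⟨s, hs⟩ := (summable_iff_vanishing_norm.1 hs) (ε ^ 2) (by positivity)
  refine ⟨s, fun t ht => ?_⟩
  have h1 := hs t ht
  have h2 : ‖∑ k ∈ t, mode k (φ k)‖ ^ 2 = ∑ k ∈ t, ‖φ k‖ ^ 2 := by
    have := congrArg ENNReal.toReal (enorm_sum_mode t φ)
    rw [ENNReal.toReal_sum (fun _ _ => ENNReal.pow_ne_top enorm_ne_top)] at this
    simpa [ENNReal.toReal_pow] using this
  rw [← h2, Real.norm_eq_abs, abs_of_nonneg (by positivity)] at h1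
  exact lt_of_pow_lt_pow_left₀ 2 hε.le h1

/-- The defining series of the free group converges, and its `k`-th coefficient is the `k`-th
summand. -/
theorem partialCoeff_freeEvolution (t : ℝ) (k : ℤ) (f : L2) :
    partialCoeff k (freeEvolution t f) = modePropagator t k (partialCoeff k f) := by
  have hs : Summable fun k => mode k (modePropagator t k (partialCoeff k f)) := by
    refine summable_mode ?_
    have : ∀ k, ‖modePropagator t k (partialCoeff k f)‖ₑ = ‖partialCoeff k f‖ₑ := fun k => by
      rw [← ofReal_norm, norm_modePropagator, ofReal_norm]
    simp only [this]
    rw [tsum_enorm_partialCoeff]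
    exact ENNReal.pow_ne_top enorm_ne_top
  rw [freeEvolution, ← partialCoeffL_apply, (partialCoeffL k).map_tsum hs]
  simp only [partialCoeffL_apply, partialCoeff_mode]
  rw [tsum_eq_single k (fun j hj => by simp [hj.symm])]
  simp

/-! ### The free group on the waveguide -/

/-- The Fourier transform in both variables: the Fourier transform on `ℝ²` of the `k`-th Fourier
coefficient. -/
noncomputable def hatCoeff (k : ℤ) (f : L2) : L2Plane := 𝓕 (partialCoeff k f)

/-- `hatCoeff` as a continuous linear map. -/
noncomputable def hatCoeffL (k : ℤ) : L2 →L[ℂ] L2Plane :=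
  (Lp.fourierTransformₗᵢ Plane ℂ).toContinuousLinearEquiv.toContinuousLinearMap ∘L partialCoeffL k

@[simp] theorem hatCoeffL_apply (k : ℤ) (f : L2) : hatCoeffL k f = hatCoeff k f := rfl

theorem ext_hatCoeff {f g : L2} (h : ∀ k, (hatCoeff k f : Plane → ℂ) =ᵐ[volume] hatCoeff k g) :
    f = g :=
  ext_partialCoeff fun k => fourier_injective (Lp.ext (h k))

theorem tsum_lintegral_hatCoeff (f : L2) :
    ∑' k, ∫⁻ ξ, ‖hatCoeff k f ξ‖ₑ ^ 2 = ‖f‖ₑ ^ 2 := by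
  rw [← tsum_enorm_partialCoeff]
  refine tsum_congr fun k => ?_
  rw [lintegral_enorm_sq_eq, hatCoeff, ← ofReal_norm, Lp.norm_fourier_eq, ofReal_norm]

theorem hatCoeff_freeEvolution (t : ℝ) (k : ℤ) (f : L2) :
    (hatCoeff k (freeEvolution t f) : Plane → ℂ) =ᵐ[volume]
      fun ξ => schrodingerSymbol t k ξ * hatCoeff k f ξ := by
  rw [hatCoeff, partialCoeff_freeEvolution]
  exact fourier_modePropagator t k _

theorem schrodingerSymbol_add (s t : ℝ) (k : ℤ) (ξ : Plane) :
    schrodingerSymbol (s + t) k ξ = schrodingerSymbol s k ξ * schrodingerSymbol t k ξ := by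
  unfold schrodingerSymbol
  rw [← Complex.exp_add]
  congr 1
  push_cast; ring

theorem freeEvolution_add_time (s t : ℝ) (f : L2) :
    freeEvolution (s + t) f = freeEvolution s (freeEvolution t f) := by
  refine ext_hatCoeff fun k => ?_
  filter_upwards [hatCoeff_freeEvolution (s + t) k f, hatCoeff_freeEvolution t k f,
    hatCoeff_freeEvolution s k (freeEvolution t f)] with ξ h1 h2 h3
  rw [h1, h3, h2, schrodingerSymbol_add, mul_assoc]

theorem freeEvolution_zero (f : L2) : freeEvolution 0 f = f := by
  refine ext_hatCoeff fun k => ?_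
  filter_upwards [hatCoeff_freeEvolution 0 k f] with ξ h1
  rw [h1]
  simp [schrodingerSymbol]

theorem freeEvolution_add (t : ℝ) (f g : L2) :
    freeEvolution t (f + g) = freeEvolution t f + freeEvolution t g := by
  refine ext_partialCoeff fun k => ?_
  rw [partialCoeff_add]
  simp only [partialCoeff_freeEvolution]
  rw [partialCoeff_add, modePropagator_add]

theorem freeEvolution_smul (t : ℝ) (c : ℂ) (f : L2) :
    freeEvolution t (c • f) = c • freeEvolution t f := by
  refine ext_partialCoeff fun k => ?_
  rw [partialCoeff_smul]
  simp only [partialCoeff_freeEvolution]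
  rw [partialCoeff_smul, modePropagator_smul]

theorem norm_freeEvolution (t : ℝ) (f : L2) : ‖freeEvolution t f‖ = ‖f‖ := by
  have h : ‖freeEvolution t f‖ₑ ^ 2 = ‖f‖ₑ ^ 2 := by
    rw [← tsum_enorm_partialCoeff, ← tsum_enorm_partialCoeff]
    refine tsum_congr fun k => ?_
    rw [partialCoeff_freeEvolution, ← ofReal_norm, norm_modePropagator, ofReal_norm]
  have h2 : ‖freeEvolution t f‖ₑ = ‖f‖ₑ :=
    le_antisymm ((ENNReal.pow_le_pow_left_iff two_ne_zero).1 h.le)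
      ((ENNReal.pow_le_pow_left_iff two_ne_zero).1 h.ge)
  simpa using congrArg ENNReal.toReal h2

/-- `freeEvolution` as a unitary operator, with inverse `freeEvolution (-t)`. -/
noncomputable def freeEvolutionₗᵢ (t : ℝ) : L2 ≃ₗᵢ[ℂ] L2 where
  toFun := freeEvolution t
  map_add' := freeEvolution_add t
  map_smul' := freeEvolution_smul t
  invFun := freeEvolution (-t)
  left_inv f := by rw [← freeEvolution_add_time, neg_add_cancel, freeEvolution_zero]
  right_inv f := by rw [← freeEvolution_add_time, add_neg_cancel, freeEvolution_zero]
  norm_map' := norm_freeEvolution t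

@[simp] theorem freeEvolutionₗᵢ_apply (t : ℝ) (f : L2) :
    freeEvolutionₗᵢ t f = freeEvolution t f := rfl

theorem enorm_freeEvolution (t : ℝ) (f : L2) : ‖freeEvolution t f‖ₑ = ‖f‖ₑ := by
  rw [← ofReal_norm, norm_freeEvolution, ofReal_norm]

theorem continuous_freeEvolution (f : L2) : Continuous fun t => freeEvolution t f := by
  rw [continuous_iff_continuousAt]
  intro t₀
  have hsum : Summable fun k => (2 * ‖partialCoeff k f‖) ^ 2 := by
    have : ∑' k, ‖partialCoeff k f‖ₑ ^ 2 ≠ ∞ := by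
      rw [tsum_enorm_partialCoeff]; exact ENNReal.pow_ne_top enorm_ne_top
    have := ENNReal.summable_toReal this
    simp only [ENNReal.toReal_pow, toReal_enorm] at this
    simpa only [mul_pow] using this.mul_left (2 ^ 2)
  have hnorm : ∀ g : L2, ‖g‖ ^ 2 = ∑' k, ‖partialCoeff k g‖ ^ 2 := by
    intro g
    have := congrArg ENNReal.toReal (tsum_enorm_partialCoeff g)
    rw [ENNReal.tsum_toReal_eq (fun k => ENNReal.pow_ne_top enorm_ne_top)] at this
    simpa [ENNReal.toReal_pow] using this.symm
  have h1 : Tendsto (fun t => ‖freeEvolution t f - freeEvolution t₀ f‖ ^ 2) (𝓝 t₀) (𝓝 0) := by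
    have hd : ∀ t k, partialCoeff k (freeEvolution t f - freeEvolution t₀ f) =
        modePropagator t k (partialCoeff k f) - modePropagator t₀ k (partialCoeff k f) := by
      intro t k
      rw [← partialCoeffL_apply, map_sub, partialCoeffL_apply, partialCoeffL_apply,
        partialCoeff_freeEvolution, partialCoeff_freeEvolution]
    simp only [hnorm, hd]
    have := tendsto_tsum_of_dominated_convergence
      (f := fun t k => ‖modePropagator t k (partialCoeff k f) -
        modePropagator t₀ k (partialCoeff k f)‖ ^ 2) (g := fun _ : ℤ => (0 : ℝ)) hsum
      (fun k => ?_) (Eventually.of_forall (f := 𝓝 t₀) fun t k => ?_)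
    · simpa using this
    · have hc := ((continuous_modePropagator k (partialCoeff k f)).sub
        (continuous_const (y := modePropagator t₀ k (partialCoeff k f)))).norm.pow 2
      simpa [Pi.pow_def] using hc.tendsto t₀
    · rw [Real.norm_eq_abs, abs_of_nonneg (by positivity)]
      gcongr
      refine (norm_sub_le _ _).trans (le_of_eq ?_)
      rw [norm_modePropagator, norm_modePropagator, two_mul]
  rw [ContinuousAt, tendsto_iff_norm_sub_tendsto_zero]
  have h2 := (Real.continuous_sqrt.tendsto 0).comp h1
  simpa [Function.comp_def, Real.sqrt_sq (norm_nonneg _)] using h2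

/-! ### Translations -/

/-- Translation `φ ↦ φ(· + h)` on `L²(ℝ²)`. -/
noncomputable def planeTranslate (h : Plane) : L2Plane →ₗᵢ[ℂ] L2Plane :=
  Lp.compMeasurePreservingₗᵢ ℂ (fun x => x + h) (measurePreserving_add_right volume h)

theorem coeFn_planeTranslate (h : Plane) (φ : L2Plane) :
    (planeTranslate h φ : Plane → ℂ) =ᵐ[volume] fun x => φ (x + h) :=
  Lp.coeFn_compMeasurePreserving φ (measurePreserving_add_right volume h)

theorem measurePreserving_translate (p : Plane × Torus) :
    MeasurePreserving (fun q : Plane × Torus => q + p) volume volume :=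
  (measurePreserving_add_right (volume : Measure Plane) p.1).prod
    (measurePreserving_add_right (volume : Measure Torus) p.2)

/-- Translation `f ↦ f(· + p)` on `L²(ℝ² × 𝕋)`. -/
noncomputable def translate (p : Plane × Torus) : L2 →ₗᵢ[ℂ] L2 :=
  Lp.compMeasurePreservingₗᵢ ℂ (fun q => q + p) (measurePreserving_translate p)

theorem coeFn_translate (p : Plane × Torus) (f : L2) :
    (translate p f : Plane × Torus → ℂ) =ᵐ[volume] fun q => f (q + p) :=
  Lp.coeFn_compMeasurePreserving f (measurePreserving_translate p)

/-- The Fourier transform of a translate. It is read off the integral for test functions and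
extended by density. -/
theorem fourier_planeTranslate (h : Plane) (φ : L2Plane) :
    (𝓕 (planeTranslate h φ) : L2Plane) =ᵐ[volume]
      fun ξ => (Real.fourierChar ⟪h, ξ⟫ : ℂ) * (𝓕 φ : L2Plane) ξ := by
  have hχc : Continuous fun ξ : Plane => (Real.fourierChar ⟪h, ξ⟫ : ℂ) := by
    refine continuous_subtype_val.comp (Real.continuous_fourierChar.comp ?_)
    fun_prop
  have hχ1 : ∀ ξ : Plane, ‖(Real.fourierChar ⟪h, ξ⟫ : ℂ)‖ = 1 := fun ξ => Circle.norm_coe _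
  have hmem : ∀ ψ : L2Plane, MemLp (fun ξ => (Real.fourierChar ⟪h, ξ⟫ : ℂ) * ψ ξ) 2 volume := by
    intro ψ
    refine (Lp.memLp ψ).of_le (hχc.aestronglyMeasurable.mul (Lp.aestronglyMeasurable ψ))
      (Eventually.of_forall fun ξ => ?_)
    rw [norm_mul, hχ1, one_mul]
  -- the multiplication operator is an isometry
  have hMcont : Continuous fun ψ : L2Plane => (hmem ψ).toLp _ := by
    refine Isometry.continuous (Isometry.of_dist_eq fun ψ ψ' => ?_)
    rw [dist_eq_norm, dist_eq_norm, ← MemLp.toLp_sub]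
    refine norm_eq_of_ae_eq_mul hχ1 ?_
    filter_upwards [MemLp.coeFn_toLp ((hmem ψ).sub (hmem ψ')), Lp.coeFn_sub ψ ψ'] with ξ h1 h2
    rw [h1, h2]
    simp only [Pi.sub_apply]
    ring
  have hFcont : Continuous fun ψ : L2Plane => (𝓕 ψ : L2Plane) :=
    (Lp.fourierTransformₗᵢ Plane ℂ).continuous
  obtain ⟨f, hf, hfS⟩ := exists_seq_contDiff_tendsto φ
  have key : ∀ n, (𝓕 (planeTranslate h (f n)) : L2Plane) = (hmem (𝓕 (f n))).toLp _ := by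
    intro n
    obtain ⟨g, hg, hgc, he⟩ := hfS n
    set G := hgc.toSchwartzMap hg with hG
    have hg' : ContDiff ℝ (⊤ : ℕ∞) fun x => g (x + h) := hg.comp (contDiff_id.add contDiff_const)
    have hgc' : HasCompactSupport fun x => g (x + h) :=
      hgc.comp_homeomorph (Homeomorph.addRight h)
    set G' := hgc'.toSchwartzMap hg' with hG'
    have e1 : planeTranslate h (f n) = G'.toLp 2 volume := by
      refine Lp.ext ?_
      have hq := (measurePreserving_add_right (volume : Measure Plane) h).quasiMeasurePreserving
      filter_upwards [coeFn_planeTranslate h (f n), G'.coeFn_toLp 2 volume,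
        hq.ae (G.coeFn_toLp 2 volume)] with x h1 h2 h3
      rw [h1, h2, he, h3]
      rfl
    rw [e1, he, SchwartzMap.toLp_fourier_eq, SchwartzMap.toLp_fourier_eq]
    refine Lp.ext ?_
    filter_upwards [(𝓕 G').coeFn_toLp 2 volume, (𝓕 G).coeFn_toLp 2 volume,
      (hmem ((𝓕 G).toLp 2 volume)).coeFn_toLp] with ξ h1 h2 h3
    rw [h1, h3, h2]
    have := congrFun (VectorFourier.fourierIntegral_comp_add_right Real.fourierChar
      (volume : Measure Plane) (innerₗ Plane) g h) ξ
    rw [SchwartzMap.fourier_coe, SchwartzMap.fourier_coe]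
    exact this
  have hlim := tendsto_nhds_unique
    ((((hFcont.comp (planeTranslate h).continuous).tendsto φ).comp hf).congr key)
    (((hMcont.comp hFcont).tendsto φ).comp hf)
  have hlim' : (𝓕 (planeTranslate h φ) : L2Plane) = (hmem (𝓕 φ)).toLp _ := hlim
  rw [hlim']
  exact MemLp.coeFn_toLp _

theorem fourier_add_apply (k : ℤ) (y z : Torus) :
    (fourier k (y + z) : ℂ) = fourier k y * fourier k z := by
  simp [fourier_apply, smul_add, AddCircle.toCircle_add]

theorem torusCoeff_comp_add (k : ℤ) (g : Torus → ℂ) (η : Torus) :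
    torusCoeff k (fun y => g (y + η)) = fourier k η * torusCoeff k g := by
  unfold torusCoeff
  rw [mul_left_comm]
  congr 1
  rw [← integral_const_mul, ← integral_add_right_eq_self
    (fun y => fourier k η * (g y * fourier (-k) y)) η]
  refine integral_congr_ae (Eventually.of_forall fun y => ?_)
  simp only
  rw [fourier_add_apply, fourier_neg (x := η)]
  have : (fourier k η : ℂ) * (starRingEnd ℂ) (fourier k η) = 1 := by
    rw [Complex.mul_conj, Complex.normSq_eq_norm_sq, norm_fourier_apply]; simp
  linear_combination (-(g (y + η) * fourier (-k) y)) * this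

theorem partialCoeff_translate (k : ℤ) (p : Plane × Torus) (f : L2) :
    partialCoeff k (translate p f) = (fourier k p.2 : ℂ) • planeTranslate p.1 (partialCoeff k f) := by
  refine Lp.ext ?_
  have hq := (measurePreserving_add_right (volume : Measure Plane) p.1).quasiMeasurePreserving
  filter_upwards [coeFn_partialCoeff k (translate p f), ae_ae_of_ae (coeFn_translate p f),
    Lp.coeFn_smul (fourier k p.2 : ℂ) (planeTranslate p.1 (partialCoeff k f)),
    coeFn_planeTranslate p.1 (partialCoeff k f), hq.ae (coeFn_partialCoeff k f)] with x h1 h2 h3 h4 h5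
  rw [h1, h3, Pi.smul_apply, h4, h5, smul_eq_mul, torusCoeff_congr_ae k h2]
  exact torusCoeff_comp_add k (fun y => f (x + p.1, y)) p.2

/-- The Fourier multiplier of the translation by `p`. -/
noncomputable def translationSymbol (p : Plane × Torus) (k : ℤ) (ξ : Plane) : ℂ :=
  fourier k p.2 * (Real.fourierChar ⟪p.1, ξ⟫ : ℂ)

theorem hatCoeff_translate (p : Plane × Torus) (k : ℤ) (f : L2) :
    (hatCoeff k (translate p f) : Plane → ℂ) =ᵐ[volume]
      fun ξ => translationSymbol p k ξ * hatCoeff k f ξ := by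
  rw [hatCoeff, partialCoeff_translate, FourierTransform.fourier_smul]
  filter_upwards [Lp.coeFn_smul (fourier k p.2 : ℂ)
    (𝓕 (planeTranslate p.1 (partialCoeff k f)) : L2Plane),
    fourier_planeTranslate p.1 (partialCoeff k f)] with ξ h1 h2
  rw [h1, Pi.smul_apply, h2, smul_eq_mul, translationSymbol, mul_assoc]
  rfl

theorem freeEvolution_translate (t : ℝ) (p : Plane × Torus) (f : L2) :
    freeEvolution t (translate p f) = translate p (freeEvolution t f) := by
  refine ext_hatCoeff fun k => ?_
  filter_upwards [hatCoeff_freeEvolution t k (translate p f), hatCoeff_translate p k f,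
    hatCoeff_translate p k (freeEvolution t f), hatCoeff_freeEvolution t k f] with ξ h1 h2 h3 h4
  rw [h1, h2, h3, h4, mul_left_comm]

theorem enorm_translate_sub_sq (p : Plane × Torus) (f : L2) :
    ‖translate p f - f‖ₑ ^ 2 =
      ∑' k, ∫⁻ ξ, ‖translationSymbol p k ξ - 1‖ₑ ^ 2 * ‖hatCoeff k f ξ‖ₑ ^ 2 := by
  rw [← tsum_lintegral_hatCoeff]
  refine tsum_congr fun k => lintegral_congr_ae ?_
  have h0 : hatCoeff k (translate p f - f) = hatCoeff k (translate p f) - hatCoeff k f := by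
    rw [← hatCoeffL_apply, map_sub]; rfl
  rw [h0]
  filter_upwards [hatCoeff_translate p k f, Lp.coeFn_sub (hatCoeff k (translate p f)) (hatCoeff k f)]
    with ξ h1 h2
  rw [h2, Pi.sub_apply, h1, ← mul_pow, ← enorm_mul, sub_mul, one_mul]

/-! ### Characterization of `H¹` by difference quotients -/

theorem translationSymbol_plane (h : Plane) (k : ℤ) (ξ : Plane) :
    translationSymbol (h, 0) k ξ = Complex.exp (Complex.I * ((2 * Real.pi * ⟪h, ξ⟫ : ℝ) : ℂ)) := by
  rw [translationSymbol, Real.fourierChar_apply, fourier_eval_zero, one_mul, mul_comm]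

theorem translationSymbol_torus (η : ℝ) (k : ℤ) (ξ : Plane) :
    translationSymbol (0, (η : Torus)) k ξ = Complex.exp (Complex.I * ((η * k : ℝ) : ℂ)) := by
  have hpi : (Real.pi : ℂ) ≠ 0 := by exact_mod_cast Real.pi_ne_zero
  rw [translationSymbol, fourier_coe_apply]
  simp only [inner_zero_left, AddChar.map_zero_eq_one, Circle.coe_one, mul_one]
  congr 1
  push_cast
  field_simp

theorem aemeasurable_hatCoeff_sq (k : ℤ) (f : L2) :
    AEMeasurable (fun ξ => ‖hatCoeff k f ξ‖ₑ ^ 2) volume :=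
  (Lp.aestronglyMeasurable _).enorm.pow_const 2

theorem h1Norm_eq (f : L2) : h1Norm f =
    (∑' k : ℤ, ∫⁻ ξ : Plane, ENNReal.ofReal (1 + (2 * Real.pi * ‖ξ‖) ^ 2) *
      ‖hatCoeff k f ξ‖ₑ ^ 2) ^ (1 / 2 : ℝ) +
    (∑' k : ℤ, ∫⁻ ξ : Plane, ENNReal.ofReal (1 + (k : ℝ) ^ 2) *
      ‖hatCoeff k f ξ‖ₑ ^ 2) ^ (1 / 2 : ℝ) := rfl

theorem le_rpow_half_of_sq_le {a b : ℝ≥0∞} (h : a ^ 2 ≤ b) : a ≤ b ^ (1 / 2 : ℝ) := by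
  rw [one_div, ENNReal.le_rpow_inv_iff (by norm_num)]
  simpa using h

theorem rpow_half_le_of_le_sq {a b : ℝ≥0∞} (h : a ≤ b ^ 2) : a ^ (1 / 2 : ℝ) ≤ b := by
  rw [one_div, ENNReal.rpow_inv_le_iff (by norm_num)]
  simpa using h

theorem enorm_translate_plane_sub_le (h : Plane) (f : L2) :
    ‖translate (h, 0) f - f‖ₑ ≤ ‖h‖ₑ * h1Norm f := by
  have h1 : ‖translate (h, 0) f - f‖ₑ ^ 2 ≤ ‖h‖ₑ ^ 2 *
      ∑' k : ℤ, ∫⁻ ξ : Plane, ENNReal.ofReal (1 + (2 * Real.pi * ‖ξ‖) ^ 2) *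
        ‖hatCoeff k f ξ‖ₑ ^ 2 := by
    rw [enorm_translate_sub_sq, ← ENNReal.tsum_mul_left]
    refine ENNReal.tsum_le_tsum fun k => ?_
    rw [← lintegral_const_mul' _ _ (ENNReal.pow_ne_top enorm_ne_top)]
    refine lintegral_mono fun ξ => ?_
    rw [← mul_assoc]
    refine mul_le_mul_left ?_ _
    rw [translationSymbol_plane]
    calc _ ≤ ‖(2 * Real.pi * ⟪h, ξ⟫ : ℝ)‖ₑ ^ 2 := by
          gcongr; exact Real.enorm_exp_I_mul_ofReal_sub_one_le
      _ ≤ (‖h‖ₑ * ENNReal.ofReal (2 * Real.pi * ‖ξ‖)) ^ 2 := by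
          gcongr
          rw [← ofReal_norm, ← ofReal_norm, ← ENNReal.ofReal_mul (norm_nonneg _)]
          refine ENNReal.ofReal_le_ofReal ?_
          rw [norm_mul, Real.norm_eq_abs, abs_of_pos Real.two_pi_pos]
          calc _ ≤ 2 * Real.pi * (‖h‖ * ‖ξ‖) := by gcongr; exact norm_inner_le_norm _ _
            _ = _ := by ring
      _ ≤ _ := by
          rw [mul_pow, ← ENNReal.ofReal_pow (by positivity)]
          gcongr
          linarith
  have h2 := le_rpow_half_of_sq_le h1
  rw [ENNReal.mul_rpow_of_nonneg _ _ (by norm_num), ← ENNReal.rpow_two, ← ENNReal.rpow_mul] at h2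
  norm_num only [ENNReal.rpow_one] at h2
  refine h2.trans ?_
  rw [h1Norm_eq]
  gcongr
  exact le_self_add

theorem enorm_translate_torus_sub_le (η : ℝ) (f : L2) :
    ‖translate (0, (η : Torus)) f - f‖ₑ ≤ ‖η‖ₑ * h1Norm f := by
  have h1 : ‖translate (0, (η : Torus)) f - f‖ₑ ^ 2 ≤ ‖η‖ₑ ^ 2 *
      ∑' k : ℤ, ∫⁻ ξ : Plane, ENNReal.ofReal (1 + (k : ℝ) ^ 2) *
        ‖hatCoeff k f ξ‖ₑ ^ 2 := by
    rw [enorm_translate_sub_sq, ← ENNReal.tsum_mul_left]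
    refine ENNReal.tsum_le_tsum fun k => ?_
    rw [← lintegral_const_mul' _ _ (ENNReal.pow_ne_top enorm_ne_top)]
    refine lintegral_mono fun ξ => ?_
    rw [← mul_assoc]
    refine mul_le_mul_left ?_ _
    rw [translationSymbol_torus]
    calc _ ≤ ‖(η * k : ℝ)‖ₑ ^ 2 := by
          gcongr; exact Real.enorm_exp_I_mul_ofReal_sub_one_le
      _ ≤ _ := by
          rw [enorm_mul, mul_pow]
          gcongr
          rw [← ofReal_norm, ← ENNReal.ofReal_pow (norm_nonneg _), Real.norm_eq_abs, sq_abs]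
          refine ENNReal.ofReal_le_ofReal ?_
          linarith
  have h2 := le_rpow_half_of_sq_le h1
  rw [ENNReal.mul_rpow_of_nonneg _ _ (by norm_num), ← ENNReal.rpow_two, ← ENNReal.rpow_mul] at h2
  norm_num only [ENNReal.rpow_one] at h2
  refine h2.trans ?_
  rw [h1Norm_eq]
  gcongr
  exact le_add_self

theorem enorm_le_h1Norm (f : L2) : ‖f‖ₑ ≤ h1Norm f := by
  rw [h1Norm_eq]
  refine le_trans (le_rpow_half_of_sq_le ?_) le_add_self
  rw [← tsum_lintegral_hatCoeff]
  refine ENNReal.tsum_le_tsum fun k => lintegral_mono fun ξ => ?_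
  refine le_mul_of_one_le_left zero_le ?_
  rw [← ENNReal.ofReal_one]
  exact ENNReal.ofReal_le_ofReal (by nlinarith [sq_nonneg (k : ℝ)])

theorem tendsto_mul_exp_sub_one (θ : ℝ) :
    Tendsto (fun n : ℕ => ‖((n : ℝ) + 1)‖ₑ *
      ‖Complex.exp (Complex.I * ((1 / ((n : ℝ) + 1) * θ : ℝ) : ℂ)) - 1‖ₑ) atTop (𝓝 ‖θ‖ₑ) := by
  have hd : HasDerivAt (fun s : ℝ => Complex.exp (Complex.I * ((s * θ : ℝ) : ℂ)))
      (Complex.I * θ) 0 := by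
    have h1 : HasDerivAt (fun s : ℝ => Complex.I * ((s * θ : ℝ) : ℂ)) (Complex.I * θ) 0 := by
      have h0 := ((hasDerivAt_id (0 : ℝ)).mul_const θ).ofReal_comp.const_mul Complex.I
      simpa using h0
    have := h1.cexp
    simpa using this
  have h2 := hd.tendsto_slope_zero
  have h3 : Tendsto (fun n : ℕ => 1 / ((n : ℝ) + 1)) atTop (𝓝[≠] 0) := by
    refine tendsto_nhdsWithin_iff.2 ⟨tendsto_one_div_add_atTop_nhds_zero_nat, ?_⟩
    exact Eventually.of_forall fun n => by
      have : (1 : ℝ) / (n + 1) ≠ 0 := by positivity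
      simpa using this
  have h4 := (h2.comp h3).enorm
  have e : ‖Complex.I * (θ : ℂ)‖ₑ = ‖θ‖ₑ := by
    rw [← ofReal_norm, ← ofReal_norm, norm_mul, Complex.norm_I, one_mul, Complex.norm_real]
  rw [e] at h4
  refine h4.congr fun n => ?_
  simp only [Function.comp_apply, zero_add, zero_mul, Complex.ofReal_zero, mul_zero,
    Complex.exp_zero, one_div, inv_inv]
  rw [enorm_smul]

/-- If the difference quotients of `f` of step `1 / (n + 1)` along a one-parameter group with symbol
`e^{isθ}` are bounded by `K`, then so is the derivative, by Fatou's lemma. -/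
theorem tsum_lintegral_le_of_translate {f : L2} {K : ℝ≥0∞} (p : ℕ → Plane × Torus)
    (θ : ℤ → Plane → ℝ)
    (hp : ∀ n k ξ, translationSymbol (p n) k ξ =
      Complex.exp (Complex.I * ((1 / ((n : ℝ) + 1) * θ k ξ : ℝ) : ℂ)))
    (hK : ∀ n : ℕ, ‖((n : ℝ) + 1)‖ₑ * ‖translate (p n) f - f‖ₑ ≤ K) :
    ∑' k, ∫⁻ ξ, ‖θ k ξ‖ₑ ^ 2 * ‖hatCoeff k f ξ‖ₑ ^ 2 ≤ K ^ 2 := by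
  set Ψ : ℕ → ℤ → Plane → ℝ≥0∞ := fun n k ξ =>
    (‖((n : ℝ) + 1)‖ₑ * ‖translationSymbol (p n) k ξ - 1‖ₑ) ^ 2 * ‖hatCoeff k f ξ‖ₑ ^ 2 with hΨ
  have hlim : ∀ k ξ, Tendsto (fun n => Ψ n k ξ) atTop (𝓝 (‖θ k ξ‖ₑ ^ 2 * ‖hatCoeff k f ξ‖ₑ ^ 2)) := by
    intro k ξ
    simp only [hΨ, hp]
    exact ENNReal.Tendsto.mul_const
      (((ENNReal.continuous_pow 2).tendsto _).comp (tendsto_mul_exp_sub_one (θ k ξ)))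
      (Or.inr (ENNReal.pow_ne_top enorm_ne_top))
  have hsymb : ∀ n k, Continuous fun ξ => translationSymbol (p n) k ξ := by
    intro n k
    unfold translationSymbol
    refine continuous_const.mul (continuous_subtype_val.comp (Real.continuous_fourierChar.comp ?_))
    fun_prop
  have hmeas : ∀ n k, AEMeasurable (Ψ n k) volume := by
    intro n k
    refine AEMeasurable.mul (Continuous.aemeasurable ?_) (aemeasurable_hatCoeff_sq k f)
    refine (ENNReal.continuous_pow 2).comp ?_
    exact ENNReal.continuous_const_mul enorm_ne_top |>.comp
      (continuous_enorm.comp ((hsymb n k).sub continuous_const))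
  have hbound : ∀ n, ∑' k, ∫⁻ ξ, Ψ n k ξ ≤ K ^ 2 := by
    intro n
    refine le_trans (le_of_eq ?_) (ENNReal.pow_le_pow_left (n := 2) (hK n))
    rw [mul_pow, enorm_translate_sub_sq, ← ENNReal.tsum_mul_left]
    refine tsum_congr fun k => ?_
    rw [← lintegral_const_mul' _ _ (ENNReal.pow_ne_top enorm_ne_top)]
    refine lintegral_congr fun ξ => ?_
    simp only [hΨ]; ring
  calc ∑' k, ∫⁻ ξ, ‖θ k ξ‖ₑ ^ 2 * ‖hatCoeff k f ξ‖ₑ ^ 2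
      ≤ ∑' k, liminf (fun n => ∫⁻ ξ, Ψ n k ξ) atTop := by
        refine ENNReal.tsum_le_tsum fun k => ?_
        refine le_trans (le_of_eq ?_) (lintegral_liminf_le' fun n => hmeas n k)
        exact lintegral_congr fun ξ => (hlim k ξ).liminf_eq.symm
    _ ≤ liminf (fun n => ∑' k, ∫⁻ ξ, Ψ n k ξ) atTop := by
        simp only [← lintegral_count]
        exact lintegral_liminf_le fun n => Measurable.of_discrete
    _ ≤ K ^ 2 := by
        refine liminf_le_of_le (by isBoundedDefault) fun c hc => ?_
        obtain ⟨n, hn⟩ := hc.exists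
        exact hn.trans (hbound n)

/-- A function whose translates in the directions of `ℝ²` and of `𝕋` satisfy a Lipschitz bound
belongs to `H¹`. -/
theorem h1Norm_le_of_translate {f : L2} {K : ℝ≥0∞}
    (hx : ∀ h : Plane, ‖translate (h, 0) f - f‖ₑ ≤ ‖h‖ₑ * K)
    (hy : ∀ η : ℝ, ‖translate (0, (η : Torus)) f - f‖ₑ ≤ ‖η‖ₑ * K) :
    h1Norm f ≤ 2 * (‖f‖ₑ + 2 * K) := by
  have hn1 : ∀ n : ℕ, ‖((n : ℝ) + 1)‖ₑ * ‖(1 / ((n : ℝ) + 1) : ℝ)‖ₑ = 1 := by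
    intro n
    rw [← enorm_mul, mul_one_div_cancel (by positivity)]
    simp
  have hX : ∀ j : Fin 2, ∑' k, ∫⁻ ξ : Plane, ‖2 * Real.pi * ξ j‖ₑ ^ 2 * ‖hatCoeff k f ξ‖ₑ ^ 2 ≤
      K ^ 2 := by
    intro j
    refine tsum_lintegral_le_of_translate
      (fun n => ((1 / ((n : ℝ) + 1) : ℝ) • EuclideanSpace.single j (1 : ℝ), 0))
      (fun _ ξ => 2 * Real.pi * ξ j) (fun n k ξ => ?_) fun n => ?_
    · rw [translationSymbol_plane, real_inner_smul_left, EuclideanSpace.inner_single_left]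
      congr 3
      simp; ring
    · refine (mul_le_mul_right (hx _) _).trans (le_of_eq ?_)
      rw [enorm_smul, ← mul_assoc, ← mul_assoc, hn1, one_mul]
      rw [← ofReal_norm, PiLp.norm_single]
      simp
  have hY : ∑' k : ℤ, ∫⁻ ξ : Plane, ‖(k : ℝ)‖ₑ ^ 2 * ‖hatCoeff k f ξ‖ₑ ^ 2 ≤ K ^ 2 := by
    refine tsum_lintegral_le_of_translate
      (fun n => (0, ((1 / ((n : ℝ) + 1) : ℝ) : Torus)))
      (fun k _ => (k : ℝ)) (fun n k ξ => translationSymbol_torus _ _ _) fun n => ?_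
    refine (mul_le_mul_right (hy _) _).trans (le_of_eq ?_)
    rw [← mul_assoc, hn1, one_mul]
  have hof : ∀ r : ℝ, ENNReal.ofReal (r ^ 2) = ‖r‖ₑ ^ 2 := by
    intro r
    rw [← ofReal_norm, ← ENNReal.ofReal_pow (norm_nonneg _), Real.norm_eq_abs, sq_abs]
  have hcoord : ∀ j : Fin 2, Measurable fun ξ : Plane => ‖2 * Real.pi * ξ j‖ₑ ^ 2 := by
    intro j
    have : Continuous fun ξ : Plane => 2 * Real.pi * ξ j := by fun_prop
    exact (continuous_enorm.comp this).measurable.pow_const 2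
  rw [h1Norm_eq, two_mul (‖f‖ₑ + 2 * K)]
  refine add_le_add (rpow_half_le_of_le_sq ?_) (rpow_half_le_of_le_sq ?_)
  · calc _ = ∑' k : ℤ, ((∫⁻ ξ, ‖hatCoeff k f ξ‖ₑ ^ 2) +
          ((∫⁻ ξ : Plane, ‖2 * Real.pi * ξ 0‖ₑ ^ 2 * ‖hatCoeff k f ξ‖ₑ ^ 2) +
            ∫⁻ ξ : Plane, ‖2 * Real.pi * ξ 1‖ₑ ^ 2 * ‖hatCoeff k f ξ‖ₑ ^ 2)) := by
          refine tsum_congr fun k => ?_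
          rw [← lintegral_add_left' (f := fun ξ : Plane => ‖2 * Real.pi * ξ 0‖ₑ ^ 2 * ‖hatCoeff k f ξ‖ₑ ^ 2)
              ((hcoord 0).aemeasurable.mul (aemeasurable_hatCoeff_sq k f)),
            ← lintegral_add_left' (aemeasurable_hatCoeff_sq k f)]
          refine lintegral_congr fun ξ => ?_
          have : 1 + (2 * Real.pi * ‖ξ‖) ^ 2 =
              1 + ((2 * Real.pi * ξ 0) ^ 2 + (2 * Real.pi * ξ 1) ^ 2) := by
            rw [mul_pow, EuclideanSpace.real_norm_sq_eq, Fin.sum_univ_two]; ring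
          rw [this, ENNReal.ofReal_add (by norm_num) (by positivity),
            ENNReal.ofReal_add (by positivity) (by positivity), hof, hof, ENNReal.ofReal_one]
          ring
      _ ≤ ‖f‖ₑ ^ 2 + (K ^ 2 + K ^ 2) := by
          rw [ENNReal.tsum_add, ENNReal.tsum_add, tsum_lintegral_hatCoeff]
          gcongr
          · exact hX 0
          · exact hX 1
      _ ≤ _ := by
          rw [add_sq]
          calc ‖f‖ₑ ^ 2 + (K ^ 2 + K ^ 2) ≤ ‖f‖ₑ ^ 2 + 2 * ‖f‖ₑ * (2 * K) + (K ^ 2 + K ^ 2) := by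
                gcongr; exact le_self_add
            _ ≤ ‖f‖ₑ ^ 2 + 2 * ‖f‖ₑ * (2 * K) + ((K ^ 2 + K ^ 2) + 2 * K ^ 2) :=
                add_le_add le_rfl le_self_add
            _ = _ := by ring
  · calc _ = ∑' k : ℤ, ((∫⁻ ξ, ‖hatCoeff k f ξ‖ₑ ^ 2) +
          ∫⁻ ξ : Plane, ‖(k : ℝ)‖ₑ ^ 2 * ‖hatCoeff k f ξ‖ₑ ^ 2) := by
          refine tsum_congr fun k => ?_
          rw [← lintegral_add_left' (aemeasurable_hatCoeff_sq k f)]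
          refine lintegral_congr fun ξ => ?_
          rw [ENNReal.ofReal_add (by norm_num) (by positivity), hof, ENNReal.ofReal_one]
          ring
      _ ≤ ‖f‖ₑ ^ 2 + K ^ 2 := by
          rw [ENNReal.tsum_add, tsum_lintegral_hatCoeff]
          gcongr
      _ ≤ _ := by
          rw [add_sq]
          calc ‖f‖ₑ ^ 2 + K ^ 2 ≤ ‖f‖ₑ ^ 2 + 2 * ‖f‖ₑ * (2 * K) + K ^ 2 := by
                gcongr; exact le_self_add
            _ ≤ ‖f‖ₑ ^ 2 + 2 * ‖f‖ₑ * (2 * K) + (K ^ 2 + 3 * K ^ 2) :=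
                add_le_add le_rfl le_self_add
            _ = _ := by ring

/-! ### Mixed norms -/

/-- The norm `‖f(x, ·)‖_{L²(𝕋)}` of a slice of `f ∈ L²(ℝ² × 𝕋)`. -/
noncomputable def sliceNorm (f : L2) (x : Plane) : ℝ≥0∞ :=
  eLpNorm (fun y => f (x, y)) 2 volume

/-- The norm of `L⁴_x L²_y`, with value `∞` off this space. -/
noncomputable def normFourTwo (f : L2) : ℝ≥0∞ := (∫⁻ x, sliceNorm f x ^ (4 : ℝ)) ^ (1 / 4 : ℝ)

/-- The norm of `L^{4/3}_x L²_y`, dual to `normFourTwo`, with value `∞` off this space. -/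
noncomputable def normFourThirdsTwo (f : L2) : ℝ≥0∞ :=
  (∫⁻ x, sliceNorm f x ^ (4 / 3 : ℝ)) ^ (3 / 4 : ℝ)

theorem eLpNorm_two_sq {α : Type*} [MeasurableSpace α] (μ : Measure α) (g : α → ℂ) :
    eLpNorm g 2 μ ^ 2 = ∫⁻ y, ‖g y‖ₑ ^ 2 ∂μ := by
  have := eLpNorm_nnreal_pow_eq_lintegral (f := g) (μ := μ) (p := 2) (by norm_num)
  simpa using this

theorem sliceNorm_sq (f : L2) (x : Plane) : sliceNorm f x ^ 2 = ∫⁻ y, ‖f (x, y)‖ₑ ^ 2 :=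
  eLpNorm_two_sq _ _

theorem ae_sliceNorm_sq (f : L2) :
    ∀ᵐ x, sliceNorm f x ^ 2 = ∑' k, ‖partialCoeff k f x‖ₑ ^ 2 := by
  filter_upwards [ae_tsum_partialCoeff f] with x hx
  rw [hx, sliceNorm_sq]

theorem aemeasurable_sliceNorm (f : L2) : AEMeasurable (sliceNorm f) := by
  have h : sliceNorm f = fun x => (∫⁻ y, ‖f (x, y)‖ₑ ^ 2) ^ (1 / 2 : ℝ) := by
    funext x
    rw [← sliceNorm_sq, ← ENNReal.rpow_natCast_mul]
    norm_num
  rw [h]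
  exact (((aestronglyMeasurable_prod f).enorm.pow_const 2).lintegral_prod_right').pow_const _

theorem lintegral_sliceNorm_sq (f : L2) : ∫⁻ x, sliceNorm f x ^ 2 = ‖f‖ₑ ^ 2 := by
  simp only [sliceNorm_sq]
  exact lintegral_slices f

theorem ae_sliceNorm_add_le (f g : L2) :
    ∀ᵐ x, sliceNorm (f + g) x ≤ sliceNorm f x + sliceNorm g x := by
  filter_upwards [ae_memLp_slice f, ae_memLp_slice g, ae_ae_of_ae (Lp.coeFn_add f g)]
    with x hf hg hfg
  unfold sliceNorm
  rw [eLpNorm_congr_ae hfg]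
  exact eLpNorm_add_le hf.1 hg.1 one_le_two

theorem normFourTwo_add_le (f g : L2) :
    normFourTwo (f + g) ≤ normFourTwo f + normFourTwo g := by
  refine le_trans ?_ (ENNReal.lintegral_Lp_add_le (aemeasurable_sliceNorm f)
    (aemeasurable_sliceNorm g) (by norm_num : (1 : ℝ) ≤ 4))
  refine ENNReal.rpow_le_rpow (lintegral_mono_ae ?_) (by norm_num)
  filter_upwards [ae_sliceNorm_add_le f g] with x hx
  exact ENNReal.rpow_le_rpow hx (by norm_num)

theorem enorm_inner_le_normFourTwo_mul (f g : L2) :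
    ‖inner ℂ f g‖ₑ ≤ normFourTwo f * normFourThirdsTwo g := by
  have h43 : (4 : ℝ).HolderConjugate (4 / 3) := by
    rw [Real.holderConjugate_iff]; norm_num
  calc ‖inner ℂ f g‖ₑ ≤ ∫⁻ p, ‖inner ℂ (f p) (g p)‖ₑ := by
        rw [L2.inner_def]; exact enorm_integral_le_lintegral_enorm _
    _ ≤ ∫⁻ p : Plane × Torus, ‖f p‖ₑ * ‖g p‖ₑ := by
        refine lintegral_mono fun p => ?_
        rw [← ofReal_norm, ← ofReal_norm, ← ofReal_norm, ← ENNReal.ofReal_mul (norm_nonneg _)]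
        exact ENNReal.ofReal_le_ofReal (norm_inner_le_norm _ _)
    _ = ∫⁻ x, ∫⁻ y, ‖f (x, y)‖ₑ * ‖g (x, y)‖ₑ :=
        lintegral_prod _ ((aestronglyMeasurable_prod f).enorm.mul (aestronglyMeasurable_prod g).enorm)
    _ ≤ ∫⁻ x, sliceNorm f x * sliceNorm g x := by
        refine lintegral_mono_ae ?_
        filter_upwards [ae_memLp_slice f, ae_memLp_slice g] with x hf hg
        have := ENNReal.lintegral_mul_le_Lp_mul_Lq (volume : Measure Torus)
          Real.HolderConjugate.two_two hf.1.enorm hg.1.enorm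
        refine this.trans (le_of_eq ?_)
        simp only [ENNReal.rpow_two, ← sliceNorm_sq]
        rw [← ENNReal.rpow_natCast_mul, ← ENNReal.rpow_natCast_mul]
        norm_num
    _ ≤ _ := by
        refine (ENNReal.lintegral_mul_le_Lp_mul_Lq volume h43 (aemeasurable_sliceNorm f)
          (aemeasurable_sliceNorm g)).trans (le_of_eq ?_)
        rw [normFourTwo, normFourThirdsTwo]
        norm_num

/-- Along a subsequence of an `L²`-convergent sequence all Fourier coefficients in `y` converge for
almost every `x`. -/
theorem exists_seq_ae_tendsto_partialCoeff {f : ℕ → L2} {g : L2} (h : Tendsto f atTop (𝓝 g)) :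
    ∃ ns : ℕ → ℕ, ∀ᵐ x, ∀ k,
      Tendsto (fun n => partialCoeff k (f (ns n)) x) atTop (𝓝 (partialCoeff k g x)) := by
  have h1 : ∀ n : ℕ, ∃ m, ‖f m - g‖ₑ ^ 2 ≤ (2⁻¹ : ℝ≥0∞) ^ n := by
    intro n
    have h2 : Tendsto (fun m => ‖f m - g‖ₑ ^ 2) atTop (𝓝 0) := by
      have : Tendsto (fun m => f m - g) atTop (𝓝 0) := by
        simpa using h.sub_const g
      have h3 := ENNReal.Tendsto.pow (n := 2) ((continuous_enorm.tendsto _).comp this)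
      simpa using h3
    exact ((h2.eventually_lt_const (ENNReal.pow_pos (by simp) n)).exists).imp
      fun m hm => hm.le
  choose ns hns using h1
  refine ⟨ns, ?_⟩
  have h2 : ∫⁻ x, ∑' n, sliceNorm (f (ns n) - g) x ^ 2 ≠ ∞ := by
    rw [lintegral_tsum fun n => (aemeasurable_sliceNorm _).pow_const 2]
    simp only [lintegral_sliceNorm_sq]
    refine ne_top_of_le_ne_top ?_ (ENNReal.tsum_le_tsum hns)
    rw [ENNReal.tsum_geometric]
    simp
  have h3 := ae_lt_top' (AEMeasurable.tsum fun n =>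
    (aemeasurable_sliceNorm (f (ns n) - g)).pow_const 2) h2
  filter_upwards [h3, ae_all_iff.2 fun n => ae_sliceNorm_sq (f (ns n) - g),
    ae_all_iff.2 fun n => ae_all_iff.2 fun k =>
      Lp.coeFn_sub (partialCoeff k (f (ns n))) (partialCoeff k g)] with x hx hsq hsub k
  rw [tendsto_iff_edist_tendsto_0]
  have h4 := ENNReal.tendsto_atTop_zero_of_tsum_ne_top hx.ne
  have h5 : Tendsto (fun n => (sliceNorm (f (ns n) - g) x ^ 2) ^ (1 / 2 : ℝ)) atTop (𝓝 0) := by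
    have := (ENNReal.continuous_rpow_const (y := (1 / 2 : ℝ))).tendsto 0 |>.comp h4
    rwa [ENNReal.zero_rpow_of_pos (by norm_num)] at this
  refine tendsto_of_tendsto_of_tendsto_of_le_of_le tendsto_const_nhds h5 (fun _ => zero_le)
    fun n => ?_
  have h6 : partialCoeff k (f (ns n) - g) = partialCoeff k (f (ns n)) - partialCoeff k g :=
    map_sub (partialCoeffL k) _ _
  refine le_rpow_half_of_sq_le ?_
  rw [edist_eq_enorm_sub, ← Pi.sub_apply, ← hsub n k, ← h6, hsq n]
  exact ENNReal.le_tsum k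

/-- The quantity `∫ (∑_k w_k |f_k(x)|²)² dx`. For `w = 1` this is the fourth power of the norm of
`L⁴_x L²_y`, and for `w_k = ⟨k⟩^{2s}` that of the norm of `L⁴_x H^s_y`. -/
noncomputable def weightedFour (w : ℤ → ℝ≥0∞) (f : L2) : ℝ≥0∞ :=
  ∫⁻ x, (∑' k, w k * ‖partialCoeff k f x‖ₑ ^ 2) ^ 2

theorem aemeasurable_weighted_tsum (w : ℤ → ℝ≥0∞) (f : L2) :
    AEMeasurable fun x => ∑' k, w k * ‖partialCoeff k f x‖ₑ ^ 2 :=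
  AEMeasurable.tsum fun _ => ((Lp.aestronglyMeasurable _).enorm.pow_const 2).const_mul _

theorem lowerSemicontinuous_weightedFour {w : ℤ → ℝ≥0∞} (hw : ∀ k, w k ≠ ∞) :
    LowerSemicontinuous (weightedFour w) := by
  have hlsc : LowerSemicontinuous fun z : ℤ → ℂ => (∑' k, w k * ‖z k‖ₑ ^ 2) ^ 2 := by
    refine (ENNReal.continuous_pow 2).comp_lowerSemicontinuous (lowerSemicontinuous_tsum fun k => ?_)
      fun a b hab => pow_le_pow_left' hab 2
    refine Continuous.lowerSemicontinuous ?_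
    exact (ENNReal.continuous_const_mul (hw k)).comp
      ((ENNReal.continuous_pow 2).comp (continuous_enorm.comp (continuous_apply k)))
  refine lowerSemicontinuous_of_subseq fun f g hfg => ?_
  obtain ⟨ns, hns⟩ := exists_seq_ae_tendsto_partialCoeff hfg
  refine ⟨ns, le_trans (lintegral_mono_ae ?_) (lintegral_liminf_le' fun n =>
    (aemeasurable_weighted_tsum w _).pow_const 2)⟩
  filter_upwards [hns] with x hx
  have hx' := tendsto_pi_nhds.2 hx
  exact (lowerSemicontinuousAt_iff_le_liminf.1 (hlsc _)).trans (liminf_le_liminf_of_le hx')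

theorem normFourTwo_eq (f : L2) : normFourTwo f = weightedFour (fun _ => 1) f ^ (1 / 4 : ℝ) := by
  rw [normFourTwo, weightedFour]
  congr 1
  refine lintegral_congr_ae ?_
  filter_upwards [ae_sliceNorm_sq f] with x hx
  simp only [one_mul]
  rw [← hx, ← pow_mul, ← ENNReal.rpow_natCast]
  norm_num

theorem lowerSemicontinuous_normFourTwo : LowerSemicontinuous normFourTwo := by
  have : normFourTwo = (fun r : ℝ≥0∞ => r ^ (1 / 4 : ℝ)) ∘ weightedFour (fun _ => 1) :=
    funext normFourTwo_eq
  rw [this]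
  exact ENNReal.continuous_rpow_const.comp_lowerSemicontinuous
    (lowerSemicontinuous_weightedFour fun _ => ENNReal.one_ne_top)
    fun a b hab => ENNReal.rpow_le_rpow hab (by norm_num)

/-! ### The Strichartz estimate on the waveguide -/

/-- Minkowski's inequality `‖∑ X_k‖_{L²} ≤ ∑ ‖X_k‖_{L²}` for nonnegative functions. -/
theorem lintegral_tsum_sq_le {α : Type*} [MeasurableSpace α] {μ : Measure α} {X : ℤ → α → ℝ≥0∞}
    (hX : ∀ k, AEMeasurable (X k) μ) :
    ∫⁻ x, (∑' k, X k x) ^ 2 ∂μ ≤ (∑' k, (∫⁻ x, X k x ^ 2 ∂μ) ^ (1 / 2 : ℝ)) ^ 2 := by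
  have h : ∀ a : ℤ → ℝ≥0∞, (∑' k, a k) ^ 2 = ∑' j, ∑' k, a j * a k := by
    intro a
    simp only [ENNReal.tsum_mul_left, ENNReal.tsum_mul_right, sq]
  simp only [h]
  have hm : ∀ j k, AEMeasurable (fun x => X j x * X k x) μ := fun j k => (hX j).mul (hX k)
  rw [lintegral_tsum fun j => AEMeasurable.tsum (hm j)]
  refine ENNReal.tsum_le_tsum fun j => ?_
  rw [lintegral_tsum (hm j)]
  refine ENNReal.tsum_le_tsum fun k => ?_
  have := ENNReal.lintegral_mul_le_Lp_mul_Lq μ Real.HolderConjugate.two_two (hX j) (hX k)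
  simpa using this

/-- The Strichartz estimate in `L⁴_t L⁴_x L²_y`. The square function in `k` costs nothing:
Minkowski's inequality is applied to the squares of the modes, in `x` and then in `t`. -/
theorem lintegral_weightedFour_freeEvolution_le (f : L2) :
    ∫⁻ t, weightedFour (fun _ => 1) (freeEvolution t f) ≤
      ENNReal.ofReal (2 * Real.pi) * ‖f‖ₑ ^ 4 := by
  set φ := fun k => partialCoeff k f with hφ
  set Y : ℤ → ℝ → ℝ≥0∞ := fun k t =>
    (∫⁻ x, ‖modePropagator t k (φ k) x‖ₑ ^ 4) ^ (1 / 2 : ℝ) with hY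
  have h1 : ∀ t, weightedFour (fun _ => 1) (freeEvolution t f) ≤ (∑' k, Y k t) ^ 2 := by
    intro t
    simp only [weightedFour, partialCoeff_freeEvolution, one_mul]
    refine (lintegral_tsum_sq_le fun k =>
      (Lp.aestronglyMeasurable _).enorm.pow_const 2).trans (le_of_eq ?_)
    simp only [← pow_mul, hY, hφ]
  refine (lintegral_mono h1).trans ?_
  refine (lintegral_tsum_sq_le fun k =>
    ((measurable_lintegral_modePropagator k (φ k)).pow_const _).aemeasurable).trans ?_
  have h2 : ∀ k, (∫⁻ t, Y k t ^ 2) ^ (1 / 2 : ℝ) ≤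
      ENNReal.ofReal (2 * Real.pi) ^ (1 / 2 : ℝ) * ‖φ k‖ₑ ^ 2 := by
    intro k
    have h3 : ∀ t, Y k t ^ 2 = ∫⁻ x, ‖modePropagator t k (φ k) x‖ₑ ^ 4 := fun t => by
      simp only [hY]
      rw [← ENNReal.rpow_mul_natCast]
      norm_num
    simp only [h3]
    refine (ENNReal.rpow_le_rpow (strichartz_modePropagator k (φ k)) (by norm_num)).trans
      (le_of_eq ?_)
    rw [ENNReal.mul_rpow_of_nonneg _ _ (by norm_num), ← ENNReal.rpow_natCast_mul,
      ← ENNReal.rpow_natCast]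
    norm_num
  refine (pow_le_pow_left' (ENNReal.tsum_le_tsum h2) 2).trans (le_of_eq ?_)
  rw [ENNReal.tsum_mul_left, tsum_enorm_partialCoeff, mul_pow, ← ENNReal.rpow_mul_natCast,
    ← pow_mul]
  norm_num

theorem isStrichartzPair_freeEvolution :
    IsStrichartzPair freeEvolutionₗᵢ normFourTwo normFourThirdsTwo
      (Real.toNNReal (2 * Real.pi) ^ (1 / 4 : ℝ)) where
  continuous_apply f := continuous_freeEvolution f
  lsc := lowerSemicontinuous_normFourTwo
  add_le := normFourTwo_add_le
  enorm_inner_le := enorm_inner_le_normFourTwo_mul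
  strichartz f := by
    have h : ∀ t, normFourTwo (freeEvolutionₗᵢ t f) ^ (4 : ℝ) =
        weightedFour (fun _ => 1) (freeEvolution t f) := fun t => by
      rw [normFourTwo_eq, ← ENNReal.rpow_mul]
      norm_num
    simp only [h]
    refine (ENNReal.rpow_le_rpow (lintegral_weightedFour_freeEvolution_le f)
      (by norm_num)).trans (le_of_eq ?_)
    rw [ENNReal.mul_rpow_of_nonneg _ _ (by norm_num), ← ENNReal.rpow_natCast_mul,
      ENNReal.coe_rpow_of_nonneg _ (by norm_num), ← ENNReal.ofReal]
    norm_num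

/-! ### Sobolev embedding on the circle and the cubic nonlinearity -/

/-- The weight `⟨k⟩^{2s}` of `H^s(𝕋)`. -/
noncomputable def sobolevWeight (s : ℝ) (k : ℤ) : ℝ≥0∞ := ENNReal.ofReal ((1 + (k : ℝ) ^ 2) ^ s)

theorem sobolevWeight_ne_top (s : ℝ) (k : ℤ) : sobolevWeight s k ≠ ∞ := ENNReal.ofReal_ne_top

theorem sobolevWeight_ne_zero (s : ℝ) (k : ℤ) : sobolevWeight s k ≠ 0 := by
  rw [sobolevWeight, Ne, ENNReal.ofReal_eq_zero, not_le]
  positivity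

theorem one_le_sobolevWeight {s : ℝ} (hs : 0 ≤ s) (k : ℤ) : 1 ≤ sobolevWeight s k := by
  rw [sobolevWeight, ← ENNReal.ofReal_one]
  exact ENNReal.ofReal_le_ofReal (Real.one_le_rpow (by nlinarith [sq_nonneg (k : ℝ)]) hs)

/-- The constant `∑_k ⟨k⟩^{-2s}` in the embedding of `H^s(𝕋)` into `L^∞(𝕋)`. -/
noncomputable def sobolevConst (s : ℝ) : ℝ≥0∞ := ∑' k, (sobolevWeight s k)⁻¹

theorem sobolevConst_ne_top {s : ℝ} (hs : 1 / 2 < s) : sobolevConst s ≠ ∞ := by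
  have h1 : Summable fun k : ℤ => (1 + (k : ℝ) ^ 2) ^ (-s) := by
    refine Summable.of_norm_bounded_eventually
      (Real.summable_abs_int_rpow (show 1 < 2 * s by linarith)) ?_
    filter_upwards [(finite_singleton (0 : ℤ)).compl_mem_cofinite] with k hk
    have hk0 : (k : ℝ) ≠ 0 := by exact_mod_cast hk
    have hk' : 0 < |(k : ℝ)| := abs_pos.2 hk0
    rw [Real.norm_eq_abs, abs_of_nonneg (by positivity), neg_mul_eq_mul_neg, Real.rpow_mul hk'.le,
      Real.rpow_two, sq_abs]
    exact Real.rpow_le_rpow_of_nonpos (by positivity) (by linarith) (by linarith)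
  have h2 : ∀ k, (sobolevWeight s k)⁻¹ = ENNReal.ofReal ((1 + (k : ℝ) ^ 2) ^ (-s)) := by
    intro k
    rw [sobolevWeight, ← ENNReal.ofReal_inv_of_pos (by positivity), Real.rpow_neg (by positivity)]
  rw [sobolevConst]
  simp only [h2]
  exact h1.tsum_ofReal_ne_top

theorem tsum_mul_sq_le (a b : ℤ → ℝ≥0∞) :
    (∑' k, a k * b k) ^ 2 ≤ (∑' k, a k ^ 2) * ∑' k, b k ^ 2 := by
  have h := ENNReal.lintegral_mul_le_Lp_mul_Lq (Measure.count : Measure ℤ)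
    Real.HolderConjugate.two_two (f := a) (g := b) Measurable.of_discrete.aemeasurable
    Measurable.of_discrete.aemeasurable
  simp only [lintegral_count, Pi.mul_apply, ENNReal.rpow_two] at h
  refine (pow_le_pow_left' h 2).trans (le_of_eq ?_)
  rw [mul_pow, ← ENNReal.rpow_mul_natCast, ← ENNReal.rpow_mul_natCast]
  norm_num

/-- An `L²` function on the circle with summable Fourier coefficients is almost everywhere equal to
the sum of its Fourier series, hence bounded by the sum of the absolute values. -/
theorem ae_enorm_le_tsum_torusCoeff {g : Torus → ℂ} (hg : MemLp g 2 volume)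
    (h : ∑' k, ‖torusCoeff k g‖ₑ ≠ ∞) : ∀ᵐ y, ‖g y‖ₑ ≤ ∑' k, ‖torusCoeff k g‖ₑ := by
  have hg' : MemLp g 2 AddCircle.haarAddCircle := MeasureTheory.memLp_haarAddCircle_iff.2 hg
  have hle : ∀ k, ‖fourierCoeff g k‖ₑ ≤ ‖torusCoeff k g‖ₑ := by
    intro k
    rw [torusCoeff_eq_fourierCoeff, enorm_mul]
    refine le_mul_of_one_le_left zero_le ?_
    rw [← ofReal_norm, ← ENNReal.ofReal_one, Complex.norm_real, Real.norm_eq_abs,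
      abs_of_nonneg (Real.sqrt_nonneg _)]
    refine ENNReal.ofReal_le_ofReal (Real.one_le_sqrt.2 ?_)
    linarith [Real.pi_gt_three]
  have hfin : ∑' k, ‖fourierCoeff g k • (fourier k : C(Torus, ℂ))‖ₑ ≤ ∑' k, ‖torusCoeff k g‖ₑ := by
    refine ENNReal.tsum_le_tsum fun k => ?_
    rw [enorm_smul, ← ofReal_norm (fourier k : C(Torus, ℂ)), fourier_norm, ENNReal.ofReal_one,
      mul_one]
    exact hle k
  have hsum : Summable fun k => fourierCoeff g k • (fourier k : C(Torus, ℂ)) := by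
    refine Summable.of_norm ?_
    have := ENNReal.summable_toReal (ne_top_of_le_ne_top h hfin)
    simpa using this
  -- the Fourier series converges uniformly, and its sum agrees with `g` as an element of `L²`
  set G : C(Torus, ℂ) := ∑' k, fourierCoeff g k • (fourier k : C(Torus, ℂ)) with hG
  have h1 : ContinuousMap.toLp (E := ℂ) 2 AddCircle.haarAddCircle ℂ G = hg'.toLp g := by
    have e1 := hsum.hasSum.mapL (ContinuousMap.toLp (E := ℂ) 2 AddCircle.haarAddCircle ℂ)
    have e2 := hasSum_fourier_series_L2 (hg'.toLp g)
    rw [fourierCoeff_congr_ae hg'.coeFn_toLp] at e2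
    refine e1.unique ?_
    simpa using e2
  have h2 : g =ᵐ[AddCircle.haarAddCircle] G := by
    have e1 := ContinuousMap.coeFn_toLp (E := ℂ) (p := 2) (𝕜 := ℂ) AddCircle.haarAddCircle G
    rw [h1] at e1
    exact hg'.coeFn_toLp.symm.trans e1
  have h3 : g =ᵐ[volume] G := by
    rw [AddCircle.volume_eq_smul_haarAddCircle]
    exact Measure.ae_smul_measure h2 _
  have h4 : ‖G‖ₑ ≤ ∑' k, ‖torusCoeff k g‖ₑ := (enorm_tsum_le_tsum_enorm).trans hfin
  filter_upwards [h3] with y hy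
  rw [hy]
  refine le_trans ?_ h4
  rw [← ofReal_norm, ← ofReal_norm]
  exact ENNReal.ofReal_le_ofReal (G.norm_coe_le_norm y)

/-- The embedding of `H^s(𝕋)` into `L^∞(𝕋)`. It is vacuous for `s ≤ 1/2`, when the constant is
infinite. -/
theorem ae_enorm_sq_le_sobolev {g : Torus → ℂ} (hg : MemLp g 2 volume) (s : ℝ) :
    ∀ᵐ y, ‖g y‖ₑ ^ 2 ≤ sobolevConst s * ∑' k, sobolevWeight s k * ‖torusCoeff k g‖ₑ ^ 2 := by
  have hcs : (∑' k, ‖torusCoeff k g‖ₑ) ^ 2 ≤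
      sobolevConst s * ∑' k, sobolevWeight s k * ‖torusCoeff k g‖ₑ ^ 2 := by
    refine le_trans (le_of_eq ?_) ((tsum_mul_sq_le (fun k => (sobolevWeight s k) ^ (-(1 / 2) : ℝ))
      fun k => sobolevWeight s k ^ (1 / 2 : ℝ) * ‖torusCoeff k g‖ₑ).trans (le_of_eq ?_))
    · congr 1
      refine tsum_congr fun k => ?_
      rw [← mul_assoc, ← ENNReal.rpow_add _ _ (sobolevWeight_ne_zero s k)
        (sobolevWeight_ne_top s k)]
      norm_num
    · rw [sobolevConst]
      congr 1
      · refine tsum_congr fun k => ?_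
        rw [← ENNReal.rpow_mul_natCast, ← ENNReal.rpow_neg_one]
        norm_num
      · refine tsum_congr fun k => ?_
        rw [mul_pow, ← ENNReal.rpow_mul_natCast]
        norm_num
  -- if the series diverges, the right-hand side is infinite
  by_cases h : ∑' k, ‖torusCoeff k g‖ₑ = ∞
  · rw [h] at hcs
    exact Eventually.of_forall fun y => le_trans (by simp) hcs
  · filter_upwards [ae_enorm_le_tsum_torusCoeff hg h] with y hy
    exact (pow_le_pow_left' hy 2).trans hcs

/-- The square of the norm of the slice `f(x, ·)` in `H^s(𝕋)`. -/
noncomputable def sliceSobolevSq (s : ℝ) (f : L2) (x : Plane) : ℝ≥0∞ :=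
  ∑' k, sobolevWeight s k * ‖partialCoeff k f x‖ₑ ^ 2

theorem ae_ae_enorm_sq_le (s : ℝ) (f : L2) :
    ∀ᵐ x, ∀ᵐ y, ‖f (x, y)‖ₑ ^ 2 ≤ sobolevConst s * sliceSobolevSq s f x := by
  filter_upwards [ae_memLp_slice f, ae_all_iff.2 fun k => coeFn_partialCoeff k f] with x hx hk
  simp only [sliceSobolevSq, hk]
  exact ae_enorm_sq_le_sobolev hx s

theorem lintegral_torusSobolevNorm_pow_four (s : ℝ) (f : L2) :
    ∫⁻ x, torusSobolevNorm s (fun y => f (x, y)) ^ 4 = weightedFour (sobolevWeight s) f := by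
  refine lintegral_congr_ae ?_
  filter_upwards [ae_all_iff.2 fun k => coeFn_partialCoeff k f] with x hk
  simp only [hk, torusSobolevNorm, sobolevWeight]
  rw [← ENNReal.rpow_mul_natCast, ← ENNReal.rpow_natCast]
  norm_num

theorem enorm_cubic_sub_le (a b : ℂ) :
    ‖((‖a‖ ^ 2 : ℝ) : ℂ) * a - ((‖b‖ ^ 2 : ℝ) : ℂ) * b‖ₑ ≤
      2 * (‖a‖ₑ ^ 2 + ‖b‖ₑ ^ 2) * ‖a - b‖ₑ := by
  have h : ‖((‖a‖ ^ 2 : ℝ) : ℂ) * a - ((‖b‖ ^ 2 : ℝ) : ℂ) * b‖ ≤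
      2 * (‖a‖ ^ 2 + ‖b‖ ^ 2) * ‖a - b‖ := by
    have e : ((‖a‖ ^ 2 : ℝ) : ℂ) * a - ((‖b‖ ^ 2 : ℝ) : ℂ) * b =
        ((‖a‖ ^ 2 : ℝ) : ℂ) * (a - b) + (((‖a‖ - ‖b‖) * (‖a‖ + ‖b‖) : ℝ) : ℂ) * b := by
      push_cast; ring
    rw [e]
    refine (norm_add_le _ _).trans ?_
    rw [norm_mul, norm_mul, Complex.norm_real, Complex.norm_real, norm_mul, norm_pow, norm_norm,
      Real.norm_eq_abs, Real.norm_eq_abs, abs_of_nonneg (by positivity : 0 ≤ ‖a‖ + ‖b‖)]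
    have h1 : |‖a‖ - ‖b‖| ≤ ‖a - b‖ := abs_norm_sub_norm_le a b
    have h2 : |‖a‖ - ‖b‖| * (‖a‖ + ‖b‖) * ‖b‖ ≤ ‖a - b‖ * (‖a‖ + ‖b‖) * ‖b‖ := by gcongr
    have h3 : 0 ≤ ‖a - b‖ * (‖a‖ - ‖b‖) ^ 2 := by positivity
    nlinarith [mul_nonneg (norm_nonneg (a - b)) (sq_nonneg ‖a‖)]
  have := ENNReal.ofReal_le_ofReal h
  rwa [ofReal_norm, ENNReal.ofReal_mul (by positivity), ENNReal.ofReal_mul (by positivity),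
    ENNReal.ofReal_add (by positivity) (by positivity), ENNReal.ofReal_pow (norm_nonneg _),
    ENNReal.ofReal_pow (norm_nonneg _), ofReal_norm, ofReal_norm, ofReal_norm,
    ENNReal.ofReal_ofNat] at this

/-- `N` is the cubic nonlinearity `|u|² u`. -/
def IsCubic (u N : L2) : Prop := ∀ᵐ p, N p = ((‖u p‖ ^ 2 : ℝ) : ℂ) * u p

theorem IsCubic.translate {u N : L2} (h : IsCubic u N) (p : Plane × Torus) :
    IsCubic (translate p u) (translate p N) := by
  filter_upwards [coeFn_translate p u, coeFn_translate p N,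
    (measurePreserving_translate p).quasiMeasurePreserving.ae h] with q h1 h2 h3
  rw [h1, h2, h3]

theorem isCubic_zero : IsCubic 0 0 := Eventually.of_forall fun p => by simp

/-- The difference of two cubic nonlinearities in `L^{4/3}_x L²_y`, when `D₁` and `D₂` bound the
squares of the functions uniformly in `y`: Hölder's inequality with `3/4 = 1/2 + 1/4` in `x`. -/
theorem normFourThirdsTwo_cubic_sub_le {u₁ u₂ N₁ N₂ : L2} (h₁ : IsCubic u₁ N₁)
    (h₂ : IsCubic u₂ N₂) {D₁ D₂ : Plane → ℝ≥0∞} (hD₁ : AEMeasurable D₁) (hD₂ : AEMeasurable D₂)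
    (hu₁ : ∀ᵐ x, ∀ᵐ y, ‖u₁ (x, y)‖ₑ ^ 2 ≤ D₁ x) (hu₂ : ∀ᵐ x, ∀ᵐ y, ‖u₂ (x, y)‖ₑ ^ 2 ≤ D₂ x) :
    normFourThirdsTwo (N₁ - N₂) ≤
      2 * ((∫⁻ x, D₁ x ^ 2) ^ (1 / 2 : ℝ) + (∫⁻ x, D₂ x ^ 2) ^ (1 / 2 : ℝ)) *
        normFourTwo (u₁ - u₂) := by
  have hslice : ∀ᵐ x, sliceNorm (N₁ - N₂) x ≤ 2 * ((D₁ + D₂) x * sliceNorm (u₁ - u₂) x) := by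
    filter_upwards [hu₁, hu₂, ae_ae_of_ae h₁, ae_ae_of_ae h₂, ae_ae_of_ae (Lp.coeFn_sub N₁ N₂),
      ae_ae_of_ae (Lp.coeFn_sub u₁ u₂), ae_memLp_slice (u₁ - u₂)] with x e1 e2 e3 e4 e5 e6 e7
    rw [← ENNReal.pow_le_pow_left_iff two_ne_zero, mul_pow, mul_pow, ← mul_assoc, ← mul_pow,
      sliceNorm_sq, sliceNorm_sq, ← lintegral_const_mul'' _ (e7.1.enorm.pow_const 2)]
    refine lintegral_mono_ae ?_
    filter_upwards [e1, e2, e3, e4, e5, e6] with y d1 d2 d3 d4 d5 d6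
    rw [d5, d6, Pi.sub_apply, Pi.sub_apply, d3, d4, ← mul_pow]
    refine pow_le_pow_left' ((enorm_cubic_sub_le _ _).trans ?_) 2
    gcongr
    exact add_le_add d1 d2
  have hH := ENNReal.lintegral_Lp_mul_le_Lq_mul_Lr (p := 4 / 3) (q := 2) (r := 4) (by norm_num)
    (by norm_num) (by norm_num) (volume : Measure Plane) (hD₁.add hD₂)
    (aemeasurable_sliceNorm (u₁ - u₂))
  have hM := ENNReal.lintegral_Lp_add_le hD₁ hD₂ (by norm_num : (1 : ℝ) ≤ 2)
  simp only [ENNReal.rpow_two] at hH hM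
  calc normFourThirdsTwo (N₁ - N₂)
      ≤ (∫⁻ x, (2 * ((D₁ + D₂) x * sliceNorm (u₁ - u₂) x)) ^ (4 / 3 : ℝ)) ^ (3 / 4 : ℝ) := by
        refine ENNReal.rpow_le_rpow (lintegral_mono_ae ?_) (by norm_num)
        filter_upwards [hslice] with x hx
        exact ENNReal.rpow_le_rpow hx (by norm_num)
    _ = 2 * (∫⁻ x, ((D₁ + D₂) x * sliceNorm (u₁ - u₂) x) ^ (4 / 3 : ℝ)) ^ (3 / 4 : ℝ) := by
        simp only [ENNReal.mul_rpow_of_nonneg _ _ (by norm_num : (0 : ℝ) ≤ 4 / 3)]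
        rw [lintegral_const_mul' _ _ (by simp), ENNReal.mul_rpow_of_nonneg _ _ (by norm_num),
          ← ENNReal.rpow_mul]
        norm_num
    _ ≤ 2 * ((∫⁻ x, (D₁ + D₂) x ^ 2) ^ (1 / 2 : ℝ) * normFourTwo (u₁ - u₂)) := by
        gcongr
        rw [normFourTwo]
        simp only [one_div_div] at hH
        exact hH
    _ ≤ 2 * (((∫⁻ x, D₁ x ^ 2) ^ (1 / 2 : ℝ) + (∫⁻ x, D₂ x ^ 2) ^ (1 / 2 : ℝ)) *
          normFourTwo (u₁ - u₂)) := by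
        gcongr
    _ = _ := by rw [mul_assoc]

theorem lintegral_const_mul_sq_rpow_half {c : ℝ≥0∞} (hc : c ≠ ∞) (D : Plane → ℝ≥0∞) :
    (∫⁻ x, (c * D x) ^ 2) ^ (1 / 2 : ℝ) = c * (∫⁻ x, D x ^ 2) ^ (1 / 2 : ℝ) := by
  simp only [mul_pow]
  rw [lintegral_const_mul' _ _ (ENNReal.pow_ne_top hc), ENNReal.mul_rpow_of_nonneg _ _ (by norm_num),
    ← ENNReal.rpow_natCast_mul]
  norm_num

theorem normFourThirdsTwo_cubic_le {s : ℝ} (hs : 1 / 2 < s) {u N : L2} (h : IsCubic u N) :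
    normFourThirdsTwo N ≤
      4 * sobolevConst s * weightedFour (sobolevWeight s) u ^ (1 / 2 : ℝ) * normFourTwo u := by
  have h1 := normFourThirdsTwo_cubic_sub_le h isCubic_zero
    ((aemeasurable_weighted_tsum (sobolevWeight s) u).const_mul (sobolevConst s))
    (aemeasurable_const (b := (0 : ℝ≥0∞))) (ae_ae_enorm_sq_le s u)
    (Eventually.of_forall fun x => Eventually.of_forall fun y => by simp)
  rw [sub_zero, sub_zero, lintegral_const_mul_sq_rpow_half (sobolevConst_ne_top hs)] at h1
  refine h1.trans ?_
  simp only [weightedFour]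
  gcongr ?_ * _
  simp only [ne_eq, OfNat.ofNat_ne_zero, not_false_eq_true, zero_pow, lintegral_zero, one_div,
    inv_pos, Nat.ofNat_pos, ENNReal.zero_rpow_of_pos, add_zero, ← mul_assoc]
  gcongr
  norm_num

theorem normFourThirdsTwo_cubic_translate_sub_le {s : ℝ} (hs : 1 / 2 < s) {u N : L2}
    (h : IsCubic u N) (p : Plane × Torus) :
    normFourThirdsTwo (translate p N - N) ≤
      4 * sobolevConst s * weightedFour (sobolevWeight s) u ^ (1 / 2 : ℝ) *
        normFourTwo (translate p u - u) := by
  have hx := measurePreserving_add_right (volume : Measure Plane) p.1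
  have hy := measurePreserving_add_right (volume : Measure Torus) p.2
  have hD := (aemeasurable_weighted_tsum (sobolevWeight s) u).const_mul (sobolevConst s)
  have h1 := normFourThirdsTwo_cubic_sub_le (h.translate p) h
    (hD.comp_quasiMeasurePreserving hx.quasiMeasurePreserving) hD (by
      filter_upwards [hx.quasiMeasurePreserving.ae (ae_ae_enorm_sq_le s u),
        ae_ae_of_ae (coeFn_translate p u)] with x h1 h2
      filter_upwards [hy.quasiMeasurePreserving.ae h1, h2] with y h3 h4
      rw [h4]
      exact h3) (ae_ae_enorm_sq_le s u)
  refine h1.trans (le_of_eq ?_)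
  have h2 : ∫⁻ x : Plane, ((fun x => sobolevConst s *
      ∑' k, sobolevWeight s k * ‖partialCoeff k u x‖ₑ ^ 2) ∘ fun x => x + p.1) x ^ 2 =
      ∫⁻ x, (sobolevConst s * ∑' k, sobolevWeight s k * ‖partialCoeff k u x‖ₑ ^ 2) ^ 2 :=
    lintegral_add_right_eq_self (fun x : Plane => (sobolevConst s *
      ∑' k, sobolevWeight s k * ‖partialCoeff k u x‖ₑ ^ 2) ^ 2) p.1
  rw [h2, lintegral_const_mul_sq_rpow_half (sobolevConst_ne_top hs), weightedFour]
  ring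

theorem normFourTwo_pow_four_le {s : ℝ} (hs : 0 ≤ s) (f : L2) :
    normFourTwo f ^ (4 : ℝ) ≤ weightedFour (sobolevWeight s) f := by
  rw [normFourTwo_eq, ← ENNReal.rpow_mul]
  norm_num
  unfold weightedFour
  gcongr with x k
  exact one_le_sobolevWeight hs k

theorem normFourTwo_translate (p : Plane × Torus) (f : L2) :
    normFourTwo (translate p f) = normFourTwo f := by
  have hx := measurePreserving_add_right (volume : Measure Plane) p.1
  have h : ∀ᵐ x, sliceNorm (translate p f) x = sliceNorm f (x + p.1) := by
    filter_upwards [ae_ae_of_ae (coeFn_translate p f),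
      hx.quasiMeasurePreserving.ae (ae_memLp_slice f)] with x hx hm
    unfold sliceNorm
    rw [eLpNorm_congr_ae hx]
    exact eLpNorm_comp_measurePreserving hm.1 (measurePreserving_add_right volume p.2)
  rw [normFourTwo, normFourTwo]
  congr 1
  rw [← lintegral_add_right_eq_self (fun x => sliceNorm f x ^ (4 : ℝ)) p.1]
  refine lintegral_congr_ae ?_
  filter_upwards [h] with x hx
  rw [hx]

/-! ### Scattering -/

theorem tendsto_setLIntegral_Ioi_zero {G : ℝ → ℝ≥0∞} (hG : ∫⁻ r, G r ≠ ∞) :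
    Tendsto (fun t => ∫⁻ r in Ioi t, G r) atTop (𝓝 0) := by
  have h := tendsto_measure_iInter_atTop (μ := volume.withDensity G) (s := fun t : ℝ => Ioi t)
    (fun t => measurableSet_Ioi.nullMeasurableSet) (fun s t hst => Ioi_subset_Ioi hst)
    ⟨0, by
      rw [withDensity_apply _ measurableSet_Ioi]
      exact ne_top_of_le_ne_top hG (setLIntegral_le_lintegral _ _)⟩
  have h0 : ⋂ t : ℝ, Ioi t = ∅ :=
    eq_empty_of_forall_notMem fun x hx => lt_irrefl x (mem_iInter.1 hx x)
  rw [h0, measure_empty] at h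
  refine h.congr fun t => ?_
  rw [Function.comp_apply, withDensity_apply _ measurableSet_Ioi]

theorem freeEvolution_smul_real (t c : ℝ) (f : L2) :
    freeEvolution t (c • f) = c • freeEvolution t f :=
  ((freeEvolutionₗᵢ t).toLinearEquiv.toLinearMap.restrictScalars ℝ).map_smul c f

theorem freeEvolution_sub (t : ℝ) (f g : L2) :
    freeEvolution t (f - g) = freeEvolution t f - freeEvolution t g :=
  map_sub (freeEvolutionₗᵢ t) f g

theorem freeEvolution_neg_apply (t : ℝ) (f : L2) :
    freeEvolution t (freeEvolution (-t) f) = f := by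
  rw [← freeEvolution_add_time, add_neg_cancel, freeEvolution_zero]

theorem ae_sliceNorm_smul {c : ℂ} (hc : ‖c‖ = 1) (f : L2) :
    ∀ᵐ x, sliceNorm (c • f) x = sliceNorm f x := by
  have hc' : ‖c‖ₑ = 1 := by rw [← ofReal_norm, hc, ENNReal.ofReal_one]
  filter_upwards [ae_ae_of_ae (Lp.coeFn_smul c f)] with x hx
  unfold sliceNorm
  rw [eLpNorm_congr_ae hx]
  have := eLpNorm_const_smul c (fun y => f (x, y)) 2 volume
  rwa [hc', one_mul] at this

theorem normFourThirdsTwo_smul {c : ℂ} (hc : ‖c‖ = 1) (f : L2) :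
    normFourThirdsTwo (c • f) = normFourThirdsTwo f := by
  unfold normFourThirdsTwo
  congr 1
  refine lintegral_congr_ae ?_
  filter_upwards [ae_sliceNorm_smul hc f] with x hx
  rw [hx]

theorem normFourTwo_smul {c : ℂ} (hc : ‖c‖ = 1) (f : L2) :
    normFourTwo (c • f) = normFourTwo f := by
  unfold normFourTwo
  congr 1
  refine lintegral_congr_ae ?_
  filter_upwards [ae_sliceNorm_smul hc f] with x hx
  rw [hx]

/-- The free group in both directions of time. -/
theorem isStrichartzPair_mul {σ : ℝ} (hσ : σ = 1 ∨ σ = -1) :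
    IsStrichartzPair (fun t => freeEvolutionₗᵢ (σ * t)) normFourTwo normFourThirdsTwo
      (Real.toNNReal (2 * Real.pi) ^ (1 / 4 : ℝ)) := by
  have h := isStrichartzPair_freeEvolution
  refine ⟨fun f => (h.continuous_apply f).comp (continuous_const.mul continuous_id), h.lsc,
    h.add_le, h.enorm_inner_le, fun f => ?_⟩
  rcases hσ with rfl | rfl
  · simpa using h.strichartz f
  · simp only [neg_one_mul]
    rw [lintegral_neg_eq_self fun t => normFourTwo (freeEvolutionₗᵢ t f) ^ (4 : ℝ)]
    exact h.strichartz f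

/-- The derivative `-i e^{-irΔ} N(r)` of the profile `e^{-irΔ} u(r)` of a solution. -/
noncomputable def profileForcing (N : ℝ → L2) (r : ℝ) : L2 :=
  (-Complex.I) • freeEvolution (-r) (N r)

/-- Duhamel's formula for the profile `e^{-itΔ} u(t)`. -/
theorem IsGlobalSolution.exists_profileForcing {u : ℝ → L2} (hu : IsGlobalSolution u) :
    ∃ N : ℝ → L2, (∀ s, IsCubic (u s) (N s)) ∧
      (∀ s t, IntervalIntegrable (profileForcing N) volume s t) ∧
      ∀ s t, freeEvolution (-t) (u t) - freeEvolution (-s) (u s) =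
        ∫ r in s..t, profileForcing N r := by
  obtain ⟨N, hN, hD⟩ := hu.duhamel
  set A : ℝ → L2 →L[ℂ] L2 := fun t =>
    (-Complex.I) • (freeEvolutionₗᵢ (-t)).toContinuousLinearEquiv.toContinuousLinearMap with hA
  have hAF : ∀ t s, A t (freeEvolution (t - s) (N s)) = profileForcing N s := by
    intro t s
    change (-Complex.I) • freeEvolution (-t) (freeEvolution (t - s) (N s)) = _
    rw [← freeEvolution_add_time, profileForcing]
    congr 2
    ring
  have hint0 : ∀ t, IntervalIntegrable (profileForcing N) volume 0 t := by
    intro t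
    have h := (hD t).1
    have h' : IntervalIntegrable (fun s => A t (freeEvolution (t - s) (N s))) volume 0 t :=
      ⟨(A t).integrable_comp h.1, (A t).integrable_comp h.2⟩
    simpa only [hAF] using h'
  have hint : ∀ s t, IntervalIntegrable (profileForcing N) volume s t := fun s t =>
    (hint0 s).symm.trans (hint0 t)
  have hv0 : ∀ t, freeEvolution (-t) (u t) = u 0 + ∫ r in (0 : ℝ)..t, profileForcing N r := by
    intro t
    have h1 := (A t).intervalIntegral_comp_comm (hD t).1
    simp only [hAF] at h1
    rw [h1, (hD t).2, freeEvolution_sub, ← freeEvolution_add_time, neg_add_cancel,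
      freeEvolution_zero, freeEvolution_smul, sub_eq_add_neg, ← neg_smul]
    rfl
  refine ⟨N, hN, hint, fun s t => ?_⟩
  rw [hv0, hv0, add_sub_add_left_eq_sub,
    intervalIntegral.integral_interval_sub_left (hint0 t) (hint0 s)]

theorem IsGlobalSolution.continuous {u : ℝ → L2} (hu : IsGlobalSolution u) : Continuous u := by
  rw [continuous_iff_continuousAt]
  intro t₀
  rw [ContinuousAt, tendsto_iff_edist_tendsto_0]
  refine tendsto_of_tendsto_of_tendsto_of_le_of_le tendsto_const_nhds (hu.continuous_h1 t₀)
    (fun _ => zero_le) fun t => ?_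
  rw [edist_eq_enorm_sub]
  exact enorm_le_h1Norm _

/-- The image of the profile under an operator `T` that commutes with the free group is a controlled
path, for the direction of time given by the sign `σ`. It is applied to the identity and to the
increments `f ↦ f(· + p) - f`. -/
theorem isControlledPath_profile {u N : ℝ → L2} (hu : Continuous u)
    (hint : ∀ s t, IntervalIntegrable (profileForcing N) volume s t)
    (hsub : ∀ s t, freeEvolution (-t) (u t) - freeEvolution (-s) (u s) =
        ∫ r in s..t, profileForcing N r)
    {σ : ℝ} (hσ : σ = 1 ∨ σ = -1) {G : ℝ → ℝ≥0∞} {C₁ : ℝ≥0} (T : L2 →L[ℂ] L2)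
    (hT : ∀ t f, freeEvolution t (T f) = T (freeEvolution t f))
    (hb : ∀ r, normFourThirdsTwo (T (N r)) ≤ C₁ * G r ^ (1 / 2 : ℝ) * normFourTwo (T (u r)))
    (ha : ∫⁻ r, normFourTwo (T (u r)) ^ (4 : ℝ) ≠ ∞) :
    IsControlledPath (fun t => freeEvolutionₗᵢ (σ * t)) normFourTwo normFourThirdsTwo
      (fun r => G (σ * r)) C₁ (fun t => T (freeEvolution (-(σ * t)) (u (σ * t))))
      (fun r => T (σ • profileForcing N (σ * r))) := by
  have hσ0 : σ ≠ 0 := by rcases hσ with rfl | rfl <;> norm_num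
  have hσn : ‖((σ : ℝ) : ℂ) * -Complex.I‖ = 1 := by rcases hσ with rfl | rfl <;> simp
  have hr : ∀ f : L2, σ • f = ((σ : ℝ) : ℂ) • f := fun f => (algebraMap_smul ℂ σ f).symm
  have hUT : ∀ r, freeEvolution (σ * r) (T (freeEvolution (-(σ * r)) (u (σ * r)))) =
      T (u (σ * r)) := fun r => by rw [hT, freeEvolution_neg_apply]
  have hint' : ∀ s t, IntervalIntegrable (fun r => σ • profileForcing N (σ * r)) volume s t := by
    intro s t
    have h := ((hint (σ * s) (σ * t)).comp_mul_left (c := σ)).smul σ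
    rwa [mul_div_cancel_left₀ _ hσ0, mul_div_cancel_left₀ _ hσ0] at h
  refine ⟨?_, fun s t => ?_, fun s t => ?_, fun r => ?_, ?_⟩
  · refine T.continuous.comp ?_
    have hpair : IsStrichartzPair (fun t => freeEvolutionₗᵢ (-σ * t)) normFourTwo
        normFourThirdsTwo (Real.toNNReal (2 * Real.pi) ^ (1 / 4 : ℝ)) :=
      isStrichartzPair_mul (by rcases hσ with rfl | rfl <;> simp)
    have := hpair.continuous_comp (hu.comp (continuous_const.mul continuous_id' : Continuous
      fun t => σ * t))
    simpa using this
  · exact ⟨T.integrable_comp (hint' s t).1, T.integrable_comp (hint' s t).2⟩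
  · refine Eq.trans ?_ (T.intervalIntegral_comp_comm (hint' s t)).symm
    rw [intervalIntegral.integral_smul, intervalIntegral.smul_integral_comp_mul_left, ← hsub,
      map_sub]
  · have h1 : freeEvolution (σ * r) (T (σ • profileForcing N (σ * r))) =
        (((σ : ℝ) : ℂ) * -Complex.I) • T (N (σ * r)) := by
      rw [hT, freeEvolution_smul_real, profileForcing, freeEvolution_smul,
        freeEvolution_neg_apply, hr, smul_smul, map_smul]
    simp only [freeEvolutionₗᵢ_apply]
    rw [h1, hUT, normFourThirdsTwo_smul hσn]
    exact hb _
  · simp only [freeEvolutionₗᵢ_apply, hUT]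
    rcases hσ with rfl | rfl
    · simpa using ha
    · simp only [neg_one_mul]
      rwa [lintegral_neg_eq_self fun t => normFourTwo (T (u t)) ^ (4 : ℝ)]

/-- The increment `f ↦ f(· + p) - f`. -/
noncomputable def increment (p : Plane × Torus) : L2 →L[ℂ] L2 :=
  (translate p).toContinuousLinearMap - ContinuousLinearMap.id ℂ L2

theorem increment_apply (p : Plane × Torus) (f : L2) : increment p f = translate p f - f := rfl

theorem freeEvolution_increment (t : ℝ) (p : Plane × Torus) (f : L2) :
    freeEvolution t (increment p f) = increment p (freeEvolution t f) := by
  rw [increment_apply, freeEvolution_sub, freeEvolution_translate, increment_apply]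

/-- The profile and all its increments are Cauchy as `σ t → σ ∞`, at a rate `γ` that does not depend
on the increment. -/
theorem exists_enorm_profile_sub_le {u : ℝ → L2} (hu : IsGlobalSolution u) {s : ℝ} (hs : 1 / 2 < s)
    (hfin : ∫⁻ t, weightedFour (sobolevWeight s) (u t) ≠ ∞) {σ : ℝ} (hσ : σ = 1 ∨ σ = -1) :
    ∃ γ : ℝ → ℝ≥0∞, Tendsto γ atTop (𝓝 0) ∧ (∀ t, γ t ≠ ∞) ∧ (∀ s t, s ≤ t → γ t ≤ γ s) ∧
      ∀ r t, 0 ≤ r → r ≤ t →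
        ‖freeEvolution (-(σ * t)) (u (σ * t)) - freeEvolution (-(σ * r)) (u (σ * r))‖ₑ ≤
          γ r * ‖u 0‖ₑ ∧
        ∀ p, ‖increment p (freeEvolution (-(σ * t)) (u (σ * t)) -
          freeEvolution (-(σ * r)) (u (σ * r)))‖ₑ ≤ γ r * ‖increment p (u 0)‖ₑ := by
  obtain ⟨N, hN, hint, hsub⟩ := hu.exists_profileForcing
  set G : ℝ → ℝ≥0∞ := fun r => weightedFour (sobolevWeight s) (u r) with hGdef
  have hGm : Measurable fun r => G (σ * r) :=
    ((lowerSemicontinuous_weightedFour (sobolevWeight_ne_top s)).comp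
      (hu.continuous.comp (continuous_const.mul continuous_id'))).measurable
  have hGfin : ∫⁻ r, G (σ * r) ≠ ∞ := by
    rcases hσ with rfl | rfl
    · simpa using hfin
    · simp only [neg_one_mul]
      rwa [lintegral_neg_eq_self G]
  obtain ⟨C₁, hC₁⟩ : ∃ C₁ : ℝ≥0, (C₁ : ℝ≥0∞) = 4 * sobolevConst s :=
    ⟨_, ENNReal.coe_toNNReal (ENNReal.mul_ne_top (by simp) (sobolevConst_ne_top hs))⟩
  obtain ⟨K, hK⟩ := IsControlledPath.exists_enorm_sub_le (isStrichartzPair_mul hσ) hGm hGfin C₁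
  have hau : ∫⁻ r, normFourTwo (u r) ^ (4 : ℝ) ≠ ∞ :=
    ne_top_of_le_ne_top hfin (lintegral_mono fun r => normFourTwo_pow_four_le (by linarith) _)
  have h0 : freeEvolution (-(σ * 0)) (u (σ * 0)) = u 0 := by simp [freeEvolution_zero]
  have hid := isControlledPath_profile hu.continuous hint hsub hσ (G := G) (C₁ := C₁)
    (ContinuousLinearMap.id ℂ L2) (fun _ _ => rfl) (fun r => by
      rw [hC₁]; exact normFourThirdsTwo_cubic_le hs (hN r)) hau
  have hinc : ∀ p, _ := fun p =>
    isControlledPath_profile hu.continuous hint hsub hσ (G := G) (C₁ := C₁)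
    (increment p) (fun t f => freeEvolution_increment t p f) (fun r => by
      rw [hC₁]; exact normFourThirdsTwo_cubic_translate_sub_le hs (hN r) p) (by
      have hle : ∀ r, normFourTwo (increment p (u r)) ^ (4 : ℝ) ≤
          16 * normFourTwo (u r) ^ (4 : ℝ) := by
        intro r
        have h1 : normFourTwo (increment p (u r)) ≤ 2 * normFourTwo (u r) := by
          have e : increment p (u r) = translate p (u r) + (-1 : ℂ) • u r := by
            rw [increment_apply, neg_one_smul, sub_eq_add_neg]
          rw [e]
          exact ((normFourTwo_add_le _ _).trans (add_le_add (normFourTwo_translate p _).le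
            (normFourTwo_smul (by simp) _).le)).trans (two_mul _).ge
        refine (ENNReal.rpow_le_rpow h1 (by norm_num)).trans (le_of_eq ?_)
        rw [ENNReal.mul_rpow_of_nonneg _ _ (by norm_num)]
        norm_num
      refine ne_top_of_le_ne_top ?_ (lintegral_mono hle)
      rw [lintegral_const_mul' _ _ (by simp)]
      exact ENNReal.mul_ne_top (by simp) hau)
  refine ⟨fun t => K * (∫⁻ r in Ioi t, G (σ * r)) ^ (1 / 2 : ℝ), ?_, fun t => ?_,
    fun a b hab => ?_, fun r t hr hrt => ⟨?_, fun p => ?_⟩⟩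
  · have h1 := (ENNReal.continuous_rpow_const (y := (1 / 2 : ℝ))).tendsto 0 |>.comp
      (tendsto_setLIntegral_Ioi_zero hGfin)
    rw [ENNReal.zero_rpow_of_pos (by norm_num)] at h1
    have h2 := ENNReal.Tendsto.const_mul (a := (K : ℝ≥0∞)) h1 (Or.inr ENNReal.coe_ne_top)
    simpa using h2
  · exact ENNReal.mul_ne_top ENNReal.coe_ne_top (ENNReal.rpow_ne_top_of_nonneg (by norm_num)
      (ne_top_of_le_ne_top hGfin (setLIntegral_le_lintegral _ _)))
  · dsimp only
    gcongr
  · have h := hK _ _ hid r t hr hrt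
    rw [h0] at h
    exact h
  · have h := hK _ _ (hinc p) r t hr hrt
    rw [h0, ← map_sub] at h
    exact h

/-- Scattering in `H¹` in the direction of time given by the sign `σ`. -/
theorem exists_scattering_state {u : ℝ → L2} (hu : IsGlobalSolution u) {s : ℝ} (hs : 1 / 2 < s)
    (hfin : ∫⁻ t, weightedFour (sobolevWeight s) (u t) ≠ ∞) {σ : ℝ} (hσ : σ = 1 ∨ σ = -1) :
    ∃ φ : L2, MemH1 φ ∧
      Tendsto (fun t => h1Norm (u (σ * t) - freeEvolution (σ * t) φ)) atTop (𝓝 0) := by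
  obtain ⟨γ, hγ0, hγfin, hγanti, hγ⟩ := exists_enorm_profile_sub_le hu hs hfin hσ
  set v : ℝ → L2 := fun t => freeEvolution (-(σ * t)) (u (σ * t)) with hv
  have hv0 : v 0 = u 0 := by simp [hv, freeEvolution_zero]
  have hM : h1Norm (u 0) ≠ ∞ := (hu.memH1 0).ne
  have hcauchy : CauchySeq v := by
    rw [EMetric.cauchySeq_iff]
    intro ε hε
    have hlim : Tendsto (fun t => γ t * ‖u 0‖ₑ) atTop (𝓝 0) := by
      have := ENNReal.Tendsto.mul_const (b := ‖u 0‖ₑ) hγ0 (Or.inr enorm_ne_top)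
      simpa using this
    obtain ⟨R, hR, hR0⟩ := ((hlim.eventually_lt_const hε).and (eventually_ge_atTop 0)).exists
    have hord : ∀ m n, R ≤ m → m ≤ n → edist (v n) (v m) < ε := fun m n hm hmn => by
      rw [edist_eq_enorm_sub]
      refine ((hγ m n (hR0.trans hm) hmn).1.trans ?_).trans_lt hR
      gcongr
      exact hγanti _ _ hm
    refine ⟨R, fun m hm n hn => ?_⟩
    rcases le_total m n with h | h
    · rw [edist_comm]; exact hord m n hm h
    · exact hord n m hn h
  obtain ⟨φ, hφ⟩ := cauchySeq_tendsto_of_complete hcauchy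
  -- let `t → ∞` in the Cauchy estimates
  have hlimit : ∀ r, 0 ≤ r → ‖φ - v r‖ₑ ≤ γ r * ‖u 0‖ₑ := fun r hr => by
    refine le_of_tendsto ((continuous_enorm.tendsto _).comp (hφ.sub_const (v r))) ?_
    filter_upwards [eventually_ge_atTop r] with t ht
    exact (hγ r t hr ht).1
  have hlimit' : ∀ r, 0 ≤ r → ∀ p, ‖increment p (φ - v r)‖ₑ ≤ γ r * ‖increment p (u 0)‖ₑ :=
    fun r hr p => by
      refine le_of_tendsto (((continuous_enorm.comp (increment p).continuous).tendsto _).comp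
        (hφ.sub_const (v r))) ?_
      filter_upwards [eventually_ge_atTop r] with t ht
      exact (hγ r t hr ht).2 p
  refine ⟨φ, ?_, ?_⟩
  · have hp : ∀ p, ‖increment p φ‖ₑ ≤ (γ 0 + 1) * ‖increment p (u 0)‖ₑ := fun p => by
      have e : increment p φ = increment p (φ - v 0) + increment p (u 0) := by
        rw [← map_add, hv0, sub_add_cancel]
      rw [e, add_mul, one_mul]
      exact (enorm_add_le _ _).trans (add_le_add (hlimit' 0 le_rfl p) le_rfl)
    have h := h1Norm_le_of_translate (f := φ) (K := (γ 0 + 1) * h1Norm (u 0)) (fun h => by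
      refine (hp (h, 0)).trans ?_
      rw [mul_left_comm]
      gcongr
      exact enorm_translate_plane_sub_le h (u 0)) fun η => by
      refine (hp (0, (η : Torus))).trans ?_
      rw [mul_left_comm]
      gcongr
      exact enorm_translate_torus_sub_le η (u 0)
    refine h.trans_lt (ENNReal.mul_lt_top (by simp) (ENNReal.add_lt_top.2 ⟨enorm_lt_top,
      ENNReal.mul_lt_top (by simp) (ENNReal.mul_lt_top
        (ENNReal.add_lt_top.2 ⟨(hγfin 0).lt_top, by simp⟩) hM.lt_top)⟩))
  · have hle : ∀ r, 0 ≤ r → h1Norm (u (σ * r) - freeEvolution (σ * r) φ) ≤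
        γ r * (6 * h1Norm (u 0)) := by
      intro r hr
      set f := u (σ * r) - freeEvolution (σ * r) φ with hf
      have e : f = freeEvolution (σ * r) (v r - φ) := by
        rw [freeEvolution_sub, hv]
        simp only [freeEvolution_neg_apply, hf]
      have hnorm : ‖f‖ₑ ≤ γ r * ‖u 0‖ₑ := by
        rw [e, enorm_freeEvolution, enorm_sub_rev]
        exact hlimit r hr
      have hinc : ∀ p, ‖translate p f - f‖ₑ ≤ γ r * ‖increment p (u 0)‖ₑ := fun p => by
        rw [← increment_apply, e, ← freeEvolution_increment, enorm_freeEvolution, map_sub,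
          enorm_sub_rev, ← map_sub]
        exact hlimit' r hr p
      have h := h1Norm_le_of_translate (f := f) (K := γ r * h1Norm (u 0)) (fun h => by
        refine (hinc (h, 0)).trans ?_
        rw [mul_left_comm]
        gcongr
        exact enorm_translate_plane_sub_le h (u 0)) fun η => by
        refine (hinc (0, (η : Torus))).trans ?_
        rw [mul_left_comm]
        gcongr
        exact enorm_translate_torus_sub_le η (u 0)
      calc _ ≤ _ := h
        _ ≤ 2 * (γ r * h1Norm (u 0) + 2 * (γ r * h1Norm (u 0))) := by
            gcongr
            exact hnorm.trans (by gcongr; exact enorm_le_h1Norm _)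
        _ = _ := by ring
    have hlim : Tendsto (fun r => γ r * (6 * h1Norm (u 0))) atTop (𝓝 0) := by
      have := ENNReal.Tendsto.mul_const (b := 6 * h1Norm (u 0)) hγ0
        (Or.inr (ENNReal.mul_ne_top (by simp) hM))
      simpa using this
    refine tendsto_of_tendsto_of_tendsto_of_le_of_le' tendsto_const_nhds hlim
      (Eventually.of_forall fun _ => zero_le) ?_
    filter_upwards [eventually_ge_atTop 0] with r hr
    exact hle r hr

end Waveguide

theorem theorem2p5 (ε₀ : ℝ) (hε₀ : 0 < ε₀) (hε₀' : ε₀ < 1 / 2) (L M : ℝ) (hL : 0 < L) (hM : 0 < M)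
    (u : ℝ → Waveguide.L2) (hu : Waveguide.IsGlobalSolution u)
    (huL : Waveguide.spaceTimeNorm (1 - ε₀) u ≤ ENNReal.ofReal L)
    (huM : Waveguide.h1Norm (u 0) ≤ ENNReal.ofReal M) :
    ∃ uplus uminus : Waveguide.L2, Waveguide.MemH1 uplus ∧ Waveguide.MemH1 uminus ∧
      Filter.Tendsto (fun t : ℝ => Waveguide.h1Norm (u t - Waveguide.freeEvolution t uplus))
        Filter.atTop (nhds 0) ∧
      Filter.Tendsto (fun t : ℝ => Waveguide.h1Norm (u t - Waveguide.freeEvolution t uminus))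
        Filter.atBot (nhds 0) := by
  have hs : 1 / 2 < 1 - ε₀ := by linarith
  have hfin : MeasureTheory.lintegral MeasureTheory.volume
      (fun t => Waveguide.weightedFour (Waveguide.sobolevWeight (1 - ε₀)) (u t)) ≠ ⊤ := by
    intro h
    rw [Waveguide.spaceTimeNorm] at huL
    simp only [Waveguide.lintegral_torusSobolevNorm_pow_four] at huL
    rw [h, ENNReal.top_rpow_of_pos (by norm_num)] at huL
    exact absurd huL (by simp)
  obtain ⟨φ, hφ, hφlim⟩ := Waveguide.exists_scattering_state hu hs hfin (Or.inl rfl)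
  obtain ⟨ψ, hψ, hψlim⟩ := Waveguide.exists_scattering_state hu hs hfin (Or.inr rfl)
  refine ⟨φ, ψ, hφ, hψ, by simpa using hφlim, ?_⟩
  simpa [Function.comp_def] using hψlim.comp Filter.tendsto_neg_atBot_atTop
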